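/- There are algorithms with the following property. Let $G$ be an $n$-node $m$-edge directed acyclic graph whose edges $e$ have arbitrary (possibly negative) real weights $w(e)$, let $r$ and $s$ be any two nodes of $G$, and let $P$ be any given shortest path of $G$ from $r$ to $s$, where the weight of a path is the sum of the weights of its edges. For a graph $H$ containing $r$ and $s$, let $d_H(r,s)$ be the minimum weight of a path of $H$ from $r$ to $s$, or $\infty$ if there is no such path. Given $G$, $r$, $s$ and $P$, it takes $O(n+m)$ time, with an absolute implied constant, (1) to compute $d_{G-e}(r,s)$ for all edges $e$ of $P$ (the edge-avoiding replacement-paths problem), where $G-e$ is $G$ with the edge $e$ deleted; and also (2) to compute $d_{G-v}(r,s)$ for all nodes $v$ of $P$ other than $r$ and $s$ (the node-avoiding replacement-paths problem), where $G-v$ is $G$ with the node $v$ and its incident edges deleted. Here time is the number of steps of a random access machine whose integers have $O(\log(n+m+2))$ bits, and which handles edge weights and distances only by copying, adding and comparing them at unit cost. -/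

import Mathlib

/-! Weighted directed graphs (parallel edges allowed, real weights of either sign). -/

/-- A directed graph with real edge weights. Its nodes are the members of `verts`, its edges the
members of `edges`; edge `e` leads from `src e` to `dst e`. -/
structure WDigraph (V E : Type) where
  verts : Set V
  edges : Set E
  src : E → V
  dst : E → V
  weight : E → ℝ
  src_mem : ∀ e ∈ edges, src e ∈ verts
  dst_mem : ∀ e ∈ edges, dst e ∈ verts

namespace WDigraph

variable {V E : Type}

/-- The graph with node set `Fin n` and edge set `Fin m` with the given endpoints and weights. -/
def ofArrays {n m : ℕ} (src dst : Fin m → Fin n) (w : Fin m → ℝ) : WDigraph (Fin n) (Fin m) where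
  verts := Set.univ
  edges := Set.univ
  src := src
  dst := dst
  weight := w
  src_mem := fun _ _ => Set.mem_univ _
  dst_mem := fun _ _ => Set.mem_univ _

/-- `G - e`. -/
def deleteEdge (G : WDigraph V E) (e : E) : WDigraph V E where
  verts := G.verts
  edges := {f | f ∈ G.edges ∧ f ≠ e}
  src := G.src
  dst := G.dst
  weight := G.weight
  src_mem := fun f hf => G.src_mem f hf.1
  dst_mem := fun f hf => G.dst_mem f hf.1

/-- `G - v`: delete the node `v` and its incident edges. -/
def deleteNode (G : WDigraph V E) (v : V) : WDigraph V E where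
  verts := {u | u ∈ G.verts ∧ u ≠ v}
  edges := {f | f ∈ G.edges ∧ G.src f ≠ v ∧ G.dst f ≠ v}
  src := G.src
  dst := G.dst
  weight := G.weight
  src_mem := fun f hf => ⟨G.src_mem f hf.1, hf.2.1⟩
  dst_mem := fun f hf => ⟨G.dst_mem f hf.1, hf.2.2⟩

/-- The edge sequence `es` is a walk of `G` from `u` to `v`. -/
def IsWalk (G : WDigraph V E) : V → List E → V → Prop
  | u, [], v => u ∈ G.verts ∧ u = v
  | u, e :: es, v => e ∈ G.edges ∧ G.src e = u ∧ G.IsWalk (G.dst e) es v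

/-- No closed walk with at least one edge. -/
def Acyclic (G : WDigraph V E) : Prop :=
  ∀ u es, G.IsWalk u es u → es = []

/-- The nodes `v₀ = u, v₁, …, v_p` of a walk from `u` with `p` edges. -/
def nodes (G : WDigraph V E) (u : V) (es : List E) : List V :=
  u :: es.map G.dst

/-- A path is a walk without repeated nodes. -/
def IsPath (G : WDigraph V E) (u : V) (es : List E) (v : V) : Prop :=
  G.IsWalk u es v ∧ (G.nodes u es).Nodup

/-- The sum of the edge weights. -/
def pathWeight (G : WDigraph V E) (es : List E) : ℝ :=
  (es.map G.weight).sum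

/-- `d` is the distance from `u` to `v` in `G`: the minimum of the weights of the paths from `u`
to `v`, and `⊤` (infinity) if there is no such path. -/
def IsDist (G : WDigraph V E) (u v : V) (d : WithTop ℝ) : Prop :=
  IsLeast (insert ⊤ {x : WithTop ℝ | ∃ es, G.IsPath u es v ∧ x = (G.pathWeight es : ℝ)}) d

/-- `es` is a shortest path of `G` from `u` to `v`. -/
def IsShortestPath (G : WDigraph V E) (u : V) (es : List E) (v : V) : Prop :=
  G.IsPath u es v ∧ G.IsDist u v (G.pathWeight es : ℝ)

end WDigraph

/-! A random access machine with bounded integer words, in which weights are an abstract data type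
that only supports copying, addition and comparison (the comparison-addition model).

Programs are finite and use integer variables, integer arrays and weight arrays, all named by
numerals. Every integer a program computes has to be smaller than the bound `B`, otherwise the
computation gets stuck. Every elementary operation takes one step. -/

namespace RAM

/-- The contents of the memory: variables, integer arrays, weight arrays. -/
structure Mem where
  var : ℕ → ℕ
  arr : ℕ → ℕ → ℕ
  warr : ℕ → ℕ → WithTop ℝ

/-- The value `v`, if it fits into a word. -/
def fit (B v : ℕ) : Option ℕ := if v < B then some v else none

/-- Arithmetic operations on words. Subtraction is truncated at zero. -/
inductive Op where
  | add | sub | mul | div | mod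

def Op.eval : Op → ℕ → ℕ → ℕ
  | .add, a, b => a + b
  | .sub, a, b => a - b
  | .mul, a, b => a * b
  | .div, a, b => a / b
  | .mod, a, b => a % b

/-- Integer expressions: numerals, variables, array elements, arithmetic. -/
inductive IExp where
  | lit (c : ℕ)
  | var (x : ℕ)
  | get (a : ℕ) (i : IExp)
  | op (o : Op) (e₁ e₂ : IExp)

/-- The value of an expression; `none` if some intermediate result does not fit into a word. -/
def IExp.eval (B : ℕ) (σ : Mem) : IExp → Option ℕ
  | .lit c => fit B c
  | .var x => some (σ.var x)
  | .get a i => (i.eval B σ).map (σ.arr a)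
  | .op o e₁ e₂ =>
    (e₁.eval B σ).bind fun v₁ => (e₂.eval B σ).bind fun v₂ => fit B (o.eval v₁ v₂)

/-- The number of elementary operations in an expression. -/
def IExp.cost : IExp → ℕ
  | .lit _ => 1
  | .var _ => 1
  | .get _ i => i.cost + 1
  | .op _ e₁ e₂ => e₁.cost + e₂.cost + 1

/-- Weight expressions: the constants zero and infinity, array elements, sums. -/
inductive WExp where
  | zero
  | top
  | get (a : ℕ) (i : IExp)
  | add (e₁ e₂ : WExp)

noncomputable def WExp.eval (B : ℕ) (σ : Mem) : WExp → Option (WithTop ℝ)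
  | .zero => some 0
  | .top => some ⊤
  | .get a i => (i.eval B σ).map (σ.warr a)
  | .add e₁ e₂ =>
    (e₁.eval B σ).bind fun v₁ => (e₂.eval B σ).map fun v₂ => v₁ + v₂

def WExp.cost : WExp → ℕ
  | .zero => 1
  | .top => 1
  | .get _ i => i.cost + 1
  | .add e₁ e₂ => e₁.cost + e₂.cost + 1

/-- Conditions: comparisons of integers, comparisons of weights, Boolean combinations. -/
inductive Cond where
  | lt (e₁ e₂ : IExp)
  | eq (e₁ e₂ : IExp)
  | wlt (e₁ e₂ : WExp)
  | not (c : Cond)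
  | and (c₁ c₂ : Cond)

noncomputable def Cond.eval (B : ℕ) (σ : Mem) : Cond → Option Bool
  | .lt e₁ e₂ =>
    (e₁.eval B σ).bind fun v₁ => (e₂.eval B σ).map fun v₂ => decide (v₁ < v₂)
  | .eq e₁ e₂ =>
    (e₁.eval B σ).bind fun v₁ => (e₂.eval B σ).map fun v₂ => decide (v₁ = v₂)
  | .wlt e₁ e₂ =>
    (e₁.eval B σ).bind fun v₁ => (e₂.eval B σ).map fun v₂ => decide (v₁ < v₂)
  | .not c => (c.eval B σ).map fun b => !b
  | .and c₁ c₂ =>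
    (c₁.eval B σ).bind fun b₁ => (c₂.eval B σ).map fun b₂ => b₁ && b₂

def Cond.cost : Cond → ℕ
  | .lt e₁ e₂ => e₁.cost + e₂.cost + 1
  | .eq e₁ e₂ => e₁.cost + e₂.cost + 1
  | .wlt e₁ e₂ => e₁.cost + e₂.cost + 1
  | .not c => c.cost + 1
  | .and c₁ c₂ => c₁.cost + c₂.cost + 1

/-- Programs. `assign x e` is `x := e`, `store a i e` is `a[i] := e` for an integer array,
`wstore a i e` is `a[i] := e` for a weight array, `loop c p` is `while c do p`. -/
inductive Prog where
  | skip
  | assign (x : ℕ) (e : IExp)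
  | store (a : ℕ) (i e : IExp)
  | wstore (a : ℕ) (i : IExp) (e : WExp)
  | seq (p q : Prog)
  | ite (c : Cond) (p q : Prog)
  | loop (c : Cond) (p : Prog)

def Mem.setVar (σ : Mem) (x v : ℕ) : Mem :=
  { σ with var := Function.update σ.var x v }

def Mem.setArr (σ : Mem) (a i v : ℕ) : Mem :=
  { σ with arr := Function.update σ.arr a (Function.update (σ.arr a) i v) }

def Mem.setWarr (σ : Mem) (a i : ℕ) (v : WithTop ℝ) : Mem :=
  { σ with warr := Function.update σ.warr a (Function.update (σ.warr a) i v) }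

/-- `Run B p σ t τ`: with words bounded by `B`, the program `p` started on memory `σ` halts after
exactly `t` steps with memory `τ`. -/
inductive Run (B : ℕ) : Prog → Mem → ℕ → Mem → Prop
  | skip (σ : Mem) : Run B .skip σ 1 σ
  | assign {x : ℕ} {e : IExp} {σ : Mem} {v : ℕ} (he : e.eval B σ = some v) :
      Run B (.assign x e) σ (e.cost + 1) (σ.setVar x v)
  | store {a : ℕ} {i e : IExp} {σ : Mem} {k v : ℕ}
      (hi : i.eval B σ = some k) (he : e.eval B σ = some v) :
      Run B (.store a i e) σ (i.cost + e.cost + 1) (σ.setArr a k v)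
  | wstore {a : ℕ} {i : IExp} {e : WExp} {σ : Mem} {k : ℕ} {v : WithTop ℝ}
      (hi : i.eval B σ = some k) (he : e.eval B σ = some v) :
      Run B (.wstore a i e) σ (i.cost + e.cost + 1) (σ.setWarr a k v)
  | seq {p q : Prog} {σ τ υ : Mem} {t₁ t₂ : ℕ} (hp : Run B p σ t₁ τ) (hq : Run B q τ t₂ υ) :
      Run B (.seq p q) σ (t₁ + t₂) υ
  | iteTrue {c : Cond} {p q : Prog} {σ τ : Mem} {t : ℕ}
      (hc : c.eval B σ = some true) (hp : Run B p σ t τ) :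
      Run B (.ite c p q) σ (c.cost + t + 1) τ
  | iteFalse {c : Cond} {p q : Prog} {σ τ : Mem} {t : ℕ}
      (hc : c.eval B σ = some false) (hq : Run B q σ t τ) :
      Run B (.ite c p q) σ (c.cost + t + 1) τ
  | loopTrue {c : Cond} {p : Prog} {σ τ υ : Mem} {t₁ t₂ : ℕ}
      (hc : c.eval B σ = some true) (hp : Run B p σ t₁ τ) (hl : Run B (.loop c p) τ t₂ υ) :
      Run B (.loop c p) σ (c.cost + t₁ + t₂ + 1) υ
  | loopFalse {c : Cond} {p : Prog} {σ : Mem} (hc : c.eval B σ = some false) :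
      Run B (.loop c p) σ (c.cost + 1) σ

/-- The initial memory: variables 0 to 4 hold `n`, `m`, `r`, `s` and the number of edges of `P`;
integer arrays 0, 1, 2 hold the tails of the edges, the heads of the edges, and the edges of `P`
in order; weight array 0 holds the edge weights; everything else is zero. -/
noncomputable def input {n m : ℕ} (src dst : Fin m → Fin n) (w : Fin m → ℝ) (r s : Fin n)
    (P : List (Fin m)) : Mem where
  var := fun x =>
    if x = 0 then n else if x = 1 then m else if x = 2 then r else if x = 3 then s
    else if x = 4 then P.length else 0
  arr := fun a i =>
    if a = 0 then (if h : i < m then (src ⟨i, h⟩ : ℕ) else 0)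
    else if a = 1 then (if h : i < m then (dst ⟨i, h⟩ : ℕ) else 0)
    else if a = 2 then (if h : i < P.length then (P[i] : ℕ) else 0)
    else 0
  warr := fun a i =>
    if a = 0 then (if h : i < m then ((w ⟨i, h⟩ : ℝ) : WithTop ℝ) else 0) else 0

end RAM

/-- Weight array 1 holds a solution of the edge-avoiding replacement-paths problem on `G` with
respect to the path `P` from `r` to `s`: the `i`-th entry is the distance from `r` to `s` in `G`
minus the `i`-th edge of `P`. -/
def SolvesEdgeAvoiding {V E : Type} (G : WDigraph V E) (r s : V) (P : List E) (τ : RAM.Mem) :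
    Prop :=
  ∀ (i : ℕ) (h : i < P.length), (G.deleteEdge P[i]).IsDist r s (τ.warr 1 i)

/-- Weight array 1 holds a solution of the node-avoiding replacement-paths problem on `G` with
respect to the path `P` from `r` to `s`: whenever the `i`-th node `v` of `P` is different from `r`
and `s`, the `i`-th entry is the distance from `r` to `s` in `G - v`. -/
def SolvesNodeAvoiding {V E : Type} (G : WDigraph V E) (r s : V) (P : List E) (τ : RAM.Mem) :
    Prop :=
  ∀ (i : ℕ) (h : i < (G.nodes r P).length), (G.nodes r P)[i] ≠ r → (G.nodes r P)[i] ≠ s →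
    (G.deleteNode (G.nodes r P)[i]).IsDist r s (τ.warr 1 i)

/-!
Order the nodes topologically, `pos v` being the position of `v`, and compute the distances `d`
from `r` and `t` to `s` by relaxing the edges in the order of their tails, and backwards. Fix the
`i`-th edge `e` of `P`, with tail `v`, and let `z = pos v`. Every walk from `r` to `s` passes from
the positions up to `z` to those after `z` by exactly one edge `f`, and `e` is the only edge of `P`
that does so. Conversely, if an edge `f` outside `P` passes over `z`, then a shortest walk through
`f` visits only positions up to `pos (src f)` and from `pos (dst f)` on, so it avoids `e`. Hence the
distance in `G - e` is the minimum of `d (src f) + w f + t (dst f)` over the edges `f` outside `P`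
with `pos (src f) ≤ z < pos (dst f)`. If the tail of `f` is required to lie strictly before `z`, the
same holds for `G - v` (`IsDetour.isDist`).

So both problems reduce to this one: given `m` intervals of positions with costs, sorted by their
left ends, find for every position the minimal cost of an interval containing it, in time
`O(n + m)`. The positions are divided into blocks of length `b = ⌊log₂ (n + 1)⌋`.

* An interval that begins in an earlier block than the one it ends in is entered at its right end;
  suffix minima within the blocks deal with its last block (`sweepBack_reaches`).
* The blocks strictly between its first and its last one are covered by two overlapping ranges of
  `2 ^ j` blocks, whose cells in a sparse table receive the cost. Pushing the table down row by row
  gives the minimum for every block. The table has `(b + 1) (⌊n / b⌋ + 1) ≤ 3 n + 1` cells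
  (`spread_reaches`, `pushDown_reaches`).
* What remains are the positions in the block in which the interval begins. A sweep from left to
  right keeps, for the intervals seen so far in the block, the staircase of the costs that are not
  dominated by the cost of an interval reaching at least as far. Its corners are the bits of a
  number below `2 ^ b ≤ n + 1`, hence of a word, and the successor and the predecessor of a corner
  are found by dividing by powers of two and looking up the lowest and the highest bit in tables of
  size `O(n)` (`sweep_reaches`). Every pass of this loop consumes an interval, a corner or a
  position, so the passes are linear in number.

Programs are verified by weakest preconditions of loop-free code and invariants for loops. No loop
contains another one, so a program takes at most `S` times a constant if each of its loops makes
fewer than `S` passes; this is the time bound in `RAM.Reaches`. The values that a program leaves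
unchanged are tracked by `RAM.Frame`, whose side conditions are decided by evaluation.
-/

/-! ### Expressions and loop-free programs -/

namespace RAM

/-- The value of an integer expression when no word overflows. -/
@[simp]
def IExp.val (σ : Mem) : IExp → ℕ
  | .lit c => c
  | .var x => σ.var x
  | .get a i => σ.arr a (i.val σ)
  | .op o e₁ e₂ => o.eval (e₁.val σ) (e₂.val σ)

/-- No intermediate result of the expression overflows. -/
@[simp]
def IExp.Ok (B : ℕ) (σ : Mem) : IExp → Prop
  | .lit c => c < B
  | .var _ => True
  | .get _ i => i.Ok B σ
  | .op o e₁ e₂ => e₁.Ok B σ ∧ e₂.Ok B σ ∧ o.eval (e₁.val σ) (e₂.val σ) < B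

theorem IExp.Ok.eval_eq {B : ℕ} {σ : Mem} {e : IExp} (h : e.Ok B σ) :
    e.eval B σ = some (e.val σ) := by
  induction e with
  | lit c => simp [IExp.eval, IExp.val, fit, show c < B from h]
  | var x => rfl
  | get a i ih => simp [IExp.eval, IExp.val, ih h]
  | op o e₁ e₂ ih₁ ih₂ =>
    simp [IExp.eval, IExp.val, fit, ih₁ h.1, ih₂ h.2.1, h.2.2]

/-- The value of a weight expression when no word overflows. -/
@[simp]
noncomputable def WExp.val (σ : Mem) : WExp → WithTop ℝ
  | .zero => 0
  | .top => ⊤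
  | .get a i => σ.warr a (i.val σ)
  | .add e₁ e₂ => e₁.val σ + e₂.val σ

/-- No index computed in the expression overflows. -/
@[simp]
def WExp.Ok (B : ℕ) (σ : Mem) : WExp → Prop
  | .zero => True
  | .top => True
  | .get _ i => i.Ok B σ
  | .add e₁ e₂ => e₁.Ok B σ ∧ e₂.Ok B σ

theorem WExp.Ok.eval_eq {B : ℕ} {σ : Mem} {e : WExp} (h : e.Ok B σ) :
    e.eval B σ = some (e.val σ) := by
  induction e with
  | zero => rfl
  | top => rfl
  | get a i => simp [WExp.eval, WExp.val, IExp.Ok.eval_eq (show i.Ok B σ from h)]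
  | add e₁ e₂ ih₁ ih₂ => simp [WExp.eval, WExp.val, ih₁ h.1, ih₂ h.2]

/-- The truth of a condition when no word overflows. -/
@[simp]
def Cond.Holds (σ : Mem) : Cond → Prop
  | .lt e₁ e₂ => e₁.val σ < e₂.val σ
  | .eq e₁ e₂ => e₁.val σ = e₂.val σ
  | .wlt e₁ e₂ => e₁.val σ < e₂.val σ
  | .not c => ¬ c.Holds σ
  | .and c₁ c₂ => c₁.Holds σ ∧ c₂.Holds σ

/-- No intermediate result of the condition overflows. -/
@[simp]
def Cond.Ok (B : ℕ) (σ : Mem) : Cond → Prop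
  | .lt e₁ e₂ => e₁.Ok B σ ∧ e₂.Ok B σ
  | .eq e₁ e₂ => e₁.Ok B σ ∧ e₂.Ok B σ
  | .wlt e₁ e₂ => e₁.Ok B σ ∧ e₂.Ok B σ
  | .not c => c.Ok B σ
  | .and c₁ c₂ => c₁.Ok B σ ∧ c₂.Ok B σ

theorem Cond.Ok.exists_eval_eq {B : ℕ} {σ : Mem} {c : Cond} (h : c.Ok B σ) :
    ∃ b, c.eval B σ = some b ∧ (b = true ↔ c.Holds σ) := by
  induction c with
  | lt e₁ e₂ | eq e₁ e₂ | wlt e₁ e₂ =>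
    exact ⟨_, by simp [Cond.eval, h.1.eval_eq, h.2.eval_eq]; rfl, by simp [Cond.Holds]⟩
  | not c ih =>
    obtain ⟨b, hb, hb'⟩ := ih h
    exact ⟨!b, by simp [Cond.eval, hb], by simp [Cond.Holds, ← hb']⟩
  | and c₁ c₂ ih₁ ih₂ =>
    obtain ⟨b₁, hb₁, hb₁'⟩ := ih₁ h.1
    obtain ⟨b₂, hb₂, hb₂'⟩ := ih₂ h.2
    exact ⟨b₁ && b₂, by simp [Cond.eval, hb₁, hb₂], by simp [Cond.Holds, ← hb₁', ← hb₂']⟩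

theorem Cond.Ok.eval_eq_true {B : ℕ} {σ : Mem} {c : Cond} (h : c.Ok B σ) (hc : c.Holds σ) :
    c.eval B σ = some true := by
  obtain ⟨b, hb, hb'⟩ := h.exists_eval_eq
  rw [hb, hb'.2 hc]

theorem Cond.Ok.eval_eq_false {B : ℕ} {σ : Mem} {c : Cond} (h : c.Ok B σ)
    (hc : ¬ c.Holds σ) : c.eval B σ = some false := by
  obtain ⟨b, hb, hb'⟩ := h.exists_eval_eq
  rw [hb, Bool.eq_false_iff.2 fun h => hc (hb'.1 h)]

/-- An upper bound for the number of steps of a program in which every loop body is executed at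
most once. -/
def Prog.cost : Prog → ℕ
  | .skip => 1
  | .assign _ e => e.cost + 1
  | .store _ i e => i.cost + e.cost + 1
  | .wstore _ i e => i.cost + e.cost + 1
  | .seq p q => p.cost + q.cost
  | .ite c p q => c.cost + p.cost + q.cost + 1
  | .loop c p => c.cost + p.cost + 1

/-- The weakest precondition of a loop-free program. Loops get the precondition `False`. -/
@[simp]
def Prog.WP (B : ℕ) : Prog → Mem → (Mem → Prop) → Prop
  | .skip, σ, Q => Q σ
  | .assign x e, σ, Q => e.Ok B σ ∧ Q (σ.setVar x (e.val σ))
  | .store a i e, σ, Q => i.Ok B σ ∧ e.Ok B σ ∧ Q (σ.setArr a (i.val σ) (e.val σ))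
  | .wstore a i e, σ, Q => i.Ok B σ ∧ e.Ok B σ ∧ Q (σ.setWarr a (i.val σ) (e.val σ))
  | .seq p q, σ, Q => p.WP B σ fun τ => q.WP B τ Q
  | .ite c p q, σ, Q => c.Ok B σ ∧ (c.Holds σ → p.WP B σ Q) ∧ (¬ c.Holds σ → q.WP B σ Q)
  | .loop _ _, _, _ => False

theorem Prog.WP.run {B : ℕ} {p : Prog} {σ : Mem} {Q : Mem → Prop} (h : p.WP B σ Q) :
    ∃ t τ, Run B p σ t τ ∧ t ≤ p.cost ∧ Q τ := by
  induction p generalizing σ Q with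
  | skip => exact ⟨_, _, .skip σ, le_rfl, h⟩
  | assign x e => exact ⟨_, _, .assign h.1.eval_eq, le_rfl, h.2⟩
  | store a i e => exact ⟨_, _, .store h.1.eval_eq h.2.1.eval_eq, le_rfl, h.2.2⟩
  | wstore a i e => exact ⟨_, _, .wstore h.1.eval_eq h.2.1.eval_eq, le_rfl, h.2.2⟩
  | seq p q ihp ihq =>
    obtain ⟨t₁, τ, hp, ht₁, hτ⟩ := ihp h
    obtain ⟨t₂, υ, hq, ht₂, hυ⟩ := ihq hτ
    exact ⟨_, _, .seq hp hq, add_le_add ht₁ ht₂, hυ⟩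
  | ite c p q ihp ihq =>
    by_cases hc : c.Holds σ
    · obtain ⟨t, τ, hp, ht, hτ⟩ := ihp (h.2.1 hc)
      refine ⟨_, _, .iteTrue (h.1.eval_eq_true hc) hp, ?_, hτ⟩
      simp only [Prog.cost]; omega
    · obtain ⟨t, τ, hq, ht, hτ⟩ := ihq (h.2.2 hc)
      refine ⟨_, _, .iteFalse (h.1.eval_eq_false hc) hq, ?_, hτ⟩
      simp only [Prog.cost]; omega
  | loop c p => exact h.elim

/-! ### Frames -/

/-- Does the program assign to the variable `x`? -/
def Prog.writesVar : Prog → ℕ → Bool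
  | .skip, _ => false
  | .assign y _, x => x == y
  | .store _ _ _, _ => false
  | .wstore _ _ _, _ => false
  | .seq p q, x => p.writesVar x || q.writesVar x
  | .ite _ p q, x => p.writesVar x || q.writesVar x
  | .loop _ p, x => p.writesVar x

/-- Does the program write to the integer array `a`? -/
def Prog.writesArr : Prog → ℕ → Bool
  | .skip, _ => false
  | .assign _ _, _ => false
  | .store b _ _, a => a == b
  | .wstore _ _ _, _ => false
  | .seq p q, a => p.writesArr a || q.writesArr a
  | .ite _ p q, a => p.writesArr a || q.writesArr a
  | .loop _ p, a => p.writesArr a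

/-- Does the program write to the weight array `a`? -/
def Prog.writesWarr : Prog → ℕ → Bool
  | .skip, _ => false
  | .assign _ _, _ => false
  | .store _ _ _, _ => false
  | .wstore b _ _, a => a == b
  | .seq p q, a => p.writesWarr a || q.writesWarr a
  | .ite _ p q, a => p.writesWarr a || q.writesWarr a
  | .loop _ p, a => p.writesWarr a

/-- The two memories agree on everything the program does not write. Arrays are tracked as a
whole. -/
structure Frame (p : Prog) (σ τ : Mem) : Prop where
  var : ∀ x, p.writesVar x = false → τ.var x = σ.var x
  arr : ∀ a, p.writesArr a = false → τ.arr a = σ.arr a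
  warr : ∀ a, p.writesWarr a = false → τ.warr a = σ.warr a

theorem Frame.refl (p : Prog) (σ : Mem) : Frame p σ σ :=
  ⟨fun _ _ => rfl, fun _ _ => rfl, fun _ _ => rfl⟩

theorem Frame.trans {p : Prog} {σ τ υ : Mem} (h : Frame p σ τ) (h' : Frame p τ υ) :
    Frame p σ υ :=
  ⟨fun x hx => (h'.var x hx).trans (h.var x hx), fun x hx => (h'.arr x hx).trans (h.arr x hx),
    fun x hx => (h'.warr x hx).trans (h.warr x hx)⟩

theorem Frame.mono {p q : Prog} {σ τ : Mem} (h : Frame p σ τ)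
    (hv : ∀ x, q.writesVar x = false → p.writesVar x = false)
    (ha : ∀ x, q.writesArr x = false → p.writesArr x = false)
    (hw : ∀ x, q.writesWarr x = false → p.writesWarr x = false) : Frame q σ τ :=
  ⟨fun x hx => h.var x (hv x hx), fun x hx => h.arr x (ha x hx),
    fun x hx => h.warr x (hw x hx)⟩

theorem Run.frame {B : ℕ} {p : Prog} {σ τ : Mem} {t : ℕ} (h : Run B p σ t τ) :
    Frame p σ τ := by
  induction h with
  | skip σ => exact .refl _ _
  | assign he =>
    refine ⟨fun x hx => ?_, fun _ _ => rfl, fun _ _ => rfl⟩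
    simp only [Prog.writesVar, beq_eq_false_iff_ne] at hx
    simp [Mem.setVar, hx]
  | store hi he =>
    refine ⟨fun _ _ => rfl, fun x hx => ?_, fun _ _ => rfl⟩
    simp only [Prog.writesArr, beq_eq_false_iff_ne] at hx
    simp [Mem.setArr, hx]
  | wstore hi he =>
    refine ⟨fun _ _ => rfl, fun _ _ => rfl, fun x hx => ?_⟩
    simp only [Prog.writesWarr, beq_eq_false_iff_ne] at hx
    simp [Mem.setWarr, hx]
  | seq _ _ ihp ihq =>
    refine (ihp.mono ?_ ?_ ?_).trans (ihq.mono ?_ ?_ ?_) <;>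
      simp +contextual [Prog.writesVar, Prog.writesArr, Prog.writesWarr]
  | iteTrue _ _ ih | iteFalse _ _ ih =>
    refine ih.mono ?_ ?_ ?_ <;>
      simp +contextual [Prog.writesVar, Prog.writesArr, Prog.writesWarr]
  | loopTrue _ _ _ ihp ihl =>
    exact .trans (ihp.mono (fun _ h => h) (fun _ h => h) (fun _ h => h)) ihl
  | loopFalse _ => exact .refl _ _

/-! ### Total correctness within linear time -/

/-- Started on `σ`, the program halts on a memory satisfying `Q`, after at most `S` times as many
steps as a run with one pass through each loop takes. As the body of every loop below is
loop-free, it is enough that each loop is passed at most `S` times. -/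
def Reaches (B S : ℕ) (p : Prog) (σ : Mem) (Q : Mem → Prop) : Prop :=
  ∃ t τ, Run B p σ t τ ∧ t ≤ S * p.cost ∧ Q τ

theorem Prog.WP.reaches {B S : ℕ} {p : Prog} {σ : Mem} {Q : Mem → Prop} (h : p.WP B σ Q)
    (hS : 1 ≤ S) : Reaches B S p σ fun τ => Q τ ∧ Frame p σ τ := by
  obtain ⟨t, τ, hr, ht, hQ⟩ := h.run
  exact ⟨t, τ, hr, ht.trans (Nat.le_mul_of_pos_left _ hS), hQ, hr.frame⟩

theorem Reaches.seq {B S : ℕ} {p q : Prog} {σ : Mem} {Q R : Mem → Prop}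
    (hp : Reaches B S p σ Q) (hq : ∀ τ, Q τ → Reaches B S q τ R) :
    Reaches B S (.seq p q) σ R := by
  obtain ⟨t₁, τ, hr, ht, hQ⟩ := hp
  obtain ⟨t₂, υ, hr', ht', hR⟩ := hq τ hQ
  refine ⟨_, _, .seq hr hr', ?_, hR⟩
  simp only [Prog.cost, mul_add]
  exact add_le_add ht ht'

theorem Reaches.skip {B S : ℕ} {σ : Mem} {Q : Mem → Prop} (hS : 1 ≤ S) (h : Q σ) :
    Reaches B S .skip σ Q :=
  ⟨1, σ, .skip σ, by simpa [Prog.cost] using hS, h⟩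

/-- The rule for loops with a loop-free body: the invariant `I` has to be kept and the potential
`Φ` has to drop in every pass. -/
theorem Reaches.loop {B S : ℕ} {c : Cond} {p : Prog} {σ : Mem} (I : Mem → Prop) (Φ : Mem → ℕ)
    (h0 : I σ) (hΦ : Φ σ < S) (hc : ∀ τ, Frame p σ τ → I τ → c.Ok B τ)
    (hp : ∀ τ, Frame p σ τ → I τ → c.Holds τ → p.WP B τ fun υ => I υ ∧ Φ υ < Φ τ) :
    Reaches B S (.loop c p) σ fun τ => (I τ ∧ ¬ c.Holds τ) ∧ Frame (.loop c p) σ τ := by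
  suffices H : ∀ N τ, Φ τ ≤ N → Frame p σ τ → I τ →
      ∃ t υ, Run B (.loop c p) τ t υ ∧ t ≤ (N + 1) * (Prog.loop c p).cost ∧
        (I υ ∧ ¬ c.Holds υ) by
    obtain ⟨t, υ, hr, ht, hI⟩ := H (Φ σ) σ le_rfl (.refl _ _) h0
    exact ⟨t, υ, hr, ht.trans (Nat.mul_le_mul_right _ hΦ), hI, hr.frame⟩
  intro N
  induction N with
  | zero =>
    intro τ hN hf hI
    have hc' : ¬ c.Holds τ := fun hh => by
      obtain ⟨_, _, _, _, _, hlt⟩ := (hp τ hf hI hh).run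
      omega
    refine ⟨_, τ, .loopFalse ((hc τ hf hI).eval_eq_false hc'), ?_, hI, hc'⟩
    simp only [Prog.cost]; omega
  | succ N ih =>
    intro τ hN hf hI
    by_cases hh : c.Holds τ
    · obtain ⟨t₁, υ, hr, ht, hI', hlt⟩ := (hp τ hf hI hh).run
      obtain ⟨t₂, υ', hr', ht', hI''⟩ := ih υ (by omega) (hf.trans hr.frame) hI'
      refine ⟨_, υ', .loopTrue ((hc τ hf hI).eval_eq_true hh) hr hr', ?_, hI''⟩
      rw [Nat.succ_mul]
      simp only [Prog.cost] at ht' ⊢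
      omega
    · refine ⟨_, τ, .loopFalse ((hc τ hf hI).eval_eq_false hh), ?_, hI, hh⟩
      simp only [Prog.cost]
      nlinarith

@[simp]
theorem Mem.setVar_var (σ : Mem) (x v y : ℕ) :
    (σ.setVar x v).var y = if y = x then v else σ.var y := by
  simp [Mem.setVar, Function.update_apply]

@[simp]
theorem Mem.setVar_arr (σ : Mem) (x v : ℕ) : (σ.setVar x v).arr = σ.arr := rfl

@[simp]
theorem Mem.setVar_warr (σ : Mem) (x v : ℕ) : (σ.setVar x v).warr = σ.warr := rfl

@[simp]
theorem Mem.setArr_var (σ : Mem) (a i v : ℕ) : (σ.setArr a i v).var = σ.var := rfl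

@[simp]
theorem Mem.setArr_arr (σ : Mem) (a i v b : ℕ) :
    (σ.setArr a i v).arr b = if b = a then Function.update (σ.arr a) i v else σ.arr b := by
  simp [Mem.setArr, Function.update_apply]

@[simp]
theorem Mem.setArr_warr (σ : Mem) (a i v : ℕ) : (σ.setArr a i v).warr = σ.warr := rfl

@[simp]
theorem Mem.setWarr_var (σ : Mem) (a i : ℕ) (v : WithTop ℝ) :
    (σ.setWarr a i v).var = σ.var := rfl

@[simp]
theorem Mem.setWarr_arr (σ : Mem) (a i : ℕ) (v : WithTop ℝ) :
    (σ.setWarr a i v).arr = σ.arr := rfl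

@[simp]
theorem Mem.setWarr_warr (σ : Mem) (a i : ℕ) (v : WithTop ℝ) (b : ℕ) :
    (σ.setWarr a i v).warr b = if b = a then Function.update (σ.warr a) i v else σ.warr b := by
  simp [Mem.setWarr, Function.update_apply]

attribute [simp] Op.eval

theorem Prog.WP.with_frame {B : ℕ} {p : Prog} {σ : Mem} {Q : Mem → Prop} (h : p.WP B σ Q) :
    p.WP B σ fun τ => Q τ ∧ Frame p σ τ := by
  suffices H : ∀ Q R : Mem → Prop, (∀ t τ, Run B p σ t τ → Q τ → R τ) →
      p.WP B σ Q → p.WP B σ R from H _ _ (fun t τ hr hQ => ⟨hQ, hr.frame⟩) h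
  clear h Q
  induction p generalizing σ with
  | skip => exact fun Q R h hw => h _ _ (.skip _) hw
  | assign x e => exact fun Q R h hw => ⟨hw.1, h _ _ (.assign hw.1.eval_eq) hw.2⟩
  | store a i e =>
    exact fun Q R h hw => ⟨hw.1, hw.2.1, h _ _ (.store hw.1.eval_eq hw.2.1.eval_eq) hw.2.2⟩
  | wstore a i e =>
    exact fun Q R h hw => ⟨hw.1, hw.2.1, h _ _ (.wstore hw.1.eval_eq hw.2.1.eval_eq) hw.2.2⟩
  | seq p q ihp ihq =>
    exact fun Q R h hw => ihp _ _ (fun t τ hr hτ =>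
      ihq _ _ (fun t' υ hr' hυ => h _ _ (.seq hr hr') hυ) hτ) hw
  | ite c p q ihp ihq =>
    exact fun Q R h hw => ⟨hw.1,
      fun hc => ihp _ _ (fun t τ hr hτ => h _ _ (.iteTrue (hw.1.eval_eq_true hc) hr) hτ)
        (hw.2.1 hc),
      fun hc => ihq _ _ (fun t τ hr hτ => h _ _ (.iteFalse (hw.1.eval_eq_false hc) hr) hτ)
        (hw.2.2 hc)⟩
  | loop c p => exact fun Q R h hw => hw.elim

theorem Prog.WP.mono {B : ℕ} {p : Prog} {σ : Mem} {Q R : Mem → Prop} (h : p.WP B σ Q)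
    (hQ : ∀ τ, Q τ → R τ) : p.WP B σ R := by
  induction p generalizing σ Q R with
  | skip => exact hQ _ h
  | assign x e => exact ⟨h.1, hQ _ h.2⟩
  | store a i e => exact ⟨h.1, h.2.1, hQ _ h.2.2⟩
  | wstore a i e => exact ⟨h.1, h.2.1, hQ _ h.2.2⟩
  | seq p q ihp ihq => exact ihp h fun τ hτ => ihq hτ hQ
  | ite c p q ihp ihq => exact ⟨h.1, fun hc => ihp (h.2.1 hc) hQ, fun hc => ihq (h.2.2 hc) hQ⟩
  | loop c p => exact h.elim

theorem Reaches.mono {B S : ℕ} {p : Prog} {σ : Mem} {Q R : Mem → Prop}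
    (h : Reaches B S p σ Q) (hQ : ∀ τ, Q τ → R τ) : Reaches B S p σ R := by
  obtain ⟨t, τ, hr, ht, hτ⟩ := h
  exact ⟨t, τ, hr, ht, hQ τ hτ⟩

theorem Reaches.with_frame {B S : ℕ} {p : Prog} {σ : Mem} {Q : Mem → Prop}
    (h : Reaches B S p σ Q) : Reaches B S p σ fun τ => Q τ ∧ Frame p σ τ := by
  obtain ⟨t, τ, hr, ht, hτ⟩ := h
  exact ⟨t, τ, hr, ht, hτ, hr.frame⟩

instance : Add IExp := ⟨.op .add⟩
instance : Sub IExp := ⟨.op .sub⟩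
instance : Mul IExp := ⟨.op .mul⟩
instance : Div IExp := ⟨.op .div⟩
instance : Mod IExp := ⟨.op .mod⟩
instance : Add WExp := ⟨.add⟩

@[simp]
theorem IExp.op_add (e₁ e₂ : IExp) : e₁ + e₂ = .op .add e₁ e₂ := rfl

@[simp]
theorem IExp.op_sub (e₁ e₂ : IExp) : e₁ - e₂ = .op .sub e₁ e₂ := rfl

@[simp]
theorem IExp.op_mul (e₁ e₂ : IExp) : e₁ * e₂ = .op .mul e₁ e₂ := rfl

@[simp]
theorem IExp.op_div (e₁ e₂ : IExp) : e₁ / e₂ = .op .div e₁ e₂ := rfl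

@[simp]
theorem IExp.op_mod (e₁ e₂ : IExp) : e₁ % e₂ = .op .mod e₁ e₂ := rfl

@[simp]
theorem WExp.add_eq (e₁ e₂ : WExp) : e₁ + e₂ = .add e₁ e₂ := rfl

/-- The statements of the list one after the other. -/
@[simp]
def Prog.block : List Prog → Prog
  | [] => .skip
  | p :: l => .seq p (.block l)

/-- `for x = 0, …, N - 1 do p`. -/
def Prog.for (x : ℕ) (N : IExp) (p : Prog) : Prog :=
  .seq (.assign x (.lit 0))
    (.loop (.lt (.var x) N) (.seq p (.assign x (.var x + .lit 1))))

/-- The rule for counting loops: `I k` holds before the pass with counter `k`. -/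
theorem Reaches.for {B S x K : ℕ} {N : IExp} {p : Prog} {σ : Mem} (I : ℕ → Mem → Prop)
    (hN : ∀ τ, Frame (.for x N p) σ τ → N.Ok B τ ∧ N.val τ = K)
    (hx : p.writesVar x = false) (hS : K < S) (hB : K + 1 < B) (h0 : I 0 (σ.setVar x 0))
    (hp : ∀ k τ, k < K → Frame (.for x N p) σ τ → τ.var x = k → I k τ →
      p.WP B τ fun υ => I (k + 1) (υ.setVar x (k + 1))) :
    Reaches B S (.for x N p) σ fun τ => I K τ ∧ Frame (.for x N p) σ τ := by
  refine Reaches.with_frame ?_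
  refine Reaches.seq (Q := fun τ => τ = σ.setVar x 0 ∧ Frame (.assign x (.lit 0)) σ τ)
    (Prog.WP.reaches ⟨by simp only [IExp.Ok]; omega, rfl⟩ (by omega)) ?_
  rintro τ ⟨rfl, hf⟩
  have hf0 : ∀ τ, Frame (.seq p (.assign x (.var x + .lit 1))) (σ.setVar x 0) τ →
      Frame (.for x N p) σ τ := by
    intro τ hτ
    refine (hf.mono ?_ ?_ ?_).trans (hτ.mono ?_ ?_ ?_) <;>
      simp +contextual [Prog.for, Prog.writesVar, Prog.writesArr, Prog.writesWarr]
  refine (Reaches.loop (fun τ => τ.var x ≤ K ∧ I (τ.var x) τ) (fun τ => K - τ.var x)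
    ⟨by simp, by simpa using h0⟩ (by simpa using hS) ?_ ?_).mono ?_
  · intro τ hτ hI
    exact ⟨trivial, (hN τ (hf0 τ hτ)).1⟩
  · rintro τ hτ ⟨hle, hI⟩ hc
    have hlt : τ.var x < K := by
      rw [← (hN τ (hf0 τ hτ)).2]; exact hc
    refine (hp _ τ hlt (hf0 τ hτ) rfl hI).with_frame.mono ?_
    rintro υ ⟨hυ, hfr⟩
    have hvx := hfr.var x hx
    refine ⟨⟨trivial, show 1 < B by omega, ?_⟩, ?_⟩
    · simp only [IExp.val, Op.eval, hvx]; omega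
    simp only [IExp.val, Op.eval, hvx, Mem.setVar_var, if_true]
    exact ⟨⟨hlt, hυ⟩, by omega⟩
  · rintro τ ⟨⟨⟨hle, hI⟩, hc⟩, hτ⟩
    have : ¬ τ.var x < K := by
      rw [← (hN τ (hf0 τ (hτ.mono (fun _ h => h) (fun _ h => h) (fun _ h => h)))).2]; exact hc
    have : τ.var x = K := by omega
    rwa [this] at hI

end RAM

/-! ### Kahn's algorithm, abstractly -/

/-- One plus the last index below `k` at which `f` takes the value `v`, or `0` if there is none. -/
def lastBefore (f : ℕ → ℕ) (v : ℕ) : ℕ → ℕ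
  | 0 => 0
  | k + 1 => if f k = v then k + 1 else lastBefore f v k

theorem lastBefore_le (f : ℕ → ℕ) (v k : ℕ) : lastBefore f v k ≤ k := by
  induction k with
  | zero => exact le_rfl
  | succ k ih => rw [lastBefore]; split_ifs <;> omega

theorem lt_lastBefore {f : ℕ → ℕ} {v k e : ℕ} (he : e < k) (hv : f e = v) :
    e < lastBefore f v k := by
  induction k with
  | zero => omega
  | succ k ih =>
    rw [lastBefore]
    split_ifs with h
    · exact he
    · exact ih (by grind)

theorem apply_lastBefore {f : ℕ → ℕ} {v k : ℕ} (h : lastBefore f v k ≠ 0) :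
    f (lastBefore f v k - 1) = v := by
  induction k with
  | zero => exact absurd rfl h
  | succ k ih =>
    rw [lastBefore] at h ⊢
    split_ifs at h ⊢ with hk
    · exact hk
    · exact ih h

/-- The edges already listed in the first `k` places of `eord`. -/
def processed (eord : ℕ → ℕ) (k : ℕ) : Finset ℕ := (Finset.range k).image eord

theorem mem_processed {eord : ℕ → ℕ} {k e : ℕ} :
    e ∈ processed eord k ↔ ∃ i < k, eord i = e := by
  simp [processed]

theorem processed_update (eord : ℕ → ℕ) (k e : ℕ) :
    processed (Function.update eord k e) (k + 1) = insert e (processed eord k) := by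
  ext x
  simp only [Finset.mem_insert, mem_processed]
  constructor
  · rintro ⟨i, hi, h⟩
    by_cases hik : i = k
    · subst hik; simp at h; exact .inl h.symm
    · rw [Function.update_of_ne hik] at h
      exact .inr ⟨i, by omega, h⟩
  · rintro (rfl | ⟨i, hi, h⟩)
    · exact ⟨k, by omega, by simp⟩
    · exact ⟨i, by omega, by rw [Function.update_of_ne (by omega)]; exact h⟩

/-- The invariant of Kahn's topological sorting. The first `qlen` entries of `queue` are the nodes
found so far and `pos` is inverse to `queue`; the outgoing edges of the first `qh - 1` of them and
those outgoing edges of the `qh`-th one that are numbered at least `cur` are processed and listed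
in the first `k` entries of `eord`. The nodes satisfying `pend` have no unprocessed incoming edge
but are not in the queue yet. -/
structure KahnInv (n m : ℕ) (src dst indeg queue pos eord : ℕ → ℕ) (pend : ℕ → Prop)
    (qlen qh cur k : ℕ) : Prop where
  qh_le : qh ≤ qlen
  queue_lt : ∀ i < qlen, queue i < n
  pos_queue : ∀ i < qlen, pos (queue i) = i
  eord_lt : ∀ i < k, eord i < m
  eord_inj : ∀ i < k, ∀ j < k, eord i = eord j → i = j
  indeg_eq : ∀ v < n,
    indeg v = ((Finset.range m).filter fun e => dst e = v ∧ e ∉ processed eord k).card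
  indeg_eq_zero : ∀ v < n, indeg v = 0 ↔ (∃ i < qlen, queue i = v) ∨ pend v
  pend_new : ∀ v, pend v → ∀ i < qlen, queue i ≠ v
  mem_iff : ∀ e < m, e ∈ processed eord k ↔
    ∃ i < qh, queue i = src e ∧ (i + 1 = qh → cur ≤ e)
  cur_le : cur ≤ m
  cur_src : cur ≠ 0 → 0 < qh ∧ src (cur - 1) = queue (qh - 1)
  increasing : ∀ e ∈ processed eord k, ∀ i < qlen, ∀ j < qlen,
    queue i = src e → queue j = dst e → i < j
  sorted : ∀ i j, i < j → j < k → ∀ a < qlen, ∀ b < qlen,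
    queue a = src (eord i) → queue b = src (eord j) → a ≤ b

namespace KahnInv

variable {n m : ℕ} {src dst indeg queue pos eord : ℕ → ℕ} {pend : ℕ → Prop}
  {qlen qh cur k : ℕ}

theorem queue_inj (h : KahnInv n m src dst indeg queue pos eord pend qlen qh cur k) {i j : ℕ}
    (hi : i < qlen) (hj : j < qlen) (hij : queue i = queue j) : i = j := by
  rw [← h.pos_queue i hi, ← h.pos_queue j hj, hij]

theorem qlen_le (h : KahnInv n m src dst indeg queue pos eord pend qlen qh cur k) :
    qlen ≤ n := by
  have := Finset.card_le_card_of_injOn (s := Finset.range qlen) (t := Finset.range n) queue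
    (fun i hi => by simpa using h.queue_lt i (by simpa using hi))
    (fun i hi j hj hij => h.queue_inj (by simpa using hi) (by simpa using hj) hij)
  simpa using this

theorem processed_subset (h : KahnInv n m src dst indeg queue pos eord pend qlen qh cur k) :
    processed eord k ⊆ Finset.range m := by
  intro e he
  obtain ⟨i, hi, rfl⟩ := mem_processed.1 he
  simpa using h.eord_lt i hi

theorem card_processed (h : KahnInv n m src dst indeg queue pos eord pend qlen qh cur k) :
    (processed eord k).card = k := by
  rw [processed, Finset.card_image_of_injOn, Finset.card_range]
  exact fun i hi j hj hij => h.eord_inj i (by simpa using hi) j (by simpa using hj) hij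

theorem k_le (h : KahnInv n m src dst indeg queue pos eord pend qlen qh cur k) : k ≤ m := by
  have := Finset.card_le_card h.processed_subset
  rwa [h.card_processed, Finset.card_range] at this

theorem congr_pend (h : KahnInv n m src dst indeg queue pos eord pend qlen qh cur k)
    {pend' : ℕ → Prop} (hp : ∀ v, pend' v → pend v) (hp' : ∀ v < n, pend v → pend' v) :
    KahnInv n m src dst indeg queue pos eord pend' qlen qh cur k :=
  { h with
    indeg_eq_zero := fun v hv => (h.indeg_eq_zero v hv).trans
      (or_congr_right ⟨hp' v hv, hp v⟩)
    pend_new := fun v hv => h.pend_new v (hp v hv) }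

/-- A pending node is appended to the queue. -/
theorem push (h : KahnInv n m src dst indeg queue pos eord pend qlen qh cur k) {v : ℕ}
    (hv : v < n) (hpv : pend v) :
    KahnInv n m src dst indeg (Function.update queue qlen v) (Function.update pos v qlen) eord
      (fun x => pend x ∧ x ≠ v) (qlen + 1) qh cur k := by
  have hq : ∀ i < qlen, Function.update queue qlen v i = queue i := fun i hi =>
    Function.update_of_ne (by omega) _ _
  have hq' : Function.update queue qlen v qlen = v := Function.update_self ..
  have hnew := h.pend_new v hpv
  have hqh := h.qh_le
  have split : ∀ {i}, i < qlen + 1 → i < qlen ∨ i = qlen := by intros; omega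
  have hsrc : ∀ e ∈ processed eord k, src e ≠ v := by
    intro e he hev
    obtain ⟨i, hi, hie, -⟩ := (h.mem_iff e (by simpa using h.processed_subset he)).1 he
    exact hnew i (by omega) (hie.trans hev)
  refine
    { qh_le := by omega
      queue_lt := ?_
      pos_queue := ?_
      eord_lt := h.eord_lt
      eord_inj := h.eord_inj
      indeg_eq := h.indeg_eq
      indeg_eq_zero := ?_
      pend_new := ?_
      mem_iff := ?_
      cur_le := h.cur_le
      cur_src := ?_
      increasing := ?_
      sorted := ?_ }
  · intro i hi
    obtain hi | rfl := split hi
    · rw [hq i hi]; exact h.queue_lt i hi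
    · rwa [hq']
  · intro i hi
    obtain hi | rfl := split hi
    · rw [hq i hi, Function.update_of_ne (hnew i hi)]; exact h.pos_queue i hi
    · rw [hq', Function.update_self]
  · intro x hx
    rw [h.indeg_eq_zero x hx]
    constructor
    · rintro (⟨i, hi, rfl⟩ | hp)
      · exact .inl ⟨i, by omega, hq i hi⟩
      · by_cases hxv : x = v
        · exact .inl ⟨qlen, by omega, hq'.trans hxv.symm⟩
        · exact .inr ⟨hp, hxv⟩
    · rintro (⟨i, hi, hix⟩ | hp)
      · obtain hi | rfl := split hi
        · exact .inl ⟨i, hi, by rw [← hq i hi, hix]⟩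
        · rw [hq'] at hix; exact .inr (hix ▸ hpv)
      · exact .inr hp.1
  · rintro x ⟨hx, hxv⟩ i hi
    obtain hi | rfl := split hi
    · rw [hq i hi]; exact h.pend_new x hx i hi
    · rw [hq']; exact hxv.symm
  · intro e he
    rw [h.mem_iff e he]
    refine exists_congr fun i => and_congr_right fun hi => ?_
    rw [hq i (by omega)]
  · intro hc
    have := h.cur_src hc
    rw [hq _ (by omega)]; exact this
  · intro e he i hi j hj hie hje
    obtain hi | rfl := split hi
    · obtain hj | rfl := split hj
      · rw [hq i hi] at hie; rw [hq j hj] at hje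
        exact h.increasing e he i hi j hj hie hje
      · exact hi
    · rw [hq'] at hie
      exact absurd hie.symm (hsrc e he)
  · intro i j hij hj a ha b hb hai hbj
    have key : ∀ {c l}, l < k → c < qlen + 1 → Function.update queue qlen v c = src (eord l) →
        c < qlen ∧ queue c = src (eord l) := by
      intro c l hl hc hcl
      obtain hc | rfl := split hc
      · exact ⟨hc, by rw [← hq c hc, hcl]⟩
      · rw [hq'] at hcl
        exact absurd hcl.symm (hsrc _ (mem_processed.2 ⟨l, hl, rfl⟩))
    obtain ⟨ha', hai'⟩ := key (by omega) ha hai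
    obtain ⟨hb', hbj'⟩ := key hj hb hbj
    exact h.sorted i j hij hj a ha' b hb' hai' hbj'

/-- The outgoing edges of the current node are exhausted, and the next node of the queue is
taken up. -/
theorem next_node (h : KahnInv n m src dst indeg queue pos eord pend qlen qh 0 k)
    (hq : qh < qlen) :
    KahnInv n m src dst indeg queue pos eord pend qlen (qh + 1)
      (lastBefore src (queue qh) m) k := by
  refine { h with qh_le := hq, mem_iff := ?_, cur_le := lastBefore_le _ _ _, cur_src := ?_ }
  · intro e he
    rw [h.mem_iff e he]
    constructor
    · rintro ⟨i, hi, hie, -⟩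
      exact ⟨i, by omega, hie, by omega⟩
    · rintro ⟨i, hi, hie, hc⟩
      by_cases hiq : i = qh
      · subst hiq
        have := lt_lastBefore (f := src) he hie.symm
        have := hc rfl
        omega
      · exact ⟨i, by omega, hie, by omega⟩
  · intro hc
    exact ⟨by omega, apply_lastBefore hc⟩

/-- The edge numbered `cur - 1` is processed. -/
theorem next_edge (h : KahnInv n m src dst indeg queue pos eord (fun _ => False) qlen qh cur k)
    (hcur : cur ≠ 0) (hdst : dst (cur - 1) < n) :
    0 < indeg (dst (cur - 1)) ∧
    KahnInv n m src dst
      (Function.update indeg (dst (cur - 1)) (indeg (dst (cur - 1)) - 1)) queue pos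
      (Function.update eord k (cur - 1))
      (fun v => v = dst (cur - 1) ∧ indeg (dst (cur - 1)) - 1 = 0) qlen qh
      (lastBefore src (src (cur - 1)) (cur - 1)) (k + 1) := by
  obtain ⟨e, rfl⟩ := Nat.exists_eq_succ_of_ne_zero hcur
  simp only [Nat.succ_eq_add_one, Nat.add_sub_cancel] at *
  obtain ⟨hqh, hse⟩ := h.cur_src hcur
  rw [Nat.add_sub_cancel] at hse
  have hqle := h.qh_le
  have hem : e < m := h.cur_le
  have hnew : e ∉ processed eord k := by
    rw [h.mem_iff e hem]
    rintro ⟨i, hi, hie, hc⟩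
    have : i = qh - 1 := h.queue_inj (by omega) (by omega) (hie.trans hse)
    have := hc (by omega)
    omega
  have hpos : 0 < indeg (dst e) := by
    rw [h.indeg_eq _ hdst, Finset.card_pos]
    exact ⟨e, by simp [hem, hnew]⟩
  have hdq : ∀ i < qlen, queue i ≠ dst e := by
    intro i hi hid
    have := (h.indeg_eq_zero _ hdst).2 (.inl ⟨i, hi, hid⟩)
    omega
  have heo : ∀ i < k, Function.update eord k e i = eord i := fun i hi =>
    Function.update_of_ne (by omega) _ _
  have heo' : Function.update eord k e k = e := Function.update_self ..
  have split : ∀ {i}, i < k + 1 → i < k ∨ i = k := by intros; omega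
  refine ⟨hpos,
    { qh_le := h.qh_le
      queue_lt := h.queue_lt
      pos_queue := h.pos_queue
      eord_lt := ?_
      eord_inj := ?_
      indeg_eq := ?_
      indeg_eq_zero := ?_
      pend_new := ?_
      mem_iff := ?_
      cur_le := (lastBefore_le _ _ _).trans hem.le
      cur_src := fun hc => ⟨hqh, (apply_lastBefore hc).trans hse⟩
      increasing := ?_
      sorted := ?_ }⟩
  · intro i hi
    obtain hi | rfl := split hi
    · rw [heo i hi]; exact h.eord_lt i hi
    · rwa [heo']
  · intro i hi j hj hij
    have key : ∀ l < k, eord l ≠ e := fun l hl hle => hnew (mem_processed.2 ⟨l, hl, hle⟩)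
    obtain hi | rfl := split hi <;> obtain hj | rfl := split hj
    · rw [heo i hi, heo j hj] at hij; exact h.eord_inj i hi j hj hij
    · rw [heo i hi, heo'] at hij; exact absurd hij (key i hi)
    · rw [heo j hj, heo'] at hij; exact absurd hij.symm (key j hj)
    · rfl
  · intro v hv
    rw [processed_update]
    by_cases hve : v = dst e
    · subst hve
      rw [Function.update_self, h.indeg_eq _ hv, ← Finset.card_erase_of_mem (a := e)]
      · congr 1
        ext x
        simp only [Finset.mem_erase, Finset.mem_filter, Finset.mem_insert]
        tauto
      · simp [hem, hnew]
    · rw [Function.update_of_ne hve, h.indeg_eq _ hv]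
      congr 1
      ext x
      simp only [Finset.mem_filter, Finset.mem_insert]
      grind
  · intro v hv
    by_cases hve : v = dst e
    · subst hve
      rw [Function.update_self]
      constructor
      · exact fun h0 => .inr ⟨rfl, h0⟩
      · rintro (⟨i, hi, hid⟩ | ⟨-, h0⟩)
        · exact absurd hid (hdq i hi)
        · exact h0
    · rw [Function.update_of_ne hve, h.indeg_eq_zero v hv]
      simp [hve]
  · rintro v ⟨rfl, -⟩
    exact hdq
  · intro x hx
    rw [processed_update, Finset.mem_insert, h.mem_iff x hx]
    constructor
    · rintro (rfl | ⟨i, hi, hix, hc⟩)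
      · exact ⟨qh - 1, by omega, hse.symm, fun _ => lastBefore_le _ _ _⟩
      · refine ⟨i, hi, hix, fun hiq => ?_⟩
        have := hc hiq
        have := lastBefore_le src (src e) e
        omega
    · rintro ⟨i, hi, hix, hc⟩
      by_cases hxe : x = e
      · exact .inl hxe
      · refine .inr ⟨i, hi, hix, fun hiq => ?_⟩
        have h1 := hc hiq
        have hxs : src x = src e := by
          rw [← hix, hse]; congr 1; omega
        by_contra hlt
        have := lt_lastBefore (f := src) (k := e) (by omega) hxs
        omega
  · intro x hx i hi j hj hix hjx
    rw [processed_update, Finset.mem_insert] at hx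
    obtain rfl | hx := hx
    · exact absurd hjx (hdq j hj)
    · exact h.increasing x hx i hi j hj hix hjx
  · intro i j hij hj a ha b hb hai hbj
    rw [heo i (by omega)] at hai
    obtain hj | rfl := split hj
    · rw [heo j hj] at hbj
      exact h.sorted i j hij hj a ha b hb hai hbj
    · rw [heo'] at hbj
      have hb' : b = qh - 1 := h.queue_inj hb (by omega) (hbj.trans hse)
      have him : eord i ∈ processed eord j := mem_processed.2 ⟨i, hij, rfl⟩
      obtain ⟨a', ha', haa', -⟩ := (h.mem_iff _ (h.eord_lt i hij)).1 him
      have : a = a' := h.queue_inj ha (by omega) (hai.trans haa'.symm)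
      omega

end KahnInv

/-- `pos` numbers the nodes topologically, and `eord` lists the edges by increasing position of
their tails. -/
structure TopSorted (n m : ℕ) (src dst pos eord : ℕ → ℕ) : Prop where
  pos_lt : ∀ v < n, pos v < n
  pos_inj : ∀ u < n, ∀ v < n, pos u = pos v → u = v
  pos_src_lt : ∀ e < m, pos (src e) < pos (dst e)
  eord_lt : ∀ k < m, eord k < m
  eord_surj : ∀ e < m, ∃ k < m, eord k = e
  eord_mono : ∀ i j, i ≤ j → j < m → pos (src (eord i)) ≤ pos (src (eord j))

/-- The queue runs empty only after all nodes have been found: otherwise every node outside the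
queue would have an incoming edge from outside the queue. -/
theorem KahnInv.topSorted {n m : ℕ} {src dst indeg queue pos eord : ℕ → ℕ} {qlen k : ℕ}
    (h : KahnInv n m src dst indeg queue pos eord (fun _ => False) qlen qlen 0 k)
    (hsrc : ∀ e < m, src e < n) (hdst : ∀ e < m, dst e < n)
    (hac : ∀ S : Set ℕ, (∃ v < n, v ∈ S) →
      ∃ v < n, v ∈ S ∧ ∀ e < m, dst e = v → src e ∉ S) :
    TopSorted n m src dst pos eord := by
  have hall : ∀ v < n, ∃ i < qlen, queue i = v := by
    by_contra! hne
    obtain ⟨v, hv, hvS, hmin⟩ := hac {v | ∀ i < qlen, queue i ≠ v} hne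
    have hdeg : ((Finset.range m).filter fun e => dst e = v ∧ e ∉ processed eord k).card ≠ 0 := by
      rw [← h.indeg_eq v hv, Ne, h.indeg_eq_zero v hv]
      rintro (⟨i, hi, hiv⟩ | hf)
      · exact hvS i hi hiv
      · exact hf
    obtain ⟨e, he⟩ := Finset.card_ne_zero.1 hdeg
    simp only [Finset.mem_filter, Finset.mem_range] at he
    obtain ⟨hem, hev, hek⟩ := he
    refine hmin e hem hev fun i hi hie => hek ?_
    exact (h.mem_iff e hem).2 ⟨i, hi, hie, fun _ => Nat.zero_le e⟩
  have hproc : ∀ e < m, e ∈ processed eord k := by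
    intro e he
    obtain ⟨i, hi, hie⟩ := hall _ (hsrc e he)
    exact (h.mem_iff e he).2 ⟨i, hi, hie, fun _ => Nat.zero_le e⟩
  have hk : k = m := by
    refine le_antisymm h.k_le ?_
    have := Finset.card_le_card (s := Finset.range m) fun e he => hproc e (by simpa using he)
    rwa [h.card_processed, Finset.card_range] at this
  subst hk
  have hpos : ∀ v < n, pos v < qlen ∧ queue (pos v) = v := by
    intro v hv
    obtain ⟨i, hi, rfl⟩ := hall v hv
    rw [h.pos_queue i hi]
    exact ⟨hi, rfl⟩
  refine
    { pos_lt := fun v hv => (hpos v hv).1.trans_le h.qlen_le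
      pos_inj := fun u hu v hv huv => by rw [← (hpos u hu).2, huv, (hpos v hv).2]
      pos_src_lt := fun e he => ?_
      eord_lt := h.eord_lt
      eord_surj := fun e he => mem_processed.1 (hproc e he)
      eord_mono := fun i j hij hj => ?_ }
  · obtain ⟨h1, h2⟩ := hpos _ (hsrc e he)
    obtain ⟨h3, h4⟩ := hpos _ (hdst e he)
    exact h.increasing e (hproc e he) _ h1 _ h3 h2 h4
  · obtain rfl | hij := hij.eq_or_lt
    · rfl
    obtain ⟨h1, h2⟩ := hpos _ (hsrc _ (h.eord_lt i (hij.trans hj)))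
    obtain ⟨h3, h4⟩ := hpos _ (hsrc _ (h.eord_lt j hj))
    exact h.sorted i j hij hj _ h1 _ h3 h2 h4

namespace RAM

/-! ### Topological sorting

The programs below share one memory layout. Besides the input, it consists of

* the variables 5 (loop counter, position of the sweep), 6 to 8 (length of the queue, number of
  nodes taken from it, pending edge plus one; later the start of the current block, a position in
  it and a part of the mask), 9 (number of edges listed), 10, 13, 14 (auxiliary), 11 (block length),
  12 (number of blocks);
* the integer arrays 3 (marks of the edges of the path), 4 to 6 (heads and links of the adjacency
  lists, indegrees), 7 (queue), 8 (positions of the nodes), 9 (edges by the positions of their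
  tails), 10 to 12 (binary logarithms, lowest bits, powers of two), 13 and 14 (left and right ends
  of the intervals);
* the weight arrays 1 (output), 2 and 3 (distances from `r` and to `s`), 4 (costs of the intervals),
  5 (values of the staircase), 6 and 7 (minima over the intervals that begin in the block of a
  position, and over those that end in it but begin before), 8 (sparse table). -/

/-- Builds the adjacency lists and counts the incoming edges. The outgoing edges of a node `v` are
linked in decreasing order: `head[v]` is one plus the largest of them, and `next[e]` is one plus
the largest one below `e` with the same tail. -/
def adjacency : Prog :=
  .for 5 (.var 1) <| .block [
    .store 5 (.var 5) (.get 4 (.get 0 (.var 5))),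
    .store 4 (.get 0 (.var 5)) (.var 5 + .lit 1),
    .store 6 (.get 1 (.var 5)) (.get 6 (.get 1 (.var 5)) + .lit 1)]

theorem adjacency_reaches {B S n m : ℕ} {src dst : ℕ → ℕ} {σ : Mem}
    (hS : n + m + 2 ≤ S) (hB : 100 * (n + m + 2) ≤ B)
    (hm : σ.var 1 = m) (hsrc : σ.arr 0 = src) (hdst : σ.arr 1 = dst)
    (h4 : ∀ v, σ.arr 4 v = 0) (h6 : ∀ v, σ.arr 6 v = 0) :
    Reaches B S adjacency σ fun τ =>
      ((∀ v, τ.arr 4 v = lastBefore src v m) ∧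
        (∀ e < m, τ.arr 5 e = lastBefore src (src e) e) ∧
        (∀ v, τ.arr 6 v = ((Finset.range m).filter fun e => dst e = v).card)) ∧
      Frame adjacency σ τ := by
  refine Reaches.for (K := m) (fun k τ =>
    (∀ v, τ.arr 4 v = lastBefore src v k) ∧
        (∀ e < k, τ.arr 5 e = lastBefore src (src e) e) ∧
        (∀ v, τ.arr 6 v = ((Finset.range k).filter fun e => dst e = v).card))
    (fun τ hτ => ⟨trivial, (hτ.var 1 rfl).trans hm⟩) rfl (by omega) (by omega)
    ⟨h4, by simp, by simpa using h6⟩ ?_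
  rintro k τ hk hf hx ⟨i4, i5, i6⟩
  have e0 := (hf.arr 0 rfl).trans hsrc
  have e1 := (hf.arr 1 rfl).trans hdst
  have hcard : ((Finset.range k).filter fun e => dst e = dst k).card ≤ k := by
    simpa using Finset.card_filter_le (Finset.range k) fun e => dst e = dst k
  simp [hx, e0, e1]
  refine ⟨⟨by omega, by omega⟩, ⟨by omega, by rw [i6]; omega⟩, ?_, ?_, ?_⟩
  · intro v
    simp [Function.update_apply, lastBefore, i4, eq_comm]
  · intro e he
    by_cases hek : e = k
    · subst hek
      simp [i4]
    · rw [Function.update_of_ne hek, i5 e (by omega)]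
  · intro v
    rw [Finset.range_add_one, Finset.filter_insert, Function.update_apply]
    split_ifs with h1 h2 h2
    · rw [Finset.card_insert_of_notMem (by simp), i6, h1]
    · exact absurd h1.symm h2
    · exact absurd h2.symm h1
    · exact i6 v

/-- Marks the edges of the given path. -/
def markPath : Prog := .for 5 (.var 4) (.store 3 (.get 2 (.var 5)) (.lit 1))

theorem markPath_reaches {B S p : ℕ} {P : ℕ → ℕ} {σ : Mem}
    (hS : p < S) (hB : p + 1 < B) (hp : σ.var 4 = p) (hP : σ.arr 2 = P)
    (h3 : ∀ e, σ.arr 3 e = 0) :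
    Reaches B S markPath σ fun τ =>
      (∀ e, τ.arr 3 e = 0 ↔ ∀ i < p, P i ≠ e) ∧ Frame markPath σ τ := by
  refine Reaches.for (K := p) (fun k τ => ∀ e, τ.arr 3 e = 0 ↔ ∀ i < k, P i ≠ e)
    (fun τ hτ => ⟨trivial, (hτ.var 4 rfl).trans hp⟩) rfl hS hB (by simpa using h3) ?_
  rintro k τ hk hf hx hI
  have e2 := (hf.arr 2 rfl).trans hP
  simp [hx, e2]
  refine ⟨by omega, fun e => ?_⟩
  rw [Function.update_apply]
  split_ifs with h
  · simp only [false_iff]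
    exact fun h' => h' k (by omega) h.symm
  · rw [hI]
    refine ⟨fun h' i hi => ?_, fun h' i hi => h' i (by omega)⟩
    by_cases hik : i = k
    · subst hik; exact fun h'' => h h''.symm
    · exact h' i (by omega)

/-- Puts the nodes without incoming edges into the queue. -/
def initQueue : Prog :=
  .for 5 (.var 0) <|
    .ite (.eq (.get 6 (.var 5)) (.lit 0))
      (.block [
        .store 7 (.var 6) (.var 5),
        .store 8 (.var 5) (.var 6),
        .assign 6 (.var 6 + .lit 1)])
      .skip

theorem initQueue_reaches {B S n m : ℕ} {src dst indeg eord : ℕ → ℕ} {σ : Mem}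
    (hS : n + m + 2 ≤ S) (hB : 100 * (n + m + 2) ≤ B)
    (hn : σ.var 0 = n) (h6 : σ.var 6 = 0) (hi : σ.arr 6 = indeg)
    (hindeg : ∀ v, indeg v = ((Finset.range m).filter fun e => dst e = v).card) :
    Reaches B S initQueue σ fun τ =>
      KahnInv n m src dst indeg (τ.arr 7) (τ.arr 8) eord (fun _ => False) (τ.var 6) 0 0 0 ∧
      Frame initQueue σ τ := by
  refine (Reaches.for (N := .var 0) (K := n) (fun k τ => KahnInv n m src dst indeg (τ.arr 7)
      (τ.arr 8) eord (fun v => k ≤ v ∧ v < n ∧ indeg v = 0) (τ.var 6) 0 0 0)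
    (fun τ hτ => ⟨trivial, (hτ.var 0 rfl).trans hn⟩) rfl (by omega) (by omega) ?_ ?_).mono ?_
  · simp only [Mem.setVar_var, Mem.setVar_arr, h6]
    constructor <;> simp +contextual [processed, hindeg]
  · rintro k τ hk hf hx hI
    have e0 := (hf.arr 6 rfl).trans hi
    simp [hx, e0]
    have := hI.qlen_le
    refine ⟨by omega, fun h0 => ⟨by omega, ?_⟩, fun h0 => ?_⟩
    · refine (hI.push hk ⟨le_rfl, hk, h0⟩).congr_pend ?_ ?_
      · rintro v ⟨h1, h2, h3⟩
        exact ⟨⟨by omega, h2, h3⟩, by omega⟩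
      · rintro v hv ⟨⟨h1, h2, h3⟩, h4⟩
        exact ⟨by omega, h2, h3⟩
    · refine hI.congr_pend ?_ ?_
      · rintro v ⟨h1, h2, h3⟩
        exact ⟨by omega, h2, h3⟩
      · rintro v hv ⟨h1, h2, h3⟩
        refine ⟨?_, h2, h3⟩
        by_contra hlt
        have : v = k := by omega
        exact h0 (this ▸ h3)
  · rintro τ ⟨hI, hf⟩
    exact ⟨hI.congr_pend (by simp) (by rintro v hv ⟨h1, h2, -⟩; omega), hf⟩

/-- The main loop of Kahn's algorithm. A pass either moves on to the next node of the queue or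
processes one edge, so that the loop need not be nested. -/
def kahn : Prog :=
  .loop (.not (.and (.eq (.var 8) (.lit 0)) (.eq (.var 7) (.var 6)))) <|
    .ite (.eq (.var 8) (.lit 0))
      (.block [
        .assign 8 (.get 4 (.get 7 (.var 7))),
        .assign 7 (.var 7 + .lit 1)])
      (.block [
        .store 9 (.var 9) (.var 8 - .lit 1),
        .assign 9 (.var 9 + .lit 1),
        .assign 10 (.get 1 (.var 8 - .lit 1)),
        .store 6 (.var 10) (.get 6 (.var 10) - .lit 1),
        .assign 8 (.get 5 (.var 8 - .lit 1)),
        .ite (.eq (.get 6 (.var 10)) (.lit 0))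
          (.block [
            .store 7 (.var 6) (.var 10),
            .store 8 (.var 10) (.var 6),
            .assign 6 (.var 6 + .lit 1)])
          .skip])

theorem kahn_reaches {B S n m : ℕ} {src dst : ℕ → ℕ} {σ : Mem}
    (hS : n + m + 2 ≤ S) (hB : 100 * (n + m + 2) ≤ B)
    (h1 : σ.arr 1 = dst) (hhead : ∀ v, σ.arr 4 v = lastBefore src v m)
    (hnext : ∀ e < m, σ.arr 5 e = lastBefore src (src e) e)
    (h7 : σ.var 7 = 0) (h8 : σ.var 8 = 0) (h9 : σ.var 9 = 0)
    (hI : KahnInv n m src dst (σ.arr 6) (σ.arr 7) (σ.arr 8) (σ.arr 9) (fun _ => False)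
      (σ.var 6) 0 0 0)
    (hsrc : ∀ e < m, src e < n) (hdst : ∀ e < m, dst e < n)
    (hac : ∀ S : Set ℕ, (∃ v < n, v ∈ S) →
      ∃ v < n, v ∈ S ∧ ∀ e < m, dst e = v → src e ∉ S) :
    Reaches B S kahn σ fun τ =>
      TopSorted n m src dst (τ.arr 8) (τ.arr 9) ∧ Frame kahn σ τ := by
  refine (Reaches.loop (fun τ => KahnInv n m src dst (τ.arr 6) (τ.arr 7) (τ.arr 8) (τ.arr 9)
    (fun _ => False) (τ.var 6) (τ.var 7) (τ.var 8) (τ.var 9))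
    (fun τ => (n - τ.var 7) + (m - τ.var 9)) ?_ ?_ ?_ ?_).mono ?_
  · simpa only [h7, h8, h9] using hI
  · simp only [h7, h9]; omega
  · intro τ hτ hI
    simp
    omega
  · intro τ hf hI hc
    have e1 := (hf.arr 1 rfl).trans h1
    have e4 : ∀ v, τ.arr 4 v = lastBefore src v m := by
      rw [hf.arr 4 rfl]; exact hhead
    have e5 : ∀ e < m, τ.arr 5 e = lastBefore src (src e) e := by
      rw [hf.arr 5 rfl]; exact hnext
    have hqn := hI.qlen_le
    have hqh := hI.qh_le
    have hk := hI.k_le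
    simp [e1] at hc ⊢
    refine ⟨by omega, fun h0 => ?_, fun h0 => ?_⟩
    · rw [h0] at hI
      have hlt : τ.var 7 < τ.var 6 := lt_of_le_of_ne hqh (hc h0)
      rw [e4]
      exact ⟨by omega, hI.next_node hlt, by omega⟩
    · have hcm := hI.cur_le
      have hdv := hdst (τ.var 8 - 1) (by omega)
      obtain ⟨hpos, hN⟩ := hI.next_edge h0 hdv
      have hk' := hN.k_le
      have hindeg : τ.arr 6 (dst (τ.var 8 - 1)) ≤ m := by
        rw [hI.indeg_eq _ hdv]
        exact (Finset.card_filter_le _ _).trans (by simp)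
      rw [e5 _ (by omega)]
      refine ⟨by omega, by omega, by omega, by omega, by omega, by omega, fun hz => ?_,
        fun hz => ?_⟩
      · have hP := hN.push hdv ⟨rfl, hz⟩
        have := hP.qlen_le
        refine ⟨by omega, hP.congr_pend (by simp) (by simp +contextual), by omega⟩
      · exact ⟨hN.congr_pend (by simp) (by simp [hz]), by omega⟩
  · rintro τ ⟨⟨hI, hc⟩, hf⟩
    simp at hc
    rw [hc.1, hc.2] at hI
    exact ⟨hI.topSorted hsrc hdst hac, hf⟩

end RAM

/-! ### Lowest bits and minima -/

theorem le_log_of_testBit {z i : ℕ} (hi : z.testBit i = true) : i ≤ Nat.log 2 z :=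
  Nat.le_log_of_pow_le one_lt_two (Nat.ge_two_pow_of_testBit hi)

/-- `i` is the lowest bit of `z`. -/
def IsLowestBit (z i : ℕ) : Prop := z.testBit i = true ∧ ∀ j < i, z.testBit j = false

theorem IsLowestBit.le_log {z i : ℕ} (h : IsLowestBit z i) : i ≤ Nat.log 2 z :=
  le_log_of_testBit h.1

theorem IsLowestBit.unique {z i j : ℕ} (hi : IsLowestBit z i) (hj : IsLowestBit z j) :
    i = j := by
  rcases lt_trichotomy i j with h | h | h
  · have := hj.2 i h; rw [hi.1] at this; cases this
  · exact h
  · have := hi.2 j h; rw [hj.1] at this; cases this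

namespace RAM

/-- `a[i] := min (e, a[i])` for a weight array. -/
def Prog.chmin (a : ℕ) (i : IExp) (e : WExp) : Prog :=
  .ite (.wlt e (.get a i)) (.wstore a i e) .skip

@[simp]
theorem Prog.chmin_WP {B a : ℕ} {i : IExp} {e : WExp} {σ : Mem} {Q : Mem → Prop} :
    (Prog.chmin a i e).WP B σ Q ↔ e.Ok B σ ∧ i.Ok B σ ∧
      Q (σ.setWarr a (i.val σ) (min (e.val σ) (σ.warr a (i.val σ)))) := by
  simp only [Prog.chmin, Prog.WP, Cond.Ok, WExp.Ok, Cond.Holds, WExp.val]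
  by_cases h : e.val σ < σ.warr a (i.val σ)
  · simp only [h, min_eq_left h.le]; tauto
  · have : σ.setWarr a (i.val σ) (σ.warr a (i.val σ)) = σ := by
      simp [Mem.setWarr]
    simp only [h, min_eq_right (not_lt.1 h), this]; tauto

/-! ### Shortest paths -/

/-- Initializes the distances from `r`, the distances to `s`, and the weight array 7. -/
def initWeights : Prog :=
  .block [
    .for 5 (.var 0) <| .block [
      .wstore 2 (.var 5) .top,
      .wstore 3 (.var 5) .top,
      .wstore 7 (.var 5) .top],
    .wstore 2 (.var 2) .zero,
    .wstore 3 (.var 3) .zero]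

theorem initWeights_reaches {B S n r s : ℕ} {σ : Mem} (hS : n + 2 ≤ S) (hB : n + 2 ≤ B)
    (hn : σ.var 0 = n) (hr : σ.var 2 = r) (hs : σ.var 3 = s) :
    Reaches B S initWeights σ fun τ =>
      ((∀ v < n, τ.warr 2 v = if v = r then 0 else ⊤) ∧ τ.warr 2 r = 0 ∧
        (∀ v < n, τ.warr 3 v = if v = s then 0 else ⊤) ∧ τ.warr 3 s = 0 ∧
        (∀ v < n, τ.warr 7 v = ⊤)) ∧ Frame initWeights σ τ := by
  refine Reaches.with_frame (Reaches.seq (Reaches.for (K := n)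
    (fun k τ => (∀ v < k, τ.warr 2 v = ⊤) ∧ (∀ v < k, τ.warr 3 v = ⊤) ∧
      (∀ v < k, τ.warr 7 v = ⊤))
    (fun τ hτ => ⟨trivial, (hτ.var 0 rfl).trans hn⟩) rfl (by omega) (by omega)
    (by simp) ?_) ?_)
  · rintro k τ hk hf hx ⟨h2, h3, h7⟩
    simp [hx, Function.update_apply]
    grind
  · rintro τ ⟨⟨h2, h3, h7⟩, hf⟩
    refine (Prog.WP.reaches (Q := fun τ => (∀ v < n, τ.warr 2 v = if v = r then 0 else ⊤) ∧
        τ.warr 2 r = 0 ∧ (∀ v < n, τ.warr 3 v = if v = s then 0 else ⊤) ∧ τ.warr 3 s = 0 ∧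
        (∀ v < n, τ.warr 7 v = ⊤)) ?_ (by omega)).mono fun _ h => h.1
    simp [hf.var 2 rfl, hf.var 3 rfl, hr, hs, Function.update_apply]
    grind

/-- Relaxes all edges, in the order given by `ord` (an expression in the counter, which is
variable 5): the label in weight array `D` at the head is lowered to the label at the tail plus
the weight. -/
def relaxAll (tail head D : ℕ) (ord : IExp) : Prog :=
  .for 5 (.var 1) <| .block [
    .assign 10 (.get 9 ord),
    .chmin D (.get head (.var 10)) (.get D (.get tail (.var 10)) + .get 0 (.var 10))]

/-- Every label is final when it is first used, provided that no edge of the sequence leads back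
to the tail of an earlier or equal one. The finite labels satisfy every predicate `Att` that holds
for the label `0` at `u` and is inherited along the edges, such as being the weight of a walk. -/
theorem relaxAll_reaches {B S n m u tail head D : ℕ} {ord : IExp} {a b f : ℕ → ℕ}
    {w : ℕ → WithTop ℝ} {σ : Mem} (hS : m + 2 ≤ S) (hB : m + 2 ≤ B)
    (hD : D ≠ 0) (hm : σ.var 1 = m) (ha : σ.arr tail = a) (hb : σ.arr head = b)
    (hw : σ.warr 0 = w) (han : ∀ e < m, a e < n)
    (hord : ∀ τ, Frame (relaxAll tail head D ord) σ τ → τ.var 5 < m → ord.Ok B τ ∧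
      σ.arr 9 (ord.val τ) = f (τ.var 5))
    (hf : ∀ k < m, f k < m) (hfs : ∀ e < m, ∃ k < m, f k = e)
    (hacyc : ∀ i j, i ≤ j → j < m → b (f j) ≠ a (f i))
    (hDu : σ.warr D u = 0) (hDv : ∀ v < n, v ≠ u → σ.warr D v = ⊤) (hun : u < n)
    (Att : ℕ → WithTop ℝ → Prop) (hAu : Att u 0)
    (hAs : ∀ e < m, ∀ x, Att (a e) x → Att (b e) (x + w e)) :
    Reaches B S (relaxAll tail head D ord) σ fun τ =>
      (τ.warr D u ≤ 0 ∧ (∀ e < m, τ.warr D (b e) ≤ τ.warr D (a e) + w e) ∧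
        ∀ v < n, τ.warr D v = ⊤ ∨ Att v (τ.warr D v)) ∧
      Frame (relaxAll tail head D ord) σ τ := by
  refine (Reaches.for (N := .var 1) (K := m) (fun k τ => τ.warr D u ≤ 0 ∧
      (∀ i < k, τ.warr D (b (f i)) ≤ τ.warr D (a (f i)) + w (f i)) ∧
        ∀ v < n, τ.warr D v = ⊤ ∨ Att v (τ.warr D v))
    (fun τ hτ => ⟨trivial, (hτ.var 1 rfl).trans hm⟩) rfl (by omega) (by omega) ?_ ?_).mono ?_
  · refine ⟨hDu.le, by simp, fun v hv => ?_⟩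
    by_cases hvu : v = u
    · subst hvu; exact .inr (by simpa [hDu] using hAu)
    · exact .inl (hDv v hv hvu)
  · rintro k τ hk hfr hx ⟨h0, hrel, hatt⟩
    have e1 := (hfr.arr tail rfl).trans ha
    have e2 := (hfr.arr head rfl).trans hb
    have e9 := hfr.arr 9 rfl
    have ew : τ.warr 0 = w := (hfr.warr 0
      (by simp [Prog.for, Prog.writesWarr, Prog.chmin, hD.symm])).trans hw
    obtain ⟨hok, hval⟩ := hord τ hfr (by omega)
    rw [hx] at hval
    simp [e1, e2, e9, ew, hval, hok]
    have hba : ∀ i ≤ k, b (f k) ≠ a (f i) := fun i hi => hacyc i k hi hk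
    refine ⟨?_, ?_, ?_⟩
    · rw [Function.update_apply]
      split_ifs with h
      · exact (min_le_right _ _).trans (h ▸ h0)
      · exact h0
    · intro i hi
      rw [Function.update_of_ne (hba i (by omega)).symm, Function.update_apply]
      split_ifs with h
      · by_cases hik : i = k
        · subst hik; exact min_le_left _ _
        · exact (min_le_right _ _).trans (h ▸ hrel i (by omega))
      · have : i ≠ k := fun hik => h (by rw [hik])
        exact hrel i (by omega)
    · intro v hv
      rw [Function.update_apply]
      split_ifs with h
      · subst h
        obtain hmin | hmin := min_choice (τ.warr D (a (f k)) + w (f k)) (τ.warr D (b (f k)))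
        · rw [hmin]
          obtain ht | ht := hatt _ (han _ (hf k hk))
          · left; simp [ht]
          · exact .inr (hAs _ (hf k hk) _ ht)
        · rw [hmin]; exact hatt _ hv
      · exact hatt v hv
  · rintro τ ⟨⟨h0, hrel, hatt⟩, hfr⟩
    refine ⟨⟨h0, fun e he => ?_, hatt⟩, hfr⟩
    obtain ⟨k, hk, rfl⟩ := hfs e he
    exact hrel k hk

/-! ### Tables for bit operations -/

/-- Tabulates the binary logarithm (integer array 10) and the lowest bit (integer array 11) of the
numbers `1, …, n + 1`. -/
def bitTables : Prog :=
  .for 5 (.var 0 + .lit 1) <| .block [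
    .assign 10 (.var 5 + .lit 1),
    .ite (.eq (.var 10) (.lit 1)) (.store 10 (.var 10) (.lit 0))
      (.store 10 (.var 10) (.get 10 (.var 10 / .lit 2) + .lit 1)),
    .ite (.eq (.var 10 % .lit 2) (.lit 1)) (.store 11 (.var 10) (.lit 0))
      (.store 11 (.var 10) (.get 11 (.var 10 / .lit 2) + .lit 1))]

theorem bitTables_reaches {B S n : ℕ} {σ : Mem} (hS : n + 2 ≤ S) (hB : 2 * n + 4 ≤ B)
    (hn : σ.var 0 = n) (h10 : σ.arr 10 0 = 0) (h11 : σ.arr 11 0 = 0) :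
    Reaches B S bitTables σ fun τ =>
      ((∀ z ≤ n + 1, τ.arr 10 z = Nat.log 2 z) ∧
        (∀ z, 1 ≤ z → z ≤ n + 1 → IsLowestBit z (τ.arr 11 z)) ∧ τ.arr 11 0 = 0) ∧
      Frame bitTables σ τ := by
  refine Reaches.for (K := n + 1) (fun k τ =>
      (∀ z ≤ k, τ.arr 10 z = Nat.log 2 z) ∧
        (∀ z, 1 ≤ z → z ≤ k → IsLowestBit z (τ.arr 11 z)) ∧ τ.arr 11 0 = 0)
    (fun τ hτ => ?_) rfl ?_ ?_ ?_ ?_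
  · have := (hτ.var 0 rfl).trans hn
    simp [this]; omega
  · omega
  · omega
  · refine ⟨fun z hz => ?_, fun z h1 h2 => by omega, h11⟩
    obtain rfl : z = 0 := by omega
    simpa using h10
  · rintro k τ hk hf hx ⟨h10, h11, h110⟩
    have hlog : Nat.log 2 (k + 1) ≤ k := by
      have := Nat.log_lt_self 2 (x := k + 1) (by omega)
      omega
    have hlog' : k ≠ 0 → Nat.log 2 (k + 1) = Nat.log 2 ((k + 1) / 2) + 1 := fun hk0 =>
      Nat.log_of_one_lt_of_le (by omega) (by omega)
    have hlow : (k + 1) % 2 ≠ 1 → IsLowestBit ((k + 1) / 2) (τ.arr 11 ((k + 1) / 2)) := fun hk0 =>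
      h11 _ (by omega) (by omega)
    have hlow' : (k + 1) % 2 ≠ 1 → τ.arr 11 ((k + 1) / 2) ≤ k := fun hk0 =>
      ((hlow hk0).le_log.trans (Nat.log_mono_right (by omega))).trans hlog
    have hI10 : ∀ y, y = Nat.log 2 (k + 1) → ∀ z ≤ k + 1,
        Function.update (τ.arr 10) (k + 1) y z = Nat.log 2 z := by
      rintro y rfl z hzk
      rw [Function.update_apply]
      split_ifs with h
      · rw [h]
      · exact h10 z (by omega)
    have hI11 : ∀ y, IsLowestBit (k + 1) y → (∀ z, 1 ≤ z → z ≤ k + 1 →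
        IsLowestBit z (Function.update (τ.arr 11) (k + 1) y z)) ∧
        Function.update (τ.arr 11) (k + 1) y 0 = 0 := by
      refine fun y hy => ⟨fun z hz hzk => ?_, by simpa using h110⟩
      rw [Function.update_apply]
      split_ifs with h
      · rwa [h]
      · exact h11 z hz (by omega)
    have hodd : (k + 1) % 2 = 1 → IsLowestBit (k + 1) 0 := fun h =>
      ⟨by simp [Nat.testBit_zero, h], by simp⟩
    have heven : (k + 1) % 2 ≠ 1 → IsLowestBit (k + 1) (τ.arr 11 ((k + 1) / 2) + 1) := by
      intro h
      refine ⟨by rw [Nat.testBit_succ]; exact (hlow h).1, fun j hj => ?_⟩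
      obtain _ | j := j
      · simp only [Nat.testBit_zero, decide_eq_false_iff_not]; exact h
      · rw [Nat.testBit_succ]; exact (hlow h).2 j (by omega)
    have hb2 : k ≠ 0 → τ.arr 10 ((k + 1) / 2) = Nat.log 2 ((k + 1) / 2) := fun hk0 =>
      h10 _ (by omega)
    simp [hx]
    by_cases hk0 : k = 0
    · subst hk0
      have h1 := hI10 0 (by simp)
      have h2 := hI11 0 (hodd rfl)
      simp only [zero_add] at h1 h2
      simp
      exact ⟨by omega, by omega, by omega, by omega, h1, h2⟩
    · simp only [hk0, false_imp_iff, true_and, not_false_eq_true, true_imp_iff]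
      have hh := hlog' hk0
      have := hb2 hk0
      refine ⟨by omega, by omega, ⟨by omega, by omega⟩, by omega,
        fun ho => ⟨by omega, hI10 _ (by omega), hI11 _ (hodd ho)⟩, fun he => ?_⟩
      have := hlow' (by omega)
      exact ⟨by omega, hI10 _ (by omega), hI11 _ (heven (by omega))⟩

/-- Computes the block length `b` (variable 11), the number `⌊n / b⌋ + 1` of blocks (variable 12),
and the powers of two up to `2 ^ b`. -/
def blockLength : Prog :=
  .block [
    .assign 11 (.get 10 (.var 0 + .lit 1)),
    .assign 12 (.var 0 / .var 11 + .lit 1),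
    .store 12 (.lit 0) (.lit 1),
    .for 5 (.var 11) (.store 12 (.var 5 + .lit 1) (.lit 2 * .get 12 (.var 5)))]

theorem blockLength_reaches {B S n : ℕ} {σ : Mem} (hS : n + 2 ≤ S) (hB : 2 * n + 4 ≤ B)
    (hn : σ.var 0 = n) (hlog : σ.arr 10 (n + 1) = Nat.log 2 (n + 1)) :
    Reaches B S blockLength σ fun τ =>
      (τ.var 11 = Nat.log 2 (n + 1) ∧ τ.var 12 = n / Nat.log 2 (n + 1) + 1 ∧
        ∀ i ≤ Nat.log 2 (n + 1), τ.arr 12 i = 2 ^ i) ∧ Frame blockLength σ τ := by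
  set b := Nat.log 2 (n + 1) with hb
  have hbn : b ≤ n := by
    have := Nat.log_lt_self 2 (x := n + 1) (by omega)
    omega
  have hpow : 2 ^ b ≤ n + 1 := Nat.pow_log_le_self 2 (by omega)
  have hdiv : n / b ≤ n := Nat.div_le_self _ _
  refine Reaches.with_frame ?_
  refine Reaches.seq (Prog.WP.reaches (Q := fun τ => τ.var 11 = b ∧ τ.var 0 = n) ?_
    (by omega)) ?_
  · simp [hn, hlog]; omega
  rintro τ ⟨⟨h11, h0⟩, -⟩
  refine Reaches.seq (Prog.WP.reaches (Q := fun τ => τ.var 11 = b ∧ τ.var 12 = n / b + 1) ?_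
    (by omega)) ?_
  · simp [h0, h11]; omega
  rintro τ ⟨⟨h11, h12⟩, -⟩
  refine Reaches.seq (Prog.WP.reaches (Q := fun τ => τ.var 11 = b ∧ τ.var 12 = n / b + 1 ∧
    τ.arr 12 0 = 1) ?_ (by omega)) ?_
  · simp [h11, h12]; omega
  rintro τ ⟨⟨h11, h12, h1⟩, -⟩
  refine Reaches.seq (Reaches.for (N := .var 11) (K := b) (fun k τ => ∀ i ≤ k, τ.arr 12 i = 2 ^ i)
    (fun τ hτ => ⟨trivial, (hτ.var 11 rfl).trans h11⟩) rfl (by omega) (by omega) ?_ ?_) ?_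
  · simpa using h1
  · rintro k υ hk hf hx hI
    simp [hx, hI k le_rfl]
    have : 2 ^ (k + 1) ≤ 2 ^ b := Nat.pow_le_pow_right (by omega) hk
    rw [pow_succ'] at this
    refine ⟨⟨by omega, by omega⟩, ⟨by omega, by omega⟩, fun i hi => ?_⟩
    rw [Function.update_apply]
    split_ifs with h
    · rw [h, pow_succ']
    · exact hI i (by omega)
  · rintro υ ⟨hI, hf⟩
    exact .skip (by omega) ⟨(hf.var 11 rfl).trans h11, (hf.var 12 rfl).trans h12, hI⟩

end RAM

/-! ### Infima and sparse tables -/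

/-- `X` is the infimum of the values `C k` over the indices `k` satisfying `p`; it is `⊤` if there
are none. -/
def IsInf (X : WithTop ℝ) (p : ℕ → Prop) (C : ℕ → WithTop ℝ) : Prop :=
  ∀ v, v ≤ X ↔ ∀ k, p k → v ≤ C k

theorem IsInf.congr {X : WithTop ℝ} {p q : ℕ → Prop} {C : ℕ → WithTop ℝ} (h : IsInf X p C)
    (hpq : ∀ k, p k ↔ q k) : IsInf X q C := fun v => by
  rw [h v]; exact forall_congr' fun k => by rw [hpq]

theorem IsInf.min {X Y : WithTop ℝ} {p q : ℕ → Prop} {C : ℕ → WithTop ℝ} (h : IsInf X p C)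
    (h' : IsInf Y q C) : IsInf (min X Y) (fun k => p k ∨ q k) C := fun v => by
  rw [le_min_iff, h v, h' v]
  simp only [or_imp, forall_and]

theorem IsInf.min_single {X : WithTop ℝ} {p : ℕ → Prop} {C : ℕ → WithTop ℝ} (h : IsInf X p C)
    (k : ℕ) : IsInf (Min.min (C k) X) (fun i => p i ∨ i = k) C := fun v => by
  rw [le_min_iff, h v]
  simp only [or_imp, forall_and, forall_eq]
  exact and_comm

theorem isInf_top {p : ℕ → Prop} {C : ℕ → WithTop ℝ} (h : ∀ k, ¬ p k) : IsInf ⊤ p C :=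
  fun v => by simp [h]

/-- Over finitely many indices the infimum is attained, or it is infinite. -/
theorem IsInf.eq_top_or {X : WithTop ℝ} {p : ℕ → Prop} {C : ℕ → WithTop ℝ} (h : IsInf X p C)
    {m : ℕ} (hp : ∀ k, p k → k < m) : X = ⊤ ∨ ∃ k, p k ∧ X = C k := by
  classical
  have hX : X = ((Finset.range m).filter p).inf C := by
    refine eq_of_forall_le_iff fun v => ?_
    rw [h v, Finset.le_inf_iff]
    simp only [Finset.mem_filter, Finset.mem_range]
    exact forall_congr' fun k => ⟨fun hk hk' => hk hk'.2, fun hk hk' => hk ⟨hp k hk', hk'⟩⟩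
  obtain hne | hne := ((Finset.range m).filter p).eq_empty_or_nonempty
  · left; rw [hX, hne, Finset.inf_empty]
  · right
    obtain ⟨k, hk, hkX⟩ := Finset.exists_mem_eq_inf _ hne C
    exact ⟨k, (Finset.mem_filter.1 hk).2, hX.trans hkX⟩

/-- Lowering the cell `z₀` to `c` adds the condition of being at most `c` to the cells. -/
theorem forall_le_update_min {p q : ℕ → Prop} {T : ℕ → WithTop ℝ} {z₀ : ℕ} {c v : WithTop ℝ} :
    (∀ z, p z → q z → v ≤ Function.update T z₀ (min c (T z₀)) z) ↔
      (∀ z, p z → q z → v ≤ T z) ∧ (p z₀ → q z₀ → v ≤ c) := by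
  constructor
  · refine fun h => ⟨fun z hz hz' => ?_, fun hz hz' => ?_⟩
    · have := h z hz hz'
      rw [Function.update_apply] at this
      split_ifs at this with hzz
      · rw [hzz]; exact (le_min_iff.1 this).2
      · exact this
    · have := h z₀ hz hz'
      rw [Function.update_self] at this
      exact (le_min_iff.1 this).1
  · rintro ⟨h, h'⟩ z hz hz'
    rw [Function.update_apply]
    split_ifs with hzz
    · subst hzz; exact le_min (h' hz hz') (h z hz hz')
    · exact h z hz hz'

/-- In a sparse table with rows of length `nb`, the cell `z` in row `j` and column `i` stands for
the range of the `2 ^ j` indices from `i` on; this says that `y` lies in it. -/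
def Covers (nb z y : ℕ) : Prop := z % nb ≤ y ∧ y < z % nb + 2 ^ (z / nb)

theorem covers_mul_add {nb j i y : ℕ} (hi : i < nb) :
    Covers nb (j * nb + i) y ↔ i ≤ y ∧ y < i + 2 ^ j := by
  have h1 : (j * nb + i) / nb = j := by
    rw [mul_comm, Nat.mul_add_div (by omega), Nat.div_eq_of_lt hi, add_zero]
  have h2 : (j * nb + i) % nb = i := by
    rw [Nat.mul_add_mod_of_lt hi]
  rw [Covers, h1, h2]

/-- Two overlapping ranges of the largest possible length `2 ^ j` make up a given range. -/
theorem covers_log_iff {nb a e y : ℕ} (hae : a < e) (he : e ≤ nb) :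
    Covers nb (Nat.log 2 (e - a) * nb + a) y ∨
      Covers nb (Nat.log 2 (e - a) * nb + (e - 2 ^ Nat.log 2 (e - a))) y ↔ a ≤ y ∧ y < e := by
  have h1 : 2 ^ Nat.log 2 (e - a) ≤ e - a := Nat.pow_log_le_self 2 (by omega)
  have h2 : e - a < 2 ^ (Nat.log 2 (e - a) + 1) := Nat.lt_pow_succ_log_self (by omega) _
  have h3 : 0 < 2 ^ Nat.log 2 (e - a) := by positivity
  rw [pow_succ] at h2
  rw [covers_mul_add (by omega), covers_mul_add (by omega)]
  omega

/-- The range of a cell is the union of two ranges of the row below, the second of which may lie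
outside the table. -/
theorem covers_iff_row_below {nb z y : ℕ} (hz : nb ≤ z) (hy : y < nb) :
    Covers nb z y ↔ Covers nb (z - nb) y ∨
      (z % nb + 2 ^ (z / nb - 1) < nb ∧ Covers nb (z - nb + 2 ^ (z / nb - 1)) y) := by
  obtain ⟨j, i, hi, rfl⟩ : ∃ j i, i < nb ∧ z = (j + 1) * nb + i := by
    refine ⟨z / nb - 1, z % nb, Nat.mod_lt _ (by omega), ?_⟩
    have : 1 ≤ z / nb := (Nat.one_le_div_iff (by omega)).2 hz
    rw [Nat.sub_add_cancel this, mul_comm, Nat.div_add_mod]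
  have h1 : ((j + 1) * nb + i) / nb = j + 1 := by
    rw [mul_comm, Nat.mul_add_div (by omega), Nat.div_eq_of_lt hi, add_zero]
  have h2 : ((j + 1) * nb + i) % nb = i := Nat.mul_add_mod_of_lt hi
  have h3 : (j + 1) * nb + i - nb = j * nb + i := by
    rw [add_mul, one_mul]; omega
  rw [h1, h2, h3, Nat.add_sub_cancel, covers_mul_add hi, covers_mul_add hi, add_assoc]
  have h4 : 2 ^ (j + 1) = 2 * 2 ^ j := pow_succ' _ _
  constructor
  · rintro ⟨h5, h6⟩
    by_cases h7 : y < i + 2 ^ j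
    · exact .inl ⟨h5, h7⟩
    · refine .inr ⟨by omega, ?_⟩
      rw [covers_mul_add (by omega)]; omega
  · rintro (h5 | ⟨h5, h6⟩)
    · omega
    · rw [covers_mul_add h5] at h6; omega

/-- The sparse table has linear size. -/
theorem table_size_le {n b : ℕ} (hb : b ≤ n) : (b + 1) * (n / b + 1) ≤ 3 * n + 1 := by
  have h1 : b * (n / b) ≤ n := Nat.mul_div_le n b
  have h2 : n / b ≤ n := Nat.div_le_self n b
  nlinarith

namespace RAM

/-! ### Intervals -/

/-- Computes, for the `k`-th edge in topological order, the interval of the positions over which the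
edge passes, and the length of a shortest walk from `r` to `s` through the edge. The edges of the
given path get the length `∞`. For `δ = 1` the interval may be empty. -/
def intervals (δ : ℕ) : Prog :=
  .for 5 (.var 1) <| .block [
    .assign 10 (.get 9 (.var 5)),
    .store 13 (.var 5) (.get 8 (.get 0 (.var 10)) + .lit δ),
    .store 14 (.var 5) (.get 8 (.get 1 (.var 10)) - .lit 1),
    .ite (.eq (.get 3 (.var 10)) (.lit 0))
      (.wstore 4 (.var 5) (.get 2 (.get 0 (.var 10)) + .get 0 (.var 10) +
        .get 3 (.get 1 (.var 10))))
      (.wstore 4 (.var 5) .top)]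

theorem intervals_reaches {B S n m δ : ℕ} {src dst pos eord mark : ℕ → ℕ}
    {w d t : ℕ → WithTop ℝ} {σ : Mem} (hS : m + 2 ≤ S) (hB : 2 * (n + m + 2) ≤ B) (hδ : δ ≤ 1)
    (hm : σ.var 1 = m) (hsrc : σ.arr 0 = src) (hdst : σ.arr 1 = dst) (hmark : σ.arr 3 = mark)
    (hpos : σ.arr 8 = pos) (heord : σ.arr 9 = eord) (hw : σ.warr 0 = w) (hd : σ.warr 2 = d)
    (ht : σ.warr 3 = t) (hsp : ∀ k < m, pos (src (eord k)) < n)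
    (hdp : ∀ k < m, pos (dst (eord k)) < n) :
    Reaches B S (intervals δ) σ fun τ =>
      (∀ k < m, τ.arr 13 k = pos (src (eord k)) + δ ∧ τ.arr 14 k = pos (dst (eord k)) - 1 ∧
        τ.warr 4 k = if mark (eord k) = 0 then
          d (src (eord k)) + w (eord k) + t (dst (eord k)) else ⊤) ∧
      Frame (intervals δ) σ τ := by
  refine Reaches.for (K := m) (fun k τ => ∀ i < k, τ.arr 13 i = pos (src (eord i)) + δ ∧
      τ.arr 14 i = pos (dst (eord i)) - 1 ∧ τ.warr 4 i = if mark (eord i) = 0 then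
          d (src (eord i)) + w (eord i) + t (dst (eord i)) else ⊤)
    (fun τ hτ => ⟨trivial, (hτ.var 1 rfl).trans hm⟩) rfl (by omega) (by omega) (by simp) ?_
  rintro k τ hk hf hx hI
  have h1 := hsp k hk
  have h2 := hdp k hk
  simp [hx, (hf.arr 0 rfl).trans hsrc, (hf.arr 1 rfl).trans hdst, (hf.arr 3 rfl).trans hmark,
    (hf.arr 8 rfl).trans hpos, (hf.arr 9 rfl).trans heord, (hf.warr 0 rfl).trans hw,
    (hf.warr 2 rfl).trans hd, (hf.warr 3 rfl).trans ht]
  refine ⟨by omega, by omega, by omega, fun h0 i hi => ?_, fun h0 i hi => ?_⟩ <;>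
  · by_cases hik : i = k
    · subst hik; simp [h0]
    · simp only [Function.update_of_ne hik]
      exact hI i (by omega)

/-! ### Stabbing minima: intervals that meet several blocks -/

/-- Fills the sparse table, which has `b + 1` rows of one cell per block, with `∞`. -/
def initTable : Prog :=
  .for 5 ((.var 11 + .lit 1) * .var 12) (.wstore 8 (.var 5) .top)

theorem initTable_reaches {B S b nb : ℕ} {σ : Mem} (hS : (b + 1) * nb < S)
    (hB : (b + 1) * nb + b + 2 < B) (hb : σ.var 11 = b) (hnb : σ.var 12 = nb) :
    Reaches B S initTable σ fun τ =>
      (∀ z < (b + 1) * nb, τ.warr 8 z = ⊤) ∧ Frame initTable σ τ := by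
  refine Reaches.for (K := (b + 1) * nb) (fun k τ => ∀ z < k, τ.warr 8 z = ⊤)
    (fun τ hτ => ?_) rfl hS (by omega) (by simp) ?_
  · simp [(hτ.var 11 rfl).trans hb, (hτ.var 12 rfl).trans hnb]
    omega
  · rintro k τ hk hf hx hI
    simp [hx]
    intro z hz
    rw [Function.update_apply]
    split_ifs with h
    · rfl
    · exact hI z (by omega)

/-- Enters every interval that meets several blocks: at its last point, for the part in its last
block, and at two cells of the sparse table, for the blocks strictly between its first and its
last one. -/
def spread : Prog :=
  .for 5 (.var 1) <|
    .ite (.lt (.get 13 (.var 5) / .var 11) (.get 14 (.var 5) / .var 11))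
      (.block [
        .chmin 7 (.get 14 (.var 5)) (.get 4 (.var 5)),
        .assign 13 (.get 13 (.var 5) / .var 11 + .lit 1),
        .assign 14 (.get 14 (.var 5) / .var 11),
        .ite (.lt (.var 13) (.var 14))
          (.block [
            .assign 10 (.get 10 (.var 14 - .var 13)),
            .chmin 8 (.var 10 * .var 12 + .var 13) (.get 4 (.var 5)),
            .chmin 8 (.var 10 * .var 12 + (.var 14 - .get 12 (.var 10))) (.get 4 (.var 5))])
          .skip])
      .skip

theorem spread_reaches {B S n m b nb : ℕ} {L R : ℕ → ℕ} {C : ℕ → WithTop ℝ} {σ : Mem}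
    (hS : m + 2 ≤ S) (hB : 100 * (n + m + 2) ≤ B) (hb : b = Nat.log 2 (n + 1))
    (hnb : nb = n / b + 1)
    (hm : σ.var 1 = m) (h11 : σ.var 11 = b) (h12 : σ.var 12 = nb)
    (hL : σ.arr 13 = L) (hR : σ.arr 14 = R) (hC : σ.warr 4 = C)
    (hlog : ∀ z ≤ n + 1, σ.arr 10 z = Nat.log 2 z)
    (hpow : ∀ i ≤ b, σ.arr 12 i = 2 ^ i) (hLn : ∀ k < m, L k ≤ n)
    (hRn : ∀ k < m, R k < n) (h7 : ∀ x < n, σ.warr 7 x = ⊤)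
    (h8 : ∀ z < (b + 1) * nb, σ.warr 8 z = ⊤) :
    Reaches B S spread σ fun τ =>
      ((∀ x < n, IsInf (τ.warr 7 x) (fun k => k < m ∧ L k / b < R k / b ∧ R k = x) C) ∧
        (∀ y < nb, ∀ v, (∀ z < (b + 1) * nb, Covers nb z y → v ≤ τ.warr 8 z) ↔
          ∀ k < m, L k / b < y → y < R k / b → v ≤ C k)) ∧
      Frame spread σ τ := by
  refine Reaches.for (K := m) (fun l τ =>
      (∀ x < n, IsInf (τ.warr 7 x) (fun k => k < l ∧ L k / b < R k / b ∧ R k = x) C) ∧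
        (∀ y < nb, ∀ v, (∀ z < (b + 1) * nb, Covers nb z y → v ≤ τ.warr 8 z) ↔
          ∀ k < l, L k / b < y → y < R k / b → v ≤ C k))
    (fun τ hτ => ⟨trivial, (hτ.var 1 rfl).trans hm⟩) rfl (by omega) (by omega) ?_ ?_
  · refine ⟨fun x hx => ?_, fun y hy v => ?_⟩
    · simp only [Mem.setVar_warr]
      rw [h7 x hx]; exact isInf_top (by simp)
    · simp only [Mem.setVar_warr]
      constructor
      · simp
      · intro _ z hz _
        rw [h8 z hz]; exact le_top
  · rintro l τ hl hf hx ⟨h7, h8⟩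
    have e10 : ∀ z ≤ n + 1, τ.arr 10 z = Nat.log 2 z := by
      rw [hf.arr 10 rfl]; exact hlog
    have e12 : ∀ i ≤ b, τ.arr 12 i = 2 ^ i := by
      rw [hf.arr 12 rfl]; exact hpow
    simp [hx, (hf.var 11 rfl).trans h11, (hf.var 12 rfl).trans h12, (hf.arr 13 rfl).trans hL,
      (hf.arr 14 rfl).trans hR, (hf.warr 4 rfl).trans hC]
    have hRl := hRn l hl
    have hLb0 : 0 ≤ L l / b := Nat.zero_le _
    have hLb : L l / b ≤ n := (Nat.div_le_self _ _).trans (hLn l hl)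
    have hbn : b ≤ n := by
      have := Nat.log_lt_self 2 (x := n + 1) (by omega)
      omega
    have hsize := hnb ▸ table_size_le hbn
    have hRb : R l / b ≤ n / b := Nat.div_le_div_right hRl.le
    have hnbn : n / b ≤ n := Nat.div_le_self _ _
    have h7' : L l / b < R l / b → ∀ x < n, IsInf
        (Function.update (τ.warr 7) (R l) (min (C l) (τ.warr 7 (R l))) x)
        (fun k => k ≤ l ∧ L k / b < R k / b ∧ R k = x) C := by
      intro hlr x hx
      rw [Function.update_apply]
      split_ifs with h
      · subst h
        refine ((h7 _ hx).min_single l).congr fun k => ?_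
        grind
      · refine (h7 x hx).congr fun k => ?_
        grind
    have hsplit : ∀ y v, (∀ k ≤ l, L k / b < y → y < R k / b → v ≤ C k) ↔
        (∀ k < l, L k / b < y → y < R k / b → v ≤ C k) ∧
          (L l / b < y ∧ y < R l / b → v ≤ C l) := by
      intro y v
      constructor
      · exact fun h => ⟨fun k hk => h k hk.le, fun hy => h l le_rfl hy.1 hy.2⟩
      · rintro ⟨h, h'⟩ k hk hky hyk
        obtain rfl | hk := hk.eq_or_lt
        · exact h' ⟨hky, hyk⟩
        · exact h k hk hky hyk
    refine ⟨⟨by omega, by omega⟩, fun hlr => ⟨by omega, by omega, fun hin => ?_,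
      fun hout => ⟨h7' hlr, fun y hy v => ?_⟩⟩, fun hle => ⟨fun x hx => ?_, fun y hy v => ?_⟩⟩
    · have hlog' : Nat.log 2 (R l / b - (L l / b + 1)) ≤ b := by
        conv_rhs => rw [hb]
        exact Nat.log_mono_right (by omega)
      rw [e10 _ (by omega), e12 _ hlog']
      have hrow : Nat.log 2 (R l / b - (L l / b + 1)) * nb + nb ≤ (b + 1) * nb := by
        rw [← Nat.succ_mul]; exact Nat.mul_le_mul_right _ (by omega)
      have hcov := fun y => covers_log_iff (nb := nb) (a := L l / b + 1) (e := R l / b) (y := y)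
        hin (by omega)
      have hp0 : 0 < 2 ^ Nat.log 2 (R l / b - (L l / b + 1)) := by positivity
      have hlen : R l / b - (L l / b + 1) ≤ n := by omega
      generalize R l / b - (L l / b + 1) = len at *
      refine ⟨by omega, by omega, by omega, h7' hlr, fun y hy v => ?_⟩
      rw [forall_le_update_min, forall_le_update_min, h8 y hy v, hsplit, and_assoc,
        and_congr_right_iff]
      intro _
      have hcy := hcov y
      have h1 : Nat.log 2 len * nb + (L l / b + 1) < (b + 1) * nb := by omega
      have h2 : Nat.log 2 len * nb + (R l / b - 2 ^ Nat.log 2 len) < (b + 1) * nb := by omega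
      rw [Nat.succ_le_iff] at hcy
      rw [← hcy]
      exact ⟨fun h hc => hc.elim (h.1 h1) (h.2 h2), fun h => ⟨fun _ hc => h (.inl hc),
        fun _ hc => h (.inr hc)⟩⟩
    · rw [h8 y hy v, hsplit, and_iff_left]
      omega
    · refine (h7 x hx).congr fun k => ?_
      grind
    · rw [h8 y hy v, hsplit, and_iff_left]
      omega

/-- Extends the minima at the last points of the intervals backwards within the blocks. -/
def sweepBack : Prog :=
  .for 5 (.var 0 - .lit 1) <| .block [
    .assign 10 (.var 0 - (.var 5 + .lit 2)),
    .ite (.eq ((.var 10 + .lit 1) % .var 11) (.lit 0)) .skip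
      (.chmin 7 (.var 10) (.get 7 (.var 10 + .lit 1)))]

theorem sweepBack_reaches {B S n m b : ℕ} {L R : ℕ → ℕ} {C : ℕ → WithTop ℝ} {σ : Mem}
    (hS : n + 2 ≤ S) (hB : n + 2 ≤ B) (hn : σ.var 0 = n) (h11 : σ.var 11 = b) (hn0 : 0 < n)
    (hRn : ∀ k < m, R k < n)
    (h7 : ∀ x < n, IsInf (σ.warr 7 x) (fun k => k < m ∧ L k / b < R k / b ∧ R k = x) C) :
    Reaches B S sweepBack σ fun τ =>
      (∀ x < n, IsInf (τ.warr 7 x)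
        (fun k => k < m ∧ L k / b < R k / b ∧ R k / b = x / b ∧ x ≤ R k) C) ∧
      Frame sweepBack σ τ := by
  refine Reaches.mono (p := sweepBack) (Reaches.for (K := n - 1) (fun l τ =>
      (∀ x < n, x + l + 1 < n → IsInf (τ.warr 7 x)
        (fun k => k < m ∧ L k / b < R k / b ∧ R k = x) C) ∧
      (∀ x < n, n ≤ x + l + 1 → IsInf (τ.warr 7 x)
        (fun k => k < m ∧ L k / b < R k / b ∧ R k / b = x / b ∧ x ≤ R k) C)) ?_ rfl ?_ ?_ ?_
        ?_) ?_
  · intro τ hτ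
    simp [(hτ.var 0 rfl).trans hn]; omega
  · omega
  · omega
  · refine ⟨fun x hx _ => h7 x hx, fun x hx hxn => ?_⟩
    refine (h7 x hx).congr fun k => ?_
    constructor
    · rintro ⟨h1, h2, rfl⟩; exact ⟨h1, h2, rfl, le_rfl⟩
    · rintro ⟨h1, h2, -, h4⟩
      have := hRn k h1
      exact ⟨h1, h2, by omega⟩
  · rintro l τ hl hf hx ⟨hlt, hge⟩
    obtain ⟨y, hy⟩ : ∃ y, n = y + (l + 2) := ⟨n - (l + 2), by omega⟩
    have hny : n - (l + 2) = y := by omega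
    simp [hx, (hf.var 0 rfl).trans hn, (hf.var 11 rfl).trans h11, hny]
    have hge' := hge (y + 1) (by omega) (by omega)
    have hlt' := hlt y (by omega) (by omega)
    have hle : (y + 1) % b ≤ y + 1 := Nat.mod_le _ _
    refine ⟨by omega, by omega, fun h0 => ⟨fun x hx hxl => hlt x hx (by omega),
      fun x hx hxl => ?_⟩, fun h0 => ⟨by omega, fun x hx hxl => ?_, fun x hx hxl => ?_⟩⟩
    · by_cases hxy : x = y
      · subst hxy
        refine hlt'.congr fun k => ?_
        -- the next position starts a new block
        have hdiv : (x + 1) / b = x / b + 1 := Nat.succ_div_of_dvd (Nat.dvd_of_mod_eq_zero h0)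
        constructor
        · rintro ⟨h1, h2, rfl⟩; exact ⟨h1, h2, rfl, le_rfl⟩
        · rintro ⟨h1, h2, h3, h4⟩
          refine ⟨h1, h2, ?_⟩
          by_contra hne
          have := Nat.div_le_div_right (c := b) (show x + 1 ≤ R k by omega)
          omega
      · exact hge x hx (by omega)
    · rw [Function.update_of_ne (by omega)]
      exact hlt x hx (by omega)
    · by_cases hxy : x = y
      · subst hxy
        rw [Function.update_self]
        have hdiv : (x + 1) / b = x / b :=
          Nat.succ_div_of_not_dvd fun h => h0 (Nat.mod_eq_zero_of_dvd h)
        refine (hge'.min hlt').congr fun k => ?_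
        rw [hdiv]
        constructor
        · rintro (⟨h1, h2, h3, h4⟩ | ⟨h1, h2, rfl⟩)
          · exact ⟨h1, h2, h3, by omega⟩
          · exact ⟨h1, h2, rfl, le_rfl⟩
        · rintro ⟨h1, h2, h3, h4⟩
          by_cases hRx : R k = x
          · exact .inr ⟨h1, h2, hRx⟩
          · exact .inl ⟨h1, h2, h3, by omega⟩
      · rw [Function.update_of_ne hxy]
        exact hge x hx (by omega)
  · rintro τ ⟨⟨-, hge⟩, hf⟩
    exact ⟨fun x hx => hge x hx (by omega), hf⟩

/-- Pushes the entries of the sparse table down to row `0`, going through the cells in decreasing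
order. -/
def pushDown : Prog :=
  .for 5 (.var 11 * .var 12) <| .block [
    .assign 10 ((.var 11 + .lit 1) * .var 12 - (.var 5 + .lit 1)),
    .assign 13 (.get 12 (.var 10 / .var 12 - .lit 1)),
    .chmin 8 (.var 10 - .var 12) (.get 8 (.var 10)),
    .ite (.lt (.var 10 % .var 12 + .var 13) (.var 12))
      (.chmin 8 (.var 10 - .var 12 + .var 13) (.get 8 (.var 10)))
      .skip]

/-- `G y v` is the condition on lower bounds `v` that the cells covering block `y` express. -/
theorem pushDown_reaches {B S n b nb : ℕ} {G : ℕ → WithTop ℝ → Prop} {σ : Mem}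
    (hS : 3 * n + 2 ≤ S) (hB : 100 * (n + 2) ≤ B) (hb : b = Nat.log 2 (n + 1))
    (hnb : nb = n / b + 1) (h11 : σ.var 11 = b) (h12 : σ.var 12 = nb)
    (hpow : ∀ i ≤ b, σ.arr 12 i = 2 ^ i)
    (h8 : ∀ y < nb, ∀ v, (∀ z < (b + 1) * nb, Covers nb z y → v ≤ σ.warr 8 z) ↔ G y v) :
    Reaches B S pushDown σ fun τ =>
      (∀ y < nb, ∀ v, v ≤ τ.warr 8 y ↔ G y v) ∧ Frame pushDown σ τ := by
  have hbn : b ≤ n := by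
    have := Nat.log_lt_self 2 (x := n + 1) (by omega)
    omega
  have hsize := hnb ▸ table_size_le hbn
  have hnbn : n / b ≤ n := Nat.div_le_self _ _
  have hadd : (b + 1) * nb = b * nb + nb := by ring
  refine Reaches.mono (p := pushDown) (Reaches.for (K := b * nb) (fun l τ =>
      ∀ y < nb, ∀ v, (∀ z < (b + 1) * nb - l, Covers nb z y → v ≤ τ.warr 8 z) ↔ G y v)
      ?_ rfl ?_ ?_ ?_ ?_) ?_
  · intro τ hτ
    simp [(hτ.var 11 rfl).trans h11, (hτ.var 12 rfl).trans h12]; omega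
  · omega
  · omega
  · simpa using h8
  · rintro l τ hl hf hx hI
    have e12 : ∀ i ≤ b, τ.arr 12 i = 2 ^ i := by
      rw [hf.arr 12 rfl]; exact hpow
    obtain ⟨z, hz⟩ : ∃ z, (b + 1) * nb = z + (l + 1) := ⟨(b + 1) * nb - (l + 1), by omega⟩
    have hz' : (b + 1) * nb - (l + 1) = z := by omega
    have hzl : (b + 1) * nb - l = z + 1 := by omega
    have hnz : nb ≤ z := by omega
    have hdiv : z / nb - 1 ≤ b := by
      have : z / nb < b + 1 := Nat.div_lt_of_lt_mul (by rw [mul_comm]; omega)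
      omega
    have hpb : 2 ^ (z / nb - 1) ≤ n + 1 :=
      (Nat.pow_le_pow_right (by omega) hdiv).trans
        (by rw [hb]; exact Nat.pow_log_le_self 2 (by omega))
    have hzn : z / nb ≤ z := Nat.div_le_self _ _
    have hmod : z % nb < nb := Nat.mod_lt _ (by rw [hnb]; exact Nat.succ_pos _)
    have hpos : 0 < 2 ^ (z / nb - 1) := by positivity
    have hsplit : ∀ y < nb, ∀ v, (∀ x < (b + 1) * nb - l, Covers nb x y → v ≤ τ.warr 8 x) ↔
        (∀ x < z, Covers nb x y → v ≤ τ.warr 8 x) ∧ (Covers nb z y → v ≤ τ.warr 8 z) := by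
      intro y hy v
      rw [hzl]
      constructor
      · exact fun h => ⟨fun x hx => h x (by omega), fun hc => h z (by omega) hc⟩
      · rintro ⟨h, h'⟩ x hx hc
        by_cases hxz : x = z
        · subst hxz; exact h' hc
        · exact h x (by omega) hc
    simp [hx, (hf.var 11 rfl).trans h11, (hf.var 12 rfl).trans h12, hz', e12 _ hdiv]
    have hne : z ≠ z - nb := by omega
    have hmB : z % nb < B := hmod.trans (by omega)
    have hmB' : z % nb + 2 ^ (z / nb - 1) < B :=
      (Nat.add_lt_add_right hmod _).trans (by omega)
    refine ⟨by omega, by omega, by omega, ⟨hmB, hmB'⟩, fun hin => ⟨by omega, fun y hy v => ?_⟩,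
      fun hout y hy v => ?_⟩
    · rw [Function.update_of_ne hne]
      have h2 : ∀ X : ℕ → WithTop ℝ, X = Function.update (τ.warr 8) (z - nb)
          (min (τ.warr 8 z) (τ.warr 8 (z - nb))) →
          X (z - nb + 2 ^ (z / nb - 1)) = τ.warr 8 (z - nb + 2 ^ (z / nb - 1)) := by
        rintro X rfl
        exact Function.update_of_ne (by omega) _ _
      rw [← h2 _ rfl, forall_le_update_min, forall_le_update_min, ← hI y hy v, hsplit y hy v,
        covers_iff_row_below hnz hy, and_assoc, and_congr_right_iff]
      have h3 : z - nb < z := by omega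
      have h4 : z - nb + 2 ^ (z / nb - 1) < z := by omega
      exact fun _ => ⟨fun h hc => hc.elim (h.1 h3) fun hc => h.2 h4 hc.2,
        fun h => ⟨fun _ hc => h (.inl hc), fun _ hc => h (.inr ⟨hin, hc⟩)⟩⟩
    · rw [forall_le_update_min, ← hI y hy v, hsplit y hy v, covers_iff_row_below hnz hy,
        and_congr_right_iff]
      have h3 : z - nb < z := by omega
      exact fun _ => ⟨fun h hc => hc.elim (h h3) fun hc => absurd hc.1 (not_lt.2 hout),
        fun h _ hc => h (.inl hc)⟩
  · rintro τ ⟨hI, hf⟩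
    refine ⟨fun y hy v => ?_, hf⟩
    rw [← hI y hy v, show (b + 1) * nb - b * nb = nb by omega]
    constructor
    · intro h z hz hc
      have := covers_mul_add (nb := nb) (j := 0) (y := y) hz
      simp only [zero_mul, zero_add, pow_zero] at this
      obtain rfl : z = y := by have := this.1 hc; omega
      exact h
    · intro h
      refine h y hy ?_
      have := covers_mul_add (nb := nb) (j := 0) (y := y) hy
      simp only [zero_mul, zero_add, pow_zero] at this
      exact this.2 (by omega)

end RAM

/-! ### Monotone staircases stored as bit masks -/

theorem testBit_log {z : ℕ} (hz : z ≠ 0) : z.testBit (Nat.log 2 z) = true :=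
  Nat.testBit_of_two_pow_le_and_two_pow_add_one_gt (Nat.pow_log_le_self 2 hz)
    (Nat.lt_pow_succ_log_self (by omega) z)

/-- Removing the highest bit below position `r`. -/
theorem testBit_remove {mask r : ℕ} (h : mask % 2 ^ r ≠ 0) (i : ℕ) :
    (mask / 2 ^ r * 2 ^ r + mask % 2 ^ r % 2 ^ Nat.log 2 (mask % 2 ^ r)).testBit i = true ↔
      mask.testBit i = true ∧ i ≠ Nat.log 2 (mask % 2 ^ r) := by
  have hlt : mask % 2 ^ r < 2 ^ r := Nat.mod_lt _ (by positivity)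
  have hq := testBit_log h
  rw [Nat.testBit_mod_two_pow, Bool.and_eq_true, decide_eq_true_eq] at hq
  rw [mul_comm, Nat.testBit_two_pow_mul_add _ ((Nat.mod_le _ _).trans_lt hlt)]
  split_ifs with hi
  · rw [Nat.testBit_mod_two_pow, Nat.testBit_mod_two_pow, Bool.and_eq_true, Bool.and_eq_true,
      decide_eq_true_eq, decide_eq_true_eq]
    constructor
    · rintro ⟨h1, -, h2⟩; exact ⟨h2, h1.ne⟩
    · rintro ⟨h1, h2⟩
      refine ⟨lt_of_le_of_ne (le_log_of_testBit ?_) h2, hi, h1⟩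
      rw [Nat.testBit_mod_two_pow, Bool.and_eq_true, decide_eq_true_eq]
      exact ⟨hi, h1⟩
  · rw [Nat.testBit_div_two_pow, Nat.sub_add_cancel (by omega)]
    constructor
    · exact fun h => ⟨h, by omega⟩
    · exact fun h => h.1

/-- Setting the bit at position `r`. -/
theorem testBit_insert (mask r i : ℕ) :
    ((mask / 2 ^ r / 2 * 2 + 1) * 2 ^ r + mask % 2 ^ r).testBit i = true ↔
      mask.testBit i = true ∨ i = r := by
  have hlt : mask % 2 ^ r < 2 ^ r := Nat.mod_lt _ (by positivity)
  rw [mul_comm, Nat.testBit_two_pow_mul_add _ hlt]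
  split_ifs with hi
  · rw [Nat.testBit_mod_two_pow, Bool.and_eq_true, decide_eq_true_eq]
    constructor
    · exact fun h => .inl h.2
    · rintro (h | h)
      · exact ⟨hi, h⟩
      · omega
  · obtain ⟨j, rfl⟩ : ∃ j, i = j + r := ⟨i - r, by omega⟩
    rw [Nat.add_sub_cancel]
    obtain _ | j := j
    · simp [Nat.testBit_zero]
    · rw [Nat.testBit_succ, show (mask / 2 ^ r / 2 * 2 + 1) / 2 = mask / 2 ^ r / 2 by omega,
        ← Nat.testBit_succ, Nat.testBit_div_two_pow]
      constructor
      · exact .inl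
      · rintro (h | h)
        · exact h
        · omega

/-- The number of bits of a mask. -/
def bitCount (b mask : ℕ) : ℕ := ((Finset.range b).filter fun i => mask.testBit i = true).card

theorem bitCount_remove_lt {b mask r : ℕ} (hmask : mask < 2 ^ b) (h : mask % 2 ^ r ≠ 0) :
    bitCount b (mask / 2 ^ r * 2 ^ r + mask % 2 ^ r % 2 ^ Nat.log 2 (mask % 2 ^ r)) <
      bitCount b mask := by
  have hq := testBit_log h
  rw [Nat.testBit_mod_two_pow, Bool.and_eq_true, decide_eq_true_eq] at hq
  refine Finset.card_lt_card (Finset.ssubset_iff_of_subset (fun i => ?_) |>.2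
    ⟨Nat.log 2 (mask % 2 ^ r), ?_, ?_⟩)
  · simp only [Finset.mem_filter, testBit_remove h]
    tauto
  · simp only [Finset.mem_filter, Finset.mem_range]
    refine ⟨?_, hq.2⟩
    exact (Nat.pow_lt_pow_iff_right (by omega)).1
      ((Nat.ge_two_pow_of_testBit hq.2).trans_lt hmask)
  · simp only [Finset.mem_filter, testBit_remove h]
    tauto

theorem bitCount_insert_le (b mask r : ℕ) :
    bitCount b ((mask / 2 ^ r / 2 * 2 + 1) * 2 ^ r + mask % 2 ^ r) ≤ bitCount b mask + 1 := by
  refine (Finset.card_le_card (t := insert r ((Finset.range b).filter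
    fun i => mask.testBit i = true)) fun i => ?_).trans (Finset.card_insert_le _ _)
  simp only [Finset.mem_filter, Finset.mem_insert, testBit_insert]
  tauto

@[simp]
theorem bitCount_zero (b : ℕ) : bitCount b 0 = 0 := by simp [bitCount]

/-- The bits of `mask` mark positions below `b` at which the values `V` increase. -/
structure Stair (b mask : ℕ) (V : ℕ → WithTop ℝ) : Prop where
  lt : mask < 2 ^ b
  mono : ∀ i j, i ≤ j → mask.testBit i = true → mask.testBit j = true → V i ≤ V j

/-- The number `v` is at most every value marked by a bit at or above position `j`. -/
def StairBound (mask : ℕ) (V : ℕ → WithTop ℝ) (j : ℕ) (v : WithTop ℝ) : Prop :=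
  ∀ i, j ≤ i → mask.testBit i = true → v ≤ V i

namespace Stair

variable {b mask r : ℕ} {V : ℕ → WithTop ℝ} {c : WithTop ℝ}

theorem bit_lt (h : Stair b mask V) {i : ℕ} (hi : mask.testBit i = true) : i < b :=
  (Nat.pow_lt_pow_iff_right (by omega)).1 ((Nat.ge_two_pow_of_testBit hi).trans_lt h.lt)

theorem empty (b : ℕ) (V : ℕ → WithTop ℝ) : Stair b 0 V :=
  ⟨by positivity, by simp⟩

/-- The lowest bit at or above position `r`, given by the lowest bit of the shifted mask. -/
theorem successor {l : ℕ} (hl : IsLowestBit (mask / 2 ^ r) l) :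
    mask.testBit (r + l) = true ∧ ∀ i, r ≤ i → mask.testBit i = true → r + l ≤ i := by
  refine ⟨by rw [add_comm, ← Nat.testBit_div_two_pow]; exact hl.1, fun i hi hb => ?_⟩
  by_contra hlt
  have := hl.2 (i - r) (by omega)
  rw [Nat.testBit_div_two_pow, Nat.sub_add_cancel hi, hb] at this
  cases this

theorem stairBound_of_shift_eq_zero (h0 : mask / 2 ^ r = 0) (v : WithTop ℝ) :
    StairBound mask V r v := by
  intro i hi hb
  have := Nat.testBit_div_two_pow (n := r) mask (i - r)
  rw [h0, Nat.sub_add_cancel hi, hb] at this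
  simp at this

/-- The minimum of the values at or above position `r` is the one at the next bit. -/
theorem stairBound_iff (h : Stair b mask V) {l : ℕ} (hl : IsLowestBit (mask / 2 ^ r) l)
    (v : WithTop ℝ) : StairBound mask V r v ↔ v ≤ V (r + l) := by
  obtain ⟨h1, h2⟩ := successor hl
  exact ⟨fun hv => hv _ (by omega) h1,
    fun hv i hi hb => hv.trans (h.mono _ _ (h2 i hi hb) h1 hb)⟩

/-- A new value at position `r` is irrelevant if the next value is at most as large. -/
theorem stairBound_and_iff_of_le {l : ℕ} (hl : IsLowestBit (mask / 2 ^ r) l)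
    (hc : V (r + l) ≤ c) (j : ℕ) (v : WithTop ℝ) :
    StairBound mask V j v ∧ (j ≤ r → v ≤ c) ↔ StairBound mask V j v :=
  and_iff_left_of_imp fun hv hj => (hv _ (by omega) (successor hl).1).trans hc

theorem remove (h : Stair b mask V) (h0 : mask % 2 ^ r ≠ 0) :
    Stair b (mask / 2 ^ r * 2 ^ r + mask % 2 ^ r % 2 ^ Nat.log 2 (mask % 2 ^ r)) V where
  lt := by
    refine lt_of_le_of_lt ?_ h.lt
    have := Nat.mod_le (mask % 2 ^ r) (2 ^ Nat.log 2 (mask % 2 ^ r))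
    have := Nat.div_add_mod' mask (2 ^ r)
    omega
  mono i j hij hi hj :=
    h.mono i j hij ((testBit_remove h0 i).1 hi).1 ((testBit_remove h0 j).1 hj).1

/-- A value before position `r` is irrelevant if a new value at position `r` is at most as
large. -/
theorem stairBound_remove (h0 : mask % 2 ^ r ≠ 0) (hc : c ≤ V (Nat.log 2 (mask % 2 ^ r)))
    (j : ℕ) (v : WithTop ℝ) :
    StairBound (mask / 2 ^ r * 2 ^ r + mask % 2 ^ r % 2 ^ Nat.log 2 (mask % 2 ^ r)) V j v ∧
      (j ≤ r → v ≤ c) ↔ StairBound mask V j v ∧ (j ≤ r → v ≤ c) := by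
  have hq := testBit_log h0
  rw [Nat.testBit_mod_two_pow, Bool.and_eq_true, decide_eq_true_eq] at hq
  refine and_congr_left fun hv => ⟨fun hs i hi hb => ?_, fun hs i hi hb =>
    hs i hi ((testBit_remove h0 i).1 hb).1⟩
  by_cases hiq : i = Nat.log 2 (mask % 2 ^ r)
  · subst hiq; exact (hv (hi.trans hq.1.le)).trans hc
  · exact hs i hi ((testBit_remove h0 i).2 ⟨hb, hiq⟩)

/-- A new value is entered between smaller and larger ones. -/
theorem insert (h : Stair b mask V) (hr : r < b)
    (hhi : ∀ l, IsLowestBit (mask / 2 ^ r) l → c ≤ V (r + l))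
    (hlow : mask % 2 ^ r ≠ 0 → V (Nat.log 2 (mask % 2 ^ r)) ≤ c)
    (hex : mask / 2 ^ r ≠ 0 → ∃ l, IsLowestBit (mask / 2 ^ r) l) :
    Stair b ((mask / 2 ^ r / 2 * 2 + 1) * 2 ^ r + mask % 2 ^ r) (Function.update V r c) where
  lt := by
    refine Nat.lt_pow_two_of_testBit _ fun i hi => ?_
    rw [Bool.eq_false_iff, Ne, testBit_insert]
    rintro (hb | rfl)
    · exact absurd (h.bit_lt hb) (by omega)
    · omega
  mono i j hij hi hj := by
    rw [testBit_insert] at hi hj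
    obtain rfl | hne := hij.eq_or_lt
    · rfl
    simp only [Function.update_apply]
    split_ifs with h1 h2 h2
    · rfl
    · subst h1
      have hj := hj.resolve_right h2
      obtain ⟨l, hl⟩ := hex (fun h0 => by
        have := Nat.testBit_div_two_pow (n := i) mask (j - i)
        rw [h0, Nat.sub_add_cancel hij, hj] at this
        simp at this)
      obtain ⟨h3, h4⟩ := successor hl
      exact (hhi l hl).trans (h.mono _ _ (h4 j hij hj) h3 hj)
    · subst h2
      have hi := hi.resolve_right h1
      have hbit : (mask % 2 ^ j).testBit i = true := by
        rw [Nat.testBit_mod_two_pow, hi]; simpa using hne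
      have h0 : mask % 2 ^ j ≠ 0 := by
        intro h0; rw [h0] at hbit; simp at hbit
      have hq := testBit_log h0
      rw [Nat.testBit_mod_two_pow, Bool.and_eq_true, decide_eq_true_eq] at hq
      exact (h.mono _ _ (le_log_of_testBit hbit) hi hq.2).trans (hlow h0)
    · exact h.mono i j hij (hi.resolve_right h1) (hj.resolve_right h2)

/-- Entering the value `c` at position `r` adds the condition of being at most `c` at the positions
up to `r`. -/
theorem stairBound_insert (hhi : mask.testBit r = true → c ≤ V r) (j : ℕ) (v : WithTop ℝ) :
    StairBound ((mask / 2 ^ r / 2 * 2 + 1) * 2 ^ r + mask % 2 ^ r) (Function.update V r c) j v ↔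
      StairBound mask V j v ∧ (j ≤ r → v ≤ c) := by
  simp only [StairBound, testBit_insert, Function.update_apply]
  constructor
  · refine fun h => ⟨fun i hi hb => ?_, fun hj => by simpa using h r hj (.inr rfl)⟩
    have := h i hi (.inl hb)
    split_ifs at this with hir
    · subst hir; exact this.trans (hhi hb)
    · exact this
  · rintro ⟨h1, h2⟩ i hi hb
    split_ifs with hir
    · exact h2 (hir ▸ hi)
    · exact h1 i hi (hb.resolve_right hir)

end Stair

/-! ### Stabbing minima: the sweep within the blocks -/

/-- The conditions `A j` on a bound `v`, for the positions `j` of the block of `x` that are not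
before `x`, say that `v` is at most the costs of those among the first `k` intervals that begin in
this block and reach up to position `j`. Positions are counted from the start of the block. -/
def BlockBound (b : ℕ) (L R : ℕ → ℕ) (C : ℕ → WithTop ℝ) (x k : ℕ)
    (A : ℕ → WithTop ℝ → Prop) : Prop :=
  ∀ j < b, x ≤ b * (x / b) + j → ∀ v, A j v ↔
    ∀ i < k, L i / b = x / b → b * (x / b) + j ≤ R i → v ≤ C i

/-- The invariant of the sweep at position `x`, when the first `k` intervals have been entered
into the staircase given by `mask` and `V`; the `k`-th one may already have removed some of the
values that it makes irrelevant. The minima `In` before `x` are computed. -/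
structure SweepInv (n m b : ℕ) (L R : ℕ → ℕ) (C : ℕ → WithTop ℝ) (x k mask : ℕ)
    (V In : ℕ → WithTop ℝ) : Prop where
  x_le : x ≤ n
  k_le : k ≤ m
  le_x : ∀ i < k, L i ≤ x
  x_le_L : ∀ i, k ≤ i → i < m → x ≤ L i
  stair : Stair b mask fun i => V (b * (x / b) + i)
  content : BlockBound b L R C x k (StairBound mask fun i => V (b * (x / b) + i)) ∨
    (k < m ∧ L k ≤ x ∧ x ≤ R k ∧ BlockBound b L R C x (k + 1) fun j v =>
      StairBound mask (fun i => V (b * (x / b) + i)) j v ∧ (b * (x / b) + j ≤ R k → v ≤ C k))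
  out : ∀ y < x, IsInf (In y) (fun i => i < m ∧ L i / b = y / b ∧ L i ≤ y ∧ y ≤ R i) C

namespace SweepInv

variable {n m b : ℕ} {L R : ℕ → ℕ} {C : ℕ → WithTop ℝ} {x k mask : ℕ} {V In : ℕ → WithTop ℝ}

theorem init (hL : ∀ i < m, 0 ≤ L i) : SweepInv n m b L R C 0 0 0 V In where
  x_le := Nat.zero_le _
  k_le := Nat.zero_le _
  le_x := by simp
  x_le_L := fun i _ hi => hL i hi
  stair := .empty _ _
  content := .inl fun j _ _ v => by simp [StairBound]
  out := by simp

theorem pending (h : SweepInv n m b L R C x k mask V In) (hk : k < m) (hL : L k ≤ x) :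
    BlockBound b L R C x (k + 1) fun j v =>
      StairBound mask (fun i => V (b * (x / b) + i)) j v ∧
        (b * (x / b) + j ≤ R k → v ≤ C k) := by
  obtain hf | ⟨-, -, -, hp⟩ := h.content
  · have hLx : L k = x := le_antisymm hL (h.x_le_L k le_rfl hk)
    intro j hj hxj v
    beta_reduce
    rw [hf j hj hxj v]
    constructor
    · rintro ⟨h1, h2⟩ i hi hib hiR
      obtain rfl | hi := Nat.lt_succ_iff_lt_or_eq.1 hi |>.symm
      · exact h2 hiR
      · exact h1 i hi hib hiR
    · exact fun h1 => ⟨fun i hi => h1 i (by omega), h1 k (by omega) (by rw [hLx])⟩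
  · exact hp

/-- An empty interval is skipped. -/
theorem skip (h : SweepInv n m b L R C x k mask V In) (hk : k < m) (hL : L k ≤ x)
    (hR : R k < x) : SweepInv n m b L R C x (k + 1) mask V In :=
  { h with
    k_le := hk
    le_x := fun i hi => by
      obtain rfl | hi := Nat.lt_succ_iff_lt_or_eq.1 hi |>.symm
      · exact hL
      · exact h.le_x i hi
    x_le_L := fun i hi hm => h.x_le_L i (by omega) hm
    content := .inl fun j hj hxj v => by
      refine Iff.trans ?_ (h.pending hk hL j hj hxj v)
      beta_reduce
      rw [and_iff_left]
      omega }

/-- The interval is made irrelevant by a value already present. -/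
theorem discard (h : SweepInv n m b L R C x k mask V In) (hk : k < m) (hL : L k ≤ x)
    {r l : ℕ} (hr : ∀ j < b, b * (x / b) + j ≤ R k ↔ j ≤ r)
    (hl : IsLowestBit (mask / 2 ^ r) l) (hc : V (b * (x / b) + (r + l)) ≤ C k) :
    SweepInv n m b L R C x (k + 1) mask V In :=
  { h with
    k_le := hk
    le_x := fun i hi => by
      obtain rfl | hi := Nat.lt_succ_iff_lt_or_eq.1 hi |>.symm
      · exact hL
      · exact h.le_x i hi
    x_le_L := fun i hi hm => h.x_le_L i (by omega) hm
    content := .inl fun j hj hxj v => by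
      refine Iff.trans ?_ (h.pending hk hL j hj hxj v)
      beta_reduce
      rw [hr j hj]
      exact (Stair.stairBound_and_iff_of_le (V := fun i => V (b * (x / b) + i)) hl hc j v).symm }

/-- A value made irrelevant by the interval is removed. -/
theorem remove (h : SweepInv n m b L R C x k mask V In) (hk : k < m) (hL : L k ≤ x)
    (hR : x ≤ R k) {r : ℕ} (hr : ∀ j < b, b * (x / b) + j ≤ R k ↔ j ≤ r)
    (h0 : mask % 2 ^ r ≠ 0) (hc : C k ≤ V (b * (x / b) + Nat.log 2 (mask % 2 ^ r))) :
    SweepInv n m b L R C x k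
      (mask / 2 ^ r * 2 ^ r + mask % 2 ^ r % 2 ^ Nat.log 2 (mask % 2 ^ r)) V In :=
  { h with
    stair := h.stair.remove h0
    content := .inr ⟨hk, hL, hR, fun j hj hxj v => by
      refine Iff.trans ?_ (h.pending hk hL j hj hxj v)
      beta_reduce
      rw [hr j hj]
      exact Stair.stairBound_remove (V := fun i => V (b * (x / b) + i)) h0 hc j v⟩ }

/-- The interval is entered. -/
theorem insert (h : SweepInv n m b L R C x k mask V In) (hk : k < m) (hL : L k ≤ x)
    {r : ℕ} (hrb : r < b) (hr : ∀ j < b, b * (x / b) + j ≤ R k ↔ j ≤ r)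
    (hhi : ∀ l, IsLowestBit (mask / 2 ^ r) l → C k ≤ V (b * (x / b) + (r + l)))
    (hlow : mask % 2 ^ r ≠ 0 → V (b * (x / b) + Nat.log 2 (mask % 2 ^ r)) ≤ C k)
    (hex : mask / 2 ^ r ≠ 0 → ∃ l, IsLowestBit (mask / 2 ^ r) l) :
    SweepInv n m b L R C x (k + 1) ((mask / 2 ^ r / 2 * 2 + 1) * 2 ^ r + mask % 2 ^ r)
      (Function.update V (b * (x / b) + r) (C k)) In := by
  have hV : (fun i => Function.update V (b * (x / b) + r) (C k) (b * (x / b) + i)) =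
      Function.update (fun i => V (b * (x / b) + i)) r (C k) := by
    ext i
    simp [Function.update_apply]
  refine
    { h with
      k_le := hk
      le_x := fun i hi => ?_
      x_le_L := fun i hi hm => h.x_le_L i (by omega) hm
      stair := ?_
      content := .inl fun j hj hxj v => ?_ }
  · obtain rfl | hi := Nat.lt_succ_iff_lt_or_eq.1 hi |>.symm
    · exact hL
    · exact h.le_x i hi
  · rw [hV]; exact h.stair.insert hrb hhi hlow hex
  · refine Iff.trans ?_ (h.pending hk hL j hj hxj v)
    beta_reduce
    rw [hr j hj, hV]
    have h0 : mask.testBit r = true → C k ≤ V (b * (x / b) + r) := fun hb =>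
      hhi 0 ⟨by rw [Nat.testBit_div_two_pow, zero_add, hb], by simp⟩
    exact Stair.stairBound_insert (V := fun i => V (b * (x / b) + i)) h0 j v

/-- The minimum at `x` is computed, and the sweep moves on to the next position. -/
theorem advance (h : SweepInv n m b L R C x k mask V In) (hx : x < n) (hb : 0 < b)
    (hLmono : ∀ i j, i ≤ j → j < m → L i ≤ L j) (hk : k < m → x < L k) {X : WithTop ℝ}
    (hX : ∀ v, v ≤ X ↔ StairBound mask (fun i => V (b * (x / b) + i)) (x % b) v) :
    SweepInv n m b L R C (x + 1) k (if (x + 1) % b = 0 then 0 else mask) V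
      (Function.update In x X) := by
  have hf : BlockBound b L R C x k (StairBound mask fun i => V (b * (x / b) + i)) := by
    obtain hf | ⟨h1, h2, -⟩ := h.content
    · exact hf
    · have := hk h1; omega
  have hxL : ∀ i, k ≤ i → i < m → x < L i := fun i hi hm =>
    (hk (by omega)).trans_le (hLmono k i hi hm)
  have hmod : b * (x / b) + x % b = x := Nat.div_add_mod x b
  refine
    { x_le := hx
      k_le := h.k_le
      le_x := fun i hi => (h.le_x i hi).trans (by omega)
      x_le_L := hxL
      stair := ?_
      content := .inl ?_
      out := fun y hy => ?_ }
  · split_ifs with h0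
    · exact .empty _ _
    · have hdiv : (x + 1) / b = x / b :=
        Nat.succ_div_of_not_dvd fun h => h0 (Nat.mod_eq_zero_of_dvd h)
      rw [hdiv]; exact h.stair
  · split_ifs with h0
    · have hdiv : (x + 1) / b = x / b + 1 := Nat.succ_div_of_dvd (Nat.dvd_of_mod_eq_zero h0)
      intro j hj hxj v
      refine iff_of_true (by simp [StairBound]) fun i hi hib => ?_
      have := Nat.div_le_div_right (c := b) (h.le_x i hi)
      omega
    · have hdiv : (x + 1) / b = x / b :=
        Nat.succ_div_of_not_dvd fun h => h0 (Nat.mod_eq_zero_of_dvd h)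
      unfold BlockBound
      rw [hdiv]
      exact fun j hj hxj v => hf j hj (by omega) v
  · rw [Function.update_apply]
    split_ifs with hyx
    · subst hyx
      intro v
      rw [hX, hf _ (Nat.mod_lt _ hb) hmod.ge v, hmod]
      constructor
      · rintro h1 i ⟨h2, h3, h4, h5⟩
        refine h1 i ?_ h3 h5
        by_contra hik
        have := hxL i (by omega) h2
        omega
      · intro h1 i hi hib hiR
        exact h1 i ⟨hi.trans_le h.k_le, hib, h.le_x i hi, hiR⟩
    · exact h.out y (by omega)

end SweepInv

namespace RAM

/-- The sweep over the positions. In every block, the staircase of the costs of the intervals that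
begin there is kept, as a bit mask in variable 14 and as the values in weight array 5. A pass
either treats the next interval (discarding it, removing one value that it makes irrelevant, or
entering it) or computes the minimum at the current position. -/
def sweep : Prog :=
  .block [
    .assign 5 (.lit 0),
    .assign 13 (.lit 0),
    .assign 14 (.lit 0),
    .loop (.lt (.var 5) (.var 0)) <|
      .ite (.and (.lt (.var 13) (.var 1)) (.not (.lt (.var 5) (.get 13 (.var 13)))))
        (.ite (.lt (.get 14 (.var 13)) (.var 5))
          (.assign 13 (.var 13 + .lit 1))
          (.block [
            .assign 6 (.var 11 * (.var 5 / .var 11)),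
            -- By truncated subtraction this is the smaller one of `b - 1` and the offset of the
            -- right end in the block.
            .assign 7 ((.var 11 - .lit 1) -
              ((.var 11 - .lit 1) - (.get 14 (.var 13) - .var 6))),
            .assign 8 (.var 14 / .get 12 (.var 7)),
            .assign 10 (.var 14 % .get 12 (.var 7)),
            .ite (.and (.lt (.lit 0) (.var 8))
                (.not (.wlt (.get 4 (.var 13)) (.get 5 (.var 6 + (.var 7 + .get 11 (.var 8)))))))
              (.assign 13 (.var 13 + .lit 1))
              (.ite (.and (.lt (.lit 0) (.var 10))
                  (.not (.wlt (.get 5 (.var 6 + .get 10 (.var 10))) (.get 4 (.var 13)))))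
                (.assign 14 (.var 8 * .get 12 (.var 7) +
                  .var 10 % .get 12 (.get 10 (.var 10))))
                (.block [
                  .assign 14 ((.var 8 / .lit 2 * .lit 2 + .lit 1) * .get 12 (.var 7) + .var 10),
                  .wstore 5 (.var 6 + .var 7) (.get 4 (.var 13)),
                  .assign 13 (.var 13 + .lit 1)]))]))
        (.block [
          .assign 8 (.var 14 / .get 12 (.var 5 % .var 11)),
          .ite (.lt (.lit 0) (.var 8))
            (.wstore 6 (.var 5) (.get 5 (.var 5 + .get 11 (.var 8))))
            (.wstore 6 (.var 5) .top),
          .assign 5 (.var 5 + .lit 1),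
          .ite (.eq (.var 5 % .var 11) (.lit 0)) (.assign 14 (.lit 0)) .skip])]

theorem sweep_reaches {B S n m b : ℕ} {L R : ℕ → ℕ} {C : ℕ → WithTop ℝ} {σ : Mem}
    (hS : n + 2 * m + 2 ≤ S) (hB : 100 * (n + m + 2) ≤ B) (hb : b = Nat.log 2 (n + 1))
    (hn0 : 0 < n)
    (hn : σ.var 0 = n) (hm : σ.var 1 = m) (h11 : σ.var 11 = b)
    (hL : σ.arr 13 = L) (hR : σ.arr 14 = R) (hC : σ.warr 4 = C)
    (hlog : ∀ z ≤ n + 1, σ.arr 10 z = Nat.log 2 z)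
    (hlow : ∀ z, 1 ≤ z → z ≤ n + 1 → IsLowestBit z (σ.arr 11 z)) (hlow0 : σ.arr 11 0 = 0)
    (hpow : ∀ i ≤ b, σ.arr 12 i = 2 ^ i) (hRn : ∀ k < m, R k < n)
    (hLmono : ∀ i j, i ≤ j → j < m → L i ≤ L j) :
    Reaches B S sweep σ fun τ =>
      (∀ y < n, IsInf (τ.warr 6 y) (fun i => i < m ∧ L i / b = y / b ∧ L i ≤ y ∧ y ≤ R i) C) ∧
      Frame sweep σ τ := by
  have hb1 : 1 ≤ b := by
    rw [hb]; exact Nat.le_log_of_pow_le (by omega) (by omega)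
  have hbn : b ≤ n := by
    have := Nat.log_lt_self 2 (x := n + 1) (by omega)
    omega
  have hpb : 2 ^ b ≤ n + 1 := by
    rw [hb]; exact Nat.pow_log_le_self 2 (by omega)
  refine Reaches.with_frame ?_
  refine Reaches.seq (Prog.WP.reaches (Q := fun τ => τ.var 5 = 0) (by simp; omega)
    (by omega)) ?_
  rintro τ₁ ⟨h5, hf₁⟩
  refine Reaches.seq (Prog.WP.reaches (Q := fun τ => τ.var 13 = 0) (by simp; omega)
    (by omega)) ?_
  rintro τ₂ ⟨h13, hf₂⟩
  refine Reaches.seq (Prog.WP.reaches (Q := fun τ => τ.var 14 = 0) (by simp; omega)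
    (by omega)) ?_
  rintro τ₃ ⟨h14, hf₃⟩
  have h5' : τ₃.var 5 = 0 := by rw [hf₃.var 5 rfl, hf₂.var 5 rfl, h5]
  have h13' : τ₃.var 13 = 0 := by rw [hf₃.var 13 rfl, h13]
  have hf : ∀ a, τ₃.arr a = σ.arr a := fun a => by
    rw [hf₃.arr a rfl, hf₂.arr a rfl, hf₁.arr a rfl]
  have hw : ∀ a, τ₃.warr a = σ.warr a := fun a => by
    rw [hf₃.warr a rfl, hf₂.warr a rfl, hf₁.warr a rfl]
  have hv0 : τ₃.var 0 = n := by rw [hf₃.var 0 rfl, hf₂.var 0 rfl, hf₁.var 0 rfl, hn]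
  have hv1 : τ₃.var 1 = m := by rw [hf₃.var 1 rfl, hf₂.var 1 rfl, hf₁.var 1 rfl, hm]
  have hv11 : τ₃.var 11 = b := by rw [hf₃.var 11 rfl, hf₂.var 11 rfl, hf₁.var 11 rfl, h11]
  clear hf₁ hf₂ hf₃
  -- A pass advances the position, or takes an interval and adds at most one bit to the mask, or
  -- removes a bit.
  refine Reaches.seq (Reaches.loop (fun τ => SweepInv n m b L R C (τ.var 5) (τ.var 13)
    (τ.var 14) (τ.warr 5) (τ.warr 6)) (fun τ => (n - τ.var 5) + 2 * (m - τ.var 13) +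
      bitCount b (τ.var 14)) ?_ ?_ ?_ ?_) ?_
  · simp only [h5', h13', h14]
    exact .init fun _ _ => Nat.zero_le _
  · simp only [h5', h13', h14, bitCount_zero]; omega
  · intro τ _ _
    simp
  · intro τ hfr hI hc
    have e0 := (hfr.var 0 rfl).trans hv0
    have e1 := (hfr.var 1 rfl).trans hv1
    have e11 := (hfr.var 11 rfl).trans hv11
    have a13 : τ.arr 13 = L := by rw [hfr.arr 13 rfl, hf, hL]
    have a14 : τ.arr 14 = R := by rw [hfr.arr 14 rfl, hf, hR]
    have w4 : τ.warr 4 = C := by rw [hfr.warr 4 rfl, hw, hC]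
    have a10 : ∀ z ≤ n + 1, τ.arr 10 z = Nat.log 2 z := by rw [hfr.arr 10 rfl, hf]; exact hlog
    have a11 : ∀ z, 1 ≤ z → z ≤ n + 1 → IsLowestBit z (τ.arr 11 z) := by
      rw [hfr.arr 11 rfl, hf]; exact hlow
    have a110 : τ.arr 11 0 = 0 := by rw [hfr.arr 11 rfl, hf, hlow0]
    have a12 : ∀ i ≤ b, τ.arr 12 i = 2 ^ i := by rw [hfr.arr 12 rfl, hf]; exact hpow
    simp [e0] at hc
    generalize hx : τ.var 5 = x at *
    generalize hk : τ.var 13 = k at *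
    generalize hmask : τ.var 14 = mask at *
    have hbs : b * (x / b) ≤ x := Nat.mul_div_le x b
    have hxb : x / b ≤ x := Nat.div_le_self x b
    have hxd : b * (x / b) + x % b = x := Nat.div_add_mod x b
    have hxm : x % b < b := Nat.mod_lt _ hb1
    have hmlt := hI.stair.lt
    have a11' : ∀ z ≤ n + 1, τ.arr 11 z ≤ b := by
      intro z hz
      obtain rfl | hz0 := Nat.eq_zero_or_pos z
      · rw [a110]; exact Nat.zero_le _
      · refine (a11 z hz0 hz).le_log.trans ?_
        rw [hb]; exact Nat.log_mono_right hz
    have hkm := hI.k_le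
    clear hfr
    refine ⟨by simp, fun hg => ?_, fun hg => ?_⟩
    · simp [e1, a13, hx, hk] at hg
      obtain ⟨hg1, hg2⟩ := hg
      refine ⟨by simp, fun hRx => ?_, fun hRx => ?_⟩
      · simp [a14, hx, hk] at hRx
        simp [hx, hk, hmask]
        exact ⟨by omega, hI.skip hg1 hg2 hRx, by omega⟩
      · simp [a14, hx, hk] at hRx
        obtain ⟨r, hr⟩ : ∃ r, r = b - 1 - (b - 1 - (R k - b * (x / b))) := ⟨_, rfl⟩
        have hrb : r < b := by omega
        have hr12 := a12 r hrb.le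
        have hrR : ∀ j < b, b * (x / b) + j ≤ R k ↔ j ≤ r := by omega
        have hRk := hRn k hg1
        have hhi : mask / 2 ^ r ≤ n := (Nat.div_le_self _ _).trans (by omega)
        have hhi0 : 0 ≤ mask / 2 ^ r := Nat.zero_le _
        have hlo : mask % 2 ^ r ≤ n := (Nat.mod_le _ _).trans (by omega)
        have hpr : 2 ^ r ≤ 2 ^ b := Nat.pow_le_pow_right (by omega) hrb.le
        have hq := a10 (mask % 2 ^ r) (by omega)
        have hqb : Nat.log 2 (mask % 2 ^ r) ≤ b := by
          conv_rhs => rw [hb]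
          exact Nat.log_mono_right (by omega)
        have hq12 := a12 _ hqb
        have hl := a11' (mask / 2 ^ r) (by omega)
        have hmul : mask / 2 ^ r * 2 ^ r + mask % 2 ^ r = mask := Nat.div_add_mod' _ _
        have hmul' : (mask / 2 ^ r / 2 * 2 + 1) * 2 ^ r ≤ mask / 2 ^ r * 2 ^ r + 2 ^ r := by
          rw [← Nat.succ_mul]; exact Nat.mul_le_mul_right _ (by omega)
        have hmm : mask % 2 ^ r % 2 ^ Nat.log 2 (mask % 2 ^ r) ≤ mask % 2 ^ r := Nat.mod_le _ _
        simp only [Prog.block, Prog.WP, IExp.op_add, IExp.op_sub, IExp.op_mul, IExp.op_div,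
          IExp.op_mod, IExp.Ok, IExp.val, WExp.Ok, WExp.val, Cond.Ok, Cond.Holds, Op.eval,
          Mem.setVar_var, Mem.setVar_arr, Mem.setVar_warr, Mem.setWarr_var, Mem.setWarr_warr,
          reduceIte, Nat.reduceEqDiff, hx, hk, hmask, e11, a14, ← hr, hr12, hq, hq12, w4, true_and,
          and_true]
        have hlow1 : mask / 2 ^ r ≠ 0 → IsLowestBit (mask / 2 ^ r) (τ.arr 11 (mask / 2 ^ r)) :=
          fun h0 => a11 _ (by omega) (by omega)
        have huniq : ∀ l, IsLowestBit (mask / 2 ^ r) l → l = τ.arr 11 (mask / 2 ^ r) := by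
          intro l hl'
          have h0 : mask / 2 ^ r ≠ 0 := by
            rintro h0; rw [h0] at hl'; simpa using hl'.1
          exact hl'.unique (hlow1 h0)
        refine ⟨by omega, by omega, by omega, by omega, by omega, ?_, ?_⟩
        · rintro ⟨h1, h2⟩
          refine ⟨by omega, hI.discard hg1 hg2 hrR (hlow1 (by omega)) (not_lt.1 h2), by omega⟩
        · intro h1
          refine ⟨by omega, ?_, ?_⟩
          · rintro ⟨h2, h3⟩
            refine ⟨by omega, hI.remove hg1 hg2 hRx hrR (by omega) (not_lt.1 h3), ?_⟩
            have := bitCount_remove_lt hmlt (r := r) (by omega)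
            omega
          · intro h2
            refine ⟨by omega, by omega, by omega, ?_, ?_⟩
            · refine hI.insert hg1 hg2 hrb hrR (fun l hl' => ?_) (fun h0 => ?_)
                (fun h0 => ⟨_, hlow1 h0⟩)
              · by_contra hlt
                have h0 : mask / 2 ^ r ≠ 0 := by
                  rintro h0; rw [h0] at hl'; simpa using hl'.1
                rw [huniq l hl'] at hlt
                exact h1 ⟨by omega, fun h => hlt h.le⟩
              · by_contra hlt
                exact h2 ⟨by omega, fun h => hlt h.le⟩
            · have := bitCount_insert_le b mask r
              omega
    · simp [e1, a13, hx, hk] at hg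
      have hpx := a12 _ hxm.le
      have hhi : mask / 2 ^ (x % b) ≤ n := (Nat.div_le_self _ _).trans (by omega)
      have hhi0 : 0 ≤ mask / 2 ^ (x % b) := Nat.zero_le _
      have hl := a11' (mask / 2 ^ (x % b)) (by omega)
      have hadv := fun X => hI.advance (X := X) hc hb1 hLmono hg
      simp only [Prog.block, Prog.WP, IExp.op_add, IExp.op_div, IExp.op_mod, IExp.Ok, IExp.val,
        WExp.Ok, WExp.val, Cond.Ok, Cond.Holds, Op.eval, Mem.setVar_var, Mem.setVar_arr,
        Mem.setVar_warr, Mem.setWarr_var, Mem.setWarr_warr, reduceIte, Nat.reduceEqDiff, hx, hk,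
        hmask, e11, hpx, true_and, and_true]
      have hIn : ∀ X, (∀ v, v ≤ X ↔ StairBound mask (fun i => τ.warr 5 (b * (x / b) + i))
          (x % b) v) → (x + 1) % b < B ∧ 0 < B → ((x + 1) % b = 0 → 0 < B ∧
            SweepInv n m b L R C (x + 1) k 0 (τ.warr 5) (Function.update (τ.warr 6) x X) ∧
            n - (x + 1) + 2 * (m - k) + bitCount b 0 < n - x + 2 * (m - k) + bitCount b mask) ∧
          (¬ (x + 1) % b = 0 →
            SweepInv n m b L R C (x + 1) k mask (τ.warr 5) (Function.update (τ.warr 6) x X) ∧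
            n - (x + 1) + 2 * (m - k) + bitCount b mask <
              n - x + 2 * (m - k) + bitCount b mask) := by
        intro X hX _
        have hA := hadv X hX
        rw [bitCount_zero]
        refine ⟨fun h0 => ⟨by omega, ?_, by omega⟩, fun h0 => ⟨?_, by omega⟩⟩
        · simpa only [if_pos h0] using hA
        · simpa only [if_neg h0] using hA
      have hxB : (x + 1) % b < B ∧ 0 < B :=
        ⟨(Nat.mod_lt _ hb1).trans (by omega), by omega⟩
      refine ⟨by omega, by omega, fun h0 => ⟨by omega, by omega, hxB, hIn _ (fun v => ?_) hxB⟩,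
        fun h0 => ⟨by omega, hxB, hIn _ (fun v => ?_) hxB⟩⟩
      · rw [hI.stair.stairBound_iff (a11 _ (by omega) (by omega)), ← add_assoc, hxd]
      · exact iff_of_true le_top (Stair.stairBound_of_shift_eq_zero (by omega) v)
  · rintro τ ⟨⟨hI, hc⟩, hfr⟩
    have e0 := (hfr.var 0 rfl).trans hv0
    simp [e0] at hc
    have hxn : τ.var 5 = n := le_antisymm hI.x_le hc
    rw [hxn] at hI
    exact .skip (by omega) hI.out

end RAM

/-! ### The algorithm -/

namespace RAM

/-- Kahn's algorithm. Integer array 8 receives the positions of the nodes in a topological order,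
and integer array 9 the edges in the order of the positions of their tails. -/
def topologicalSort : Prog := .block [adjacency, initQueue, kahn]

theorem topologicalSort_reaches {B S n m : ℕ} {src dst : ℕ → ℕ} {σ : Mem}
    (hS : n + m + 2 ≤ S) (hB : 100 * (n + m + 2) ≤ B)
    (hn : σ.var 0 = n) (hm : σ.var 1 = m) (h6 : σ.var 6 = 0) (h7 : σ.var 7 = 0)
    (h8 : σ.var 8 = 0) (h9 : σ.var 9 = 0) (h0 : σ.arr 0 = src) (h1 : σ.arr 1 = dst)
    (h4 : ∀ v, σ.arr 4 v = 0) (ha6 : ∀ v, σ.arr 6 v = 0)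
    (hsrc : ∀ e < m, src e < n) (hdst : ∀ e < m, dst e < n)
    (hac : ∀ S : Set ℕ, (∃ v < n, v ∈ S) →
      ∃ v < n, v ∈ S ∧ ∀ e < m, dst e = v → src e ∉ S) :
    Reaches B S topologicalSort σ fun τ =>
      TopSorted n m src dst (τ.arr 8) (τ.arr 9) ∧ Frame topologicalSort σ τ := by
  refine Reaches.with_frame ?_
  refine Reaches.seq (adjacency_reaches hS hB hm h0 h1 h4 ha6) ?_
  rintro τ₁ ⟨⟨ha, hb, hc⟩, hf₁⟩
  refine Reaches.seq (initQueue_reaches (src := src) (eord := τ₁.arr 9) hS hB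
    ((hf₁.var 0 rfl).trans hn) ((hf₁.var 6 rfl).trans h6) rfl hc) ?_
  rintro τ₂ ⟨hI, hf₂⟩
  rw [← hf₂.arr 6 rfl, ← hf₂.arr 9 rfl] at hI
  refine Reaches.seq (kahn_reaches hS hB (dst := dst) ?_ ?_ ?_ ?_ ?_ ?_ hI hsrc hdst hac) ?_
  · rw [hf₂.arr 1 rfl, hf₁.arr 1 rfl, h1]
  · rw [hf₂.arr 4 rfl]; exact ha
  · rw [hf₂.arr 5 rfl]; exact hb
  · rw [hf₂.var 7 rfl, hf₁.var 7 rfl, h7]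
  · rw [hf₂.var 8 rfl, hf₁.var 8 rfl, h8]
  · rw [hf₂.var 9 rfl, hf₁.var 9 rfl, h9]
  · exact fun τ h => .skip (by omega) h.1

/-- No edge `e`, leading from `a e` to `b e`, can lower the label `D (b e)`; the label of `u` is at
most zero, and the finite labels satisfy `Att`. If `Att v x` says that some walk from `u` to `v` has
weight `x`, then the labels are the distances from `u`. -/
def IsPotential (n m u : ℕ) (a b : ℕ → ℕ) (w D : ℕ → WithTop ℝ) (Att : ℕ → WithTop ℝ → Prop) :
    Prop :=
  D u ≤ 0 ∧ (∀ e < m, D (b e) ≤ D (a e) + w e) ∧ ∀ v < n, D v = ⊤ ∨ Att v (D v)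

/-- The distances from the source (weight array 2) and to the sink (weight array 3). -/
def distances : Prog :=
  .block [initWeights, relaxAll 0 1 2 (.var 5), relaxAll 1 0 3 (.var 1 - (.var 5 + .lit 1))]

theorem distances_reaches {B S n m r s : ℕ} {src dst : ℕ → ℕ} {w : ℕ → WithTop ℝ} {σ : Mem}
    (hS : n + m + 2 ≤ S) (hB : 100 * (n + m + 2) ≤ B) (hn : σ.var 0 = n) (hm : σ.var 1 = m)
    (hr : σ.var 2 = r) (hs : σ.var 3 = s) (h0 : σ.arr 0 = src) (h1 : σ.arr 1 = dst)
    (hw : σ.warr 0 = w) (hsrc : ∀ e < m, src e < n) (hdst : ∀ e < m, dst e < n)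
    (hrn : r < n) (hsn : s < n) (hT : TopSorted n m src dst (σ.arr 8) (σ.arr 9))
    (A A' : ℕ → WithTop ℝ → Prop) (hAr : A r 0) (hAs : A' s 0)
    (hA : ∀ e < m, ∀ x, A (src e) x → A (dst e) (x + w e))
    (hA' : ∀ e < m, ∀ x, A' (dst e) x → A' (src e) (x + w e)) :
    Reaches B S distances σ fun τ =>
      (IsPotential n m r src dst w (τ.warr 2) A ∧ IsPotential n m s dst src w (τ.warr 3) A' ∧
        ∀ v < n, τ.warr 7 v = ⊤) ∧ Frame distances σ τ := by
  refine Reaches.with_frame ?_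
  refine Reaches.seq (initWeights_reaches (n := n) (by omega) (by omega) hn hr hs) ?_
  rintro τ₁ ⟨⟨ha, hb, hc, hd, he⟩, hf₁⟩
  refine Reaches.seq (relaxAll_reaches (ord := .var 5) (n := n) (m := m) (u := r) (a := src)
    (b := dst) (f := σ.arr 9) (w := w) (by omega) (by omega) (by omega) ((hf₁.var 1 rfl).trans hm)
    ((hf₁.arr 0 rfl).trans h0) ((hf₁.arr 1 rfl).trans h1) ((hf₁.warr 0 rfl).trans hw) hsrc
    (fun τ _ _ => ⟨trivial, by rw [hf₁.arr 9 rfl]; rfl⟩) hT.eord_lt hT.eord_surj ?_ hb ?_ hrn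
    A hAr hA) ?_
  · intro i j hij hj h
    have h1 := hT.eord_mono i j hij hj
    have h2 := hT.pos_src_lt _ (hT.eord_lt j hj)
    rw [h] at h2
    omega
  · intro v hv hvr
    rw [ha v hv, if_neg hvr]
  rintro τ₂ ⟨h2, hf₂⟩
  refine Reaches.seq (relaxAll_reaches (n := n) (m := m) (u := s) (a := dst) (b := src)
    (f := fun k => σ.arr 9 (m - (k + 1))) (w := w) (by omega) (by omega) (by omega)
    (by rw [hf₂.var 1 rfl, hf₁.var 1 rfl, hm]) (by rw [hf₂.arr 1 rfl, hf₁.arr 1 rfl, h1])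
    (by rw [hf₂.arr 0 rfl, hf₁.arr 0 rfl, h0]) (by rw [hf₂.warr 0 rfl, hf₁.warr 0 rfl, hw]) hdst
    (fun τ hτ hk => ?_) ?_ ?_ ?_ ?_ ?_ hsn A' hAs hA') ?_
  · have hm' : τ.var 1 = m := by rw [hτ.var 1 rfl, hf₂.var 1 rfl, hf₁.var 1 rfl, hm]
    simp [hm', hf₂.arr 9 rfl, hf₁.arr 9 rfl]
    omega
  · exact fun k hk => hT.eord_lt _ (by omega)
  · intro e he
    obtain ⟨k, hk, rfl⟩ := hT.eord_surj e he
    exact ⟨m - (k + 1), by omega, by congr 1; omega⟩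
  · intro i j hij hj h
    have h1 := hT.eord_mono (m - (j + 1)) (m - (i + 1)) (by omega) (by omega)
    have h2 := hT.pos_src_lt _ (hT.eord_lt (m - (i + 1)) (by omega))
    rw [h] at h1
    omega
  · rw [hf₂.warr 3 rfl, hd]
  · intro v hv hvs
    rw [hf₂.warr 3 rfl, hc v hv, if_neg hvs]
  rintro τ₃ ⟨h3, hf₃⟩
  refine .skip (by omega) ⟨?_, h3, ?_⟩
  · rw [hf₃.warr 2 rfl]; exact h2
  · rw [hf₃.warr 7 rfl, hf₂.warr 7 rfl]; exact he

/-- Given intervals `L k, …, R k` (integer arrays 13 and 14) with costs `C k` (weight array 4), the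
minima of the costs of the intervals that contain a given position, each as the minimum of three
stored values. -/
def stabbing : Prog :=
  .block [bitTables, blockLength, initTable, spread, sweep, sweepBack, pushDown]

theorem stabbing_reaches {B S n m : ℕ} {L R : ℕ → ℕ} {C : ℕ → WithTop ℝ} {σ : Mem}
    (hS : 3 * (n + m) + 3 ≤ S) (hB : 100 * (n + m + 2) ≤ B) (hn0 : 0 < n)
    (hn : σ.var 0 = n) (hm : σ.var 1 = m) (h10 : σ.arr 10 0 = 0) (h11 : σ.arr 11 0 = 0)
    (hL : σ.arr 13 = L) (hR : σ.arr 14 = R) (hC : σ.warr 4 = C) (h7 : ∀ v < n, σ.warr 7 v = ⊤)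
    (hLn : ∀ k < m, L k ≤ n) (hRn : ∀ k < m, R k < n)
    (hLmono : ∀ i j, i ≤ j → j < m → L i ≤ L j) :
    Reaches B S stabbing σ fun τ =>
      (∀ x < n, IsInf (min (τ.warr 6 x) (min (τ.warr 7 x) (τ.warr 8 (x / τ.var 11))))
        (fun k => k < m ∧ L k ≤ x ∧ x ≤ R k) C) ∧ Frame stabbing σ τ := by
  obtain ⟨b, hb⟩ : ∃ b, b = Nat.log 2 (n + 1) := ⟨_, rfl⟩
  obtain ⟨nb, hnb⟩ : ∃ nb, nb = n / b + 1 := ⟨_, rfl⟩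
  have hb1 : 1 ≤ b := by
    rw [hb]; exact Nat.le_log_of_pow_le (by omega) (by omega)
  have hbn : b ≤ n := by
    have := Nat.log_lt_self 2 (x := n + 1) (by omega)
    omega
  have hsize : (b + 1) * nb ≤ 3 * n + 1 := hnb ▸ table_size_le hbn
  refine Reaches.with_frame ?_
  refine Reaches.seq (bitTables_reaches (n := n) (by omega) (by omega) hn h10 h11) ?_
  rintro τ₁ ⟨⟨hlog, hlow, hlow0⟩, hf₁⟩
  refine Reaches.seq (blockLength_reaches (n := n) (by omega) (by omega)
    ((hf₁.var 0 rfl).trans hn) (hlog _ le_rfl)) ?_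
  rw [← hb, ← hnb]
  rintro τ₂ ⟨⟨v11, v12, hpow⟩, hf₂⟩
  refine Reaches.seq (initTable_reaches (by omega) (by omega) v11 v12) ?_
  rintro τ₃ ⟨h8, hf₃⟩
  have hlog₃ : ∀ z ≤ n + 1, τ₃.arr 10 z = Nat.log 2 z := by
    rw [hf₃.arr 10 rfl, hf₂.arr 10 rfl]; exact hlog
  have hpow₃ : ∀ i ≤ b, τ₃.arr 12 i = 2 ^ i := by
    rw [hf₃.arr 12 rfl]; exact hpow
  have v11₃ : τ₃.var 11 = b := (hf₃.var 11 rfl).trans v11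
  have v12₃ : τ₃.var 12 = nb := (hf₃.var 12 rfl).trans v12
  have v0₃ : τ₃.var 0 = n := by rw [hf₃.var 0 rfl, hf₂.var 0 rfl, hf₁.var 0 rfl, hn]
  have v1₃ : τ₃.var 1 = m := by rw [hf₃.var 1 rfl, hf₂.var 1 rfl, hf₁.var 1 rfl, hm]
  have hL₃ : τ₃.arr 13 = L := by rw [hf₃.arr 13 rfl, hf₂.arr 13 rfl, hf₁.arr 13 rfl, hL]
  have hR₃ : τ₃.arr 14 = R := by rw [hf₃.arr 14 rfl, hf₂.arr 14 rfl, hf₁.arr 14 rfl, hR]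
  have hC₃ : τ₃.warr 4 = C := by rw [hf₃.warr 4 rfl, hf₂.warr 4 rfl, hf₁.warr 4 rfl, hC]
  refine Reaches.seq (spread_reaches (by omega) hB hb hnb v1₃ v11₃ v12₃ hL₃ hR₃ hC₃ hlog₃ hpow₃
    hLn hRn ?_ h8) ?_
  · rw [hf₃.warr 7 rfl, hf₂.warr 7 rfl, hf₁.warr 7 rfl]; exact h7
  rintro τ₄ ⟨⟨hPf, hTab⟩, hf₄⟩
  refine Reaches.seq (sweep_reaches (n := n) (m := m) (b := b) (L := L) (R := R) (C := C)
    (by omega) hB hb hn0 ((hf₄.var 0 rfl).trans v0₃) ((hf₄.var 1 rfl).trans v1₃)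
    ((hf₄.var 11 rfl).trans v11₃) ((hf₄.arr 13 rfl).trans hL₃) ((hf₄.arr 14 rfl).trans hR₃)
    ((hf₄.warr 4 rfl).trans hC₃) ?_ ?_ ?_ ?_ hRn hLmono) ?_
  · rw [hf₄.arr 10 rfl]; exact hlog₃
  · rw [hf₄.arr 11 rfl, hf₃.arr 11 rfl, hf₂.arr 11 rfl]; exact hlow
  · rw [hf₄.arr 11 rfl, hf₃.arr 11 rfl, hf₂.arr 11 rfl]; exact hlow0
  · rw [hf₄.arr 12 rfl]; exact hpow₃
  rintro τ₅ ⟨hIn, hf₅⟩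
  rw [← hf₅.warr 7 rfl] at hPf
  rw [← hf₅.warr 8 rfl] at hTab
  have v11₅ : τ₅.var 11 = b := by rw [hf₅.var 11 rfl, hf₄.var 11 rfl, v11₃]
  refine Reaches.seq (sweepBack_reaches (n := n) (by omega) (by omega)
    (by rw [hf₅.var 0 rfl, hf₄.var 0 rfl, v0₃]) v11₅ hn0 hRn hPf) ?_
  rintro τ₆ ⟨hPf, hf₆⟩
  rw [← hf₆.warr 8 rfl] at hTab
  refine Reaches.seq (pushDown_reaches (n := n) (by omega) (by omega) hb hnb
    ((hf₆.var 11 rfl).trans v11₅)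
    (by rw [hf₆.var 12 rfl, hf₅.var 12 rfl, hf₄.var 12 rfl, v12₃]) ?_ hTab) ?_
  · rw [hf₆.arr 12 rfl, hf₅.arr 12 rfl, hf₄.arr 12 rfl]; exact hpow₃
  rintro τ₇ ⟨hT, hf₇⟩
  refine .skip (by omega) fun x hx => ?_
  rw [hf₇.var 11 rfl, hf₆.var 11 rfl, v11₅, hf₇.warr 6 rfl, hf₆.warr 6 rfl, hf₇.warr 7 rfl]
  have hxb : x / b < nb := by
    rw [hnb]; exact Nat.lt_succ_of_le (Nat.div_le_div_right hx.le)
  have hT' : IsInf (τ₇.warr 8 (x / b))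
      (fun k => k < m ∧ L k / b < x / b ∧ x / b < R k / b) C := fun v => by
    rw [hT _ hxb v]
    simp only [and_imp]
  refine ((hIn x hx).min ((hPf x hx).min hT')).congr fun k => ?_
  constructor
  · rintro (⟨h1, h2, h3, h4⟩ | ⟨h1, h2, h3, h4⟩ | ⟨h1, h2, h3⟩)
    · exact ⟨h1, h3, h4⟩
    · refine ⟨h1, ?_, h4⟩
      by_contra hlt
      have := Nat.div_le_div_right (c := b) (not_le.1 hlt).le
      omega
    · refine ⟨h1, ?_, ?_⟩
      · by_contra hlt
        have := Nat.div_le_div_right (c := b) (not_le.1 hlt).le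
        omega
      · by_contra hlt
        have := Nat.div_le_div_right (c := b) (not_le.1 hlt).le
        omega
  · rintro ⟨h1, h2, h3⟩
    have h4 := Nat.div_le_div_right (c := b) h2
    have h5 := Nat.div_le_div_right (c := b) h3
    obtain h6 | h6 := h4.eq_or_lt
    · exact .inl ⟨h1, h6, h2, h3⟩
    · obtain h7 | h7 := h5.eq_or_lt
      · exact .inr (.inl ⟨h1, by omega, h7.symm, h3⟩)
      · exact .inr (.inr ⟨h1, h6, h7⟩)

/-- The output: the stabbing minima at the positions of the tails of the edges of the path. -/
def collect : Prog :=
  .for 5 (.var 4) <| .block [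
    .assign 10 (.get 8 (.get 0 (.get 2 (.var 5)))),
    .wstore 1 (.var 5) (.get 6 (.var 10)),
    .chmin 1 (.var 5) (.get 7 (.var 10)),
    .chmin 1 (.var 5) (.get 8 (.var 10 / .var 11))]

theorem collect_reaches {B S n p : ℕ} {σ : Mem} (hS : p < S) (hB : n + p + 2 ≤ B)
    (hp : σ.var 4 = p) (hx : ∀ i < p, σ.arr 8 (σ.arr 0 (σ.arr 2 i)) < n) :
    Reaches B S collect σ fun τ =>
      (∀ i < p, ∀ x, x = σ.arr 8 (σ.arr 0 (σ.arr 2 i)) → τ.warr 1 i =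
        min (σ.warr 6 x) (min (σ.warr 7 x) (σ.warr 8 (x / σ.var 11)))) ∧
      Frame collect σ τ := by
  refine Reaches.for (K := p) (fun l τ => ∀ i < l, ∀ x, x = σ.arr 8 (σ.arr 0 (σ.arr 2 i)) →
    τ.warr 1 i = min (σ.warr 6 x) (min (σ.warr 7 x) (σ.warr 8 (x / σ.var 11))))
    (fun τ hτ => ⟨trivial, (hτ.var 4 rfl).trans hp⟩) rfl hS (by omega) (by simp) ?_
  intro k τ hk hf h5 hI
  have e11 := hf.var 11 rfl
  have e8 := hf.arr 8 rfl
  have e0 := hf.arr 0 rfl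
  have e2 := hf.arr 2 rfl
  have w6 := hf.warr 6 rfl
  have w7 := hf.warr 7 rfl
  have w8 := hf.warr 8 rfl
  have hxk := hx k hk
  have hdiv := Nat.div_le_self (σ.arr 8 (σ.arr 0 (σ.arr 2 k))) (σ.var 11)
  simp [h5, e11, e8, e0, e2, w6, w7, w8, Function.update_apply]
  refine ⟨by omega, fun i hi => ?_⟩
  split_ifs with hik
  · subst hik
    rw [min_left_comm, min_comm (σ.warr 8 _), min_left_comm]
  · exact hI i (by omega) _ rfl

/-- The algorithm for both problems. Every edge outside the path gives the interval of the
positions from the one of its tail plus `δ` up to the one before its head, with the length of a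
shortest walk through the edge as its cost. The `i`-th output is the minimal cost of an interval
that contains the position of the tail of the `i`-th edge of the path. This is the length of a
shortest detour around that edge for `δ = 0`, and around its tail for `δ = 1`. -/
def replacementPaths (δ : ℕ) : Prog :=
  .block [markPath, topologicalSort, distances, intervals δ, stabbing, collect]

theorem replacementPaths_reaches {B S n m r s p δ : ℕ} {src dst P : ℕ → ℕ} {w : ℕ → WithTop ℝ}
    {σ : Mem} (hS : 3 * (n + m) + 3 ≤ S) (hB : 100 * (n + m + 2) ≤ B) (hδ : δ ≤ 1)
    (hv : ∀ x, 5 ≤ x → σ.var x = 0) (ha : ∀ a, 3 ≤ a → ∀ i, σ.arr a i = 0)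
    (hn : σ.var 0 = n) (hm : σ.var 1 = m) (hr : σ.var 2 = r) (hs : σ.var 3 = s)
    (hp : σ.var 4 = p) (h0 : σ.arr 0 = src) (h1 : σ.arr 1 = dst) (h2 : σ.arr 2 = P)
    (hw : σ.warr 0 = w) (hsrc : ∀ e < m, src e < n) (hdst : ∀ e < m, dst e < n)
    (hrn : r < n) (hsn : s < n) (hpn : p ≤ n) (hP : ∀ i < p, P i < m)
    (hac : ∀ S : Set ℕ, (∃ v < n, v ∈ S) →
      ∃ v < n, v ∈ S ∧ ∀ e < m, dst e = v → src e ∉ S)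
    (A A' : ℕ → WithTop ℝ → Prop) (hAr : A r 0) (hAs : A' s 0)
    (hA : ∀ e < m, ∀ x, A (src e) x → A (dst e) (x + w e))
    (hA' : ∀ e < m, ∀ x, A' (dst e) x → A' (src e) (x + w e)) :
    Reaches B S (replacementPaths δ) σ fun τ => ∃ (pos eord : ℕ → ℕ) (d t : ℕ → WithTop ℝ),
      TopSorted n m src dst pos eord ∧ IsPotential n m r src dst w d A ∧
      IsPotential n m s dst src w t A' ∧ ∀ i < p, IsInf (τ.warr 1 i)
        (fun e => e < m ∧ pos (src e) + δ ≤ pos (src (P i)) ∧ pos (src (P i)) < pos (dst e))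
        (fun e => if ∀ j < p, P j ≠ e then d (src e) + w e + t (dst e) else ⊤) := by
  refine Reaches.seq (markPath_reaches (by omega) (by omega) hp h2 (ha 3 le_rfl)) ?_
  rintro τ₁ ⟨hmark, hf₁⟩
  refine Reaches.seq (topologicalSort_reaches (by omega) hB ((hf₁.var 0 rfl).trans hn)
    ((hf₁.var 1 rfl).trans hm) ((hf₁.var 6 rfl).trans (hv 6 (by omega)))
    ((hf₁.var 7 rfl).trans (hv 7 (by omega))) ((hf₁.var 8 rfl).trans (hv 8 (by omega)))
    ((hf₁.var 9 rfl).trans (hv 9 (by omega))) ((hf₁.arr 0 rfl).trans h0)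
    ((hf₁.arr 1 rfl).trans h1) ?_ ?_ hsrc hdst hac) ?_
  · rw [hf₁.arr 4 rfl]; exact ha 4 (by omega)
  · rw [hf₁.arr 6 rfl]; exact ha 6 (by omega)
  rintro τ₂ ⟨hT, hf₂⟩
  have v1₂ : τ₂.var 1 = m := by rw [hf₂.var 1 rfl, hf₁.var 1 rfl, hm]
  have a0₂ : τ₂.arr 0 = src := by rw [hf₂.arr 0 rfl, hf₁.arr 0 rfl, h0]
  have a1₂ : τ₂.arr 1 = dst := by rw [hf₂.arr 1 rfl, hf₁.arr 1 rfl, h1]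
  have w0₂ : τ₂.warr 0 = w := by rw [hf₂.warr 0 rfl, hf₁.warr 0 rfl, hw]
  have v0₂ : τ₂.var 0 = n := by rw [hf₂.var 0 rfl, hf₁.var 0 rfl, hn]
  refine Reaches.seq (distances_reaches (by omega) hB v0₂ v1₂
    (by rw [hf₂.var 2 rfl, hf₁.var 2 rfl, hr]) (by rw [hf₂.var 3 rfl, hf₁.var 3 rfl, hs])
    a0₂ a1₂ w0₂ hsrc hdst hrn hsn hT A A' hAr hAs hA hA') ?_
  rintro τ₃ ⟨⟨hd, ht, h7⟩, hf₃⟩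
  have hsp : ∀ k < m, τ₂.arr 8 (src (τ₂.arr 9 k)) < n := fun k hk =>
    hT.pos_lt _ (hsrc _ (hT.eord_lt k hk))
  have hdp : ∀ k < m, τ₂.arr 8 (dst (τ₂.arr 9 k)) < n := fun k hk =>
    hT.pos_lt _ (hdst _ (hT.eord_lt k hk))
  have hlt : ∀ k < m, τ₂.arr 8 (src (τ₂.arr 9 k)) < τ₂.arr 8 (dst (τ₂.arr 9 k)) := fun k hk =>
    hT.pos_src_lt _ (hT.eord_lt k hk)
  refine Reaches.seq (intervals_reaches (n := n) (by omega) (by omega) hδ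
    ((hf₃.var 1 rfl).trans v1₂) ((hf₃.arr 0 rfl).trans a0₂) ((hf₃.arr 1 rfl).trans a1₂) rfl
    (hf₃.arr 8 rfl) (hf₃.arr 9 rfl) ((hf₃.warr 0 rfl).trans w0₂) rfl rfl hsp hdp) ?_
  rintro τ₄ ⟨hLRC, hf₄⟩
  refine Reaches.seq (stabbing_reaches (n := n) (m := m) hS hB (by omega)
    ((hf₄.var 0 rfl).trans ((hf₃.var 0 rfl).trans v0₂))
    ((hf₄.var 1 rfl).trans ((hf₃.var 1 rfl).trans v1₂)) ?_ ?_ rfl rfl rfl ?_ ?_ ?_ ?_) ?_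
  · rw [hf₄.arr 10 rfl, hf₃.arr 10 rfl, hf₂.arr 10 rfl, hf₁.arr 10 rfl]; exact ha 10 (by omega) 0
  · rw [hf₄.arr 11 rfl, hf₃.arr 11 rfl, hf₂.arr 11 rfl, hf₁.arr 11 rfl]; exact ha 11 (by omega) 0
  · rw [hf₄.warr 7 rfl]; exact h7
  · intro k hk
    rw [(hLRC k hk).1]
    have := hsp k hk
    omega
  · intro k hk
    rw [(hLRC k hk).2.1]
    have := hdp k hk
    omega
  · intro i j hij hj
    rw [(hLRC i (by omega)).1, (hLRC j hj).1]
    exact Nat.add_le_add_right (hT.eord_mono i j hij hj) _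
  rintro τ₅ ⟨hmin, hf₅⟩
  have a8 : τ₅.arr 8 = τ₂.arr 8 := by rw [hf₅.arr 8 rfl, hf₄.arr 8 rfl, hf₃.arr 8 rfl]
  have a0 : τ₅.arr 0 = src := by rw [hf₅.arr 0 rfl, hf₄.arr 0 rfl, hf₃.arr 0 rfl, a0₂]
  have a2 : τ₅.arr 2 = P := by
    rw [hf₅.arr 2 rfl, hf₄.arr 2 rfl, hf₃.arr 2 rfl, hf₂.arr 2 rfl, hf₁.arr 2 rfl, h2]
  have v4 : τ₅.var 4 = p := by
    rw [hf₅.var 4 rfl, hf₄.var 4 rfl, hf₃.var 4 rfl, hf₂.var 4 rfl, hf₁.var 4 rfl, hp]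
  have hx : ∀ i < p, τ₅.arr 8 (τ₅.arr 0 (τ₅.arr 2 i)) < n := fun i hi => by
    rw [a8, a0, a2]; exact hT.pos_lt _ (hsrc _ (hP i hi))
  refine Reaches.seq (collect_reaches (n := n) (by omega) (by omega) v4 hx) ?_
  rintro τ₆ ⟨hout, -⟩
  refine .skip (by omega) ⟨_, _, _, _, hT, hd, ht, fun i hi v => ?_⟩
  rw [hout i hi _ rfl, hmin _ (hx i hi) v, a8, a0, a2]
  have hmark' : ∀ e, τ₃.arr 3 e = 0 ↔ ∀ j < p, P j ≠ e := by
    rw [hf₃.arr 3 rfl, hf₂.arr 3 rfl]; exact hmark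
  constructor
  · rintro h e ⟨he, h1, h2⟩
    obtain ⟨k, hk, rfl⟩ := hT.eord_surj e he
    obtain ⟨eL, eR, eC⟩ := hLRC k hk
    have := h k ⟨hk, by rw [eL]; exact h1, by rw [eR]; omega⟩
    simpa only [eC, hmark'] using this
  · rintro h k ⟨hk, h1, h2⟩
    obtain ⟨eL, eR, eC⟩ := hLRC k hk
    rw [eL] at h1
    rw [eR] at h2
    have := hlt k hk
    have := h _ ⟨hT.eord_lt k hk, h1, by omega⟩
    simpa only [eC, hmark'] using this

end RAM

/-! ### Walks in acyclic graphs -/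

namespace WDigraph

variable {V E : Type} {G H : WDigraph V E} {u v x : V} {e f : E} {es es' : List E}

theorem IsWalk.append (h : G.IsWalk u es v) (h' : G.IsWalk v es' x) :
    G.IsWalk u (es ++ es') x := by
  induction es generalizing u with
  | nil => obtain ⟨-, rfl⟩ := h; exact h'
  | cons e es ih => exact ⟨h.1, h.2.1, ih h.2.2⟩

theorem pathWeight_append (es es' : List E) :
    G.pathWeight (es ++ es') = G.pathWeight es + G.pathWeight es' := by
  simp [pathWeight]

theorem pathWeight_cons (e : E) (es : List E) :
    G.pathWeight (e :: es) = G.weight e + G.pathWeight es := by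
  simp [pathWeight]

theorem nodes_getElem_of_lt (h : G.IsWalk u es v) {i : ℕ} (hi : i < es.length) :
    (G.nodes u es)[i]'(by simp [nodes]; omega) = G.src es[i] := by
  induction es generalizing u i with
  | nil => simp at hi
  | cons e es ih =>
    obtain ⟨-, rfl, h⟩ := h
    cases i with
    | zero => rfl
    | succ i => exact ih h (by simpa using hi)

theorem nodes_getElem_length (h : G.IsWalk u es v) :
    (G.nodes u es)[es.length]'(by simp [nodes]) = v := by
  induction es generalizing u with
  | nil => exact h.2
  | cons e es ih => exact ih h.2.2

/-- A topological order: a number for every node that grows along every edge. -/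
def IsTopological (G : WDigraph V E) (q : V → ℕ) : Prop :=
  ∀ e ∈ G.edges, q (G.src e) < q (G.dst e)

variable {q : V → ℕ}

theorem IsTopological.le_of_mem_nodes (hq : G.IsTopological q) (h : G.IsWalk u es v) :
    ∀ x ∈ G.nodes u es, q u ≤ q x ∧ q x ≤ q v := by
  induction es generalizing u with
  | nil => obtain ⟨-, rfl⟩ := h; simp [nodes]
  | cons e es ih =>
    obtain ⟨he, rfl, h⟩ := h
    have h1 := hq e he
    have ih' := ih h
    have h2 := (ih' (G.dst e) (by simp [nodes])).2
    intro x hx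
    obtain rfl | hx := List.mem_cons.1 hx
    · exact ⟨le_rfl, h1.le.trans h2⟩
    · exact ⟨h1.le.trans (ih' x hx).1, (ih' x hx).2⟩

theorem IsTopological.isPath (hq : G.IsTopological q) (h : G.IsWalk u es v) :
    G.IsPath u es v := by
  refine ⟨h, ?_⟩
  induction es generalizing u with
  | nil => simp [nodes]
  | cons e es ih =>
    obtain ⟨he, rfl, h⟩ := h
    refine List.nodup_cons.2 ⟨fun hm => ?_, ih h⟩
    have h1 := hq e he
    have h2 := (hq.le_of_mem_nodes h _ hm).1
    omega

theorem IsTopological.pairwise (hq : G.IsTopological q) (h : G.IsWalk u es v) :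
    es.Pairwise fun e f => q (G.dst e) ≤ q (G.src f) := by
  induction es generalizing u with
  | nil => exact .nil
  | cons e es ih =>
    refine List.pairwise_cons.2 ⟨fun f hf => ?_, ih h.2.2⟩
    obtain ⟨i, hi, rfl⟩ := List.mem_iff_getElem.1 hf
    refine (hq.le_of_mem_nodes h.2.2 _ ?_).1
    rw [← nodes_getElem_of_lt h.2.2 hi]
    exact List.getElem_mem _

theorem IsWalk.mem_edges (h : G.IsWalk u es v) (he : e ∈ es) : e ∈ G.edges := by
  induction es generalizing u with
  | nil => simp at he
  | cons f es ih =>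
    obtain rfl | he := List.mem_cons.1 he
    · exact h.1
    · exact ih h.2.2 he

/-- Only one edge of a walk passes over the position of the tail of a given one. -/
theorem IsTopological.eq_of_mem (hq : G.IsTopological q) (h : G.IsWalk u es v) {i : ℕ}
    (hi : i < es.length) (he : e ∈ es) (h1 : q (G.src e) ≤ q (G.src es[i]))
    (h2 : q (G.src es[i]) < q (G.dst e)) : e = es[i] := by
  obtain ⟨j, hj, rfl⟩ := List.mem_iff_getElem.1 he
  have hp := List.pairwise_iff_getElem.1 (hq.pairwise h)
  obtain hij | rfl | hij := lt_trichotomy i j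
  · have h3 := hp i j hi hj hij
    have h4 := hq _ (h.mem_edges (List.getElem_mem hi))
    omega
  · rfl
  · have h3 := hp j i hj hi hij
    omega

/-- An acyclic finite graph has a source within every nonempty set of nodes. -/
theorem Acyclic.exists_source [Finite V] (h : G.Acyclic) {S : Set V} (hS : S.Nonempty) :
    ∃ v ∈ S, ∀ e ∈ G.edges, G.dst e = v → G.src e ∉ S := by
  let R : V → V → Prop := fun u v => ∃ es, es ≠ [] ∧ G.IsWalk u es v
  have : IsTrans V R := ⟨fun a b c ⟨es, h1, h2⟩ ⟨es', _, h4⟩ =>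
    ⟨es ++ es', by simp [h1], h2.append h4⟩⟩
  have : Std.Irrefl R := ⟨fun a ⟨es, h1, h2⟩ => h1 (h a es h2)⟩
  obtain ⟨v, hv, hmin⟩ := (Finite.wellFounded_of_trans_of_irrefl R).has_min S hS
  refine ⟨v, hv, fun e he hev hs => hmin _ hs ⟨[e], by simp, he, rfl, ?_, hev⟩⟩
  exact G.dst_mem e he

/-! ### Detours -/

/-- `d` gives the distances from `r`, `t` the distances to `s`, and `q` a topological order. -/
structure IsDistances (G : WDigraph V E) (r s : V) (q : V → ℕ) (d t : V → WithTop ℝ) : Prop where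
  topological : G.IsTopological q
  d_root : d r ≤ 0
  d_edge : ∀ e ∈ G.edges, d (G.dst e) ≤ d (G.src e) + (G.weight e : ℝ)
  d_walk : ∀ v, d v = ⊤ ∨ ∃ es, G.IsWalk r es v ∧ d v = (G.pathWeight es : ℝ)
  t_root : t s ≤ 0
  t_edge : ∀ e ∈ G.edges, t (G.src e) ≤ t (G.dst e) + (G.weight e : ℝ)
  t_walk : ∀ v, t v = ⊤ ∨ ∃ es, G.IsWalk v es s ∧ t v = (G.pathWeight es : ℝ)

/-- The edge `e` lies outside `P` and leads from a position at most `z - δ` to one after `z`. -/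
def PassesOver (G : WDigraph V E) (P : List E) (q : V → ℕ) (δ z : ℕ) (e : E) : Prop :=
  e ∈ G.edges ∧ e ∉ P ∧ q (G.src e) + δ ≤ z ∧ z < q (G.dst e)

/-- `X` is the minimal length of a walk from the source to the sink through an edge that passes over
position `z`, and `⊤` if there is none. -/
def IsDetour (G : WDigraph V E) (P : List E) (q : V → ℕ) (d t : V → WithTop ℝ) (δ z : ℕ)
    (X : WithTop ℝ) : Prop :=
  (∀ e, G.PassesOver P q δ z e → X ≤ d (G.src e) + (G.weight e : ℝ) + t (G.dst e)) ∧
    (X = ⊤ ∨ ∃ e, G.PassesOver P q δ z e ∧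
      X = d (G.src e) + (G.weight e : ℝ) + t (G.dst e))

variable {r s : V} {d t : V → WithTop ℝ}

theorem IsDistances.d_le (h : G.IsDistances r s q d t) (hw : G.IsWalk u es v) :
    d v ≤ d u + (G.pathWeight es : ℝ) := by
  induction es generalizing u with
  | nil => obtain ⟨-, rfl⟩ := hw; simp [pathWeight]
  | cons e es ih =>
    obtain ⟨he, rfl, hw⟩ := hw
    refine (ih hw).trans ?_
    rw [pathWeight_cons, WithTop.coe_add, ← add_assoc]
    gcongr
    exact h.d_edge e he

theorem IsDistances.t_le (h : G.IsDistances r s q d t) (hw : G.IsWalk u es v) :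
    t u ≤ (G.pathWeight es : ℝ) + t v := by
  induction es generalizing u with
  | nil => obtain ⟨-, rfl⟩ := hw; simp [pathWeight]
  | cons e es ih =>
    obtain ⟨he, rfl, hw⟩ := hw
    refine (h.t_edge e he).trans ?_
    rw [pathWeight_cons, WithTop.coe_add, add_comm, add_assoc]
    gcongr
    exact ih hw

/-- The edges of `H` are edges of `G`, with the same ends and weights. -/
structure IsSubgraph (H G : WDigraph V E) : Prop where
  src : H.src = G.src
  dst : H.dst = G.dst
  weight : H.weight = G.weight
  edges : ∀ e ∈ H.edges, e ∈ G.edges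

theorem IsSubgraph.isWalk (h : H.IsSubgraph G) (hw : H.IsWalk u es v) (hv : v ∈ G.verts) :
    G.IsWalk u es v := by
  induction es generalizing u with
  | nil => obtain ⟨-, rfl⟩ := hw; exact ⟨hv, rfl⟩
  | cons e es ih =>
    obtain ⟨h1, h2, h3⟩ := hw
    exact ⟨h.edges e h1, by rw [← h.src, h2], ih (by rw [← h.dst]; exact h3)⟩

theorem IsSubgraph.isWalk_of_dst_le (h : H.IsSubgraph G) (hq : G.IsTopological q)
    (hw : G.IsWalk u es v) (hv : v ∈ H.verts)
    (hedges : ∀ e ∈ G.edges, q (G.dst e) ≤ q v → e ∈ H.edges) : H.IsWalk u es v := by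
  induction es generalizing u with
  | nil => obtain ⟨-, rfl⟩ := hw; exact ⟨hv, rfl⟩
  | cons e es ih =>
    obtain ⟨h1, h2, h3⟩ := hw
    refine ⟨hedges e h1 (hq.le_of_mem_nodes h3 _ (by simp [nodes])).2, by rw [h.src, h2], ?_⟩
    rw [h.dst]; exact ih h3

theorem IsSubgraph.isWalk_of_le_src (h : H.IsSubgraph G) (hq : G.IsTopological q)
    (hw : G.IsWalk u es v) (hv : v ∈ H.verts)
    (hedges : ∀ e ∈ G.edges, q u ≤ q (G.src e) → e ∈ H.edges) : H.IsWalk u es v := by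
  induction es generalizing u with
  | nil => obtain ⟨-, rfl⟩ := hw; exact ⟨hv, rfl⟩
  | cons e es ih =>
    obtain ⟨h1, rfl, h3⟩ := hw
    refine ⟨hedges e h1 le_rfl, by rw [h.src], ?_⟩
    rw [h.dst]
    exact ih h3 fun f hf hle => hedges f hf ((hq e h1).le.trans hle)

theorem IsSubgraph.pathWeight (h : H.IsSubgraph G) (es : List E) :
    H.pathWeight es = G.pathWeight es := by
  rw [WDigraph.pathWeight, WDigraph.pathWeight, h.weight]

/-- A walk from a `low` to a `high` node has an edge from a `low` to a `high` node. -/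
theorem exists_crossing {low high : V → Prop} (hcov : ∀ v ∈ H.verts, low v ∨ high v)
    (hw : H.IsWalk u es v) (hu : low u) (hv : high v) (hlh : ∀ v, low v → ¬ high v) :
    ∃ es₁ e es₂, es = es₁ ++ e :: es₂ ∧ H.IsWalk u es₁ (H.src e) ∧ e ∈ H.edges ∧
      low (H.src e) ∧ high (H.dst e) ∧ H.IsWalk (H.dst e) es₂ v := by
  induction es generalizing u with
  | nil => obtain ⟨-, rfl⟩ := hw; exact absurd hv (hlh _ hu)
  | cons e es ih =>
    obtain ⟨he, rfl, hw⟩ := hw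
    obtain hl | hh := hcov _ (H.dst_mem e he)
    · obtain ⟨es₁, f, es₂, rfl, h1, h2⟩ := ih hw hl
      exact ⟨e :: es₁, f, es₂, rfl, ⟨he, rfl, h1⟩, h2⟩
    · exact ⟨[], e, es, rfl, ⟨H.src_mem e he, rfl⟩, he, hu, hh, hw⟩

/-- If the nodes of `H` are those of `G` at positions at most `z - δ` or after `z`, and the edges
between them that lead from the first to the second kind are those outside `P`, then the detours
give the distance in `H`. -/
theorem IsDetour.isDist {P : List E} {δ z : ℕ} {X : WithTop ℝ} (hX : G.IsDetour P q d t δ z X)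
    (hG : G.IsDistances r s q d t) (hH : H.IsSubgraph G)
    (hr : q r + δ ≤ z) (hs : z < q s) (hsG : s ∈ G.verts)
    (hverts : ∀ v ∈ G.verts, v ∈ H.verts ↔ q v + δ ≤ z ∨ z < q v)
    (hvG : ∀ v ∈ H.verts, v ∈ G.verts)
    (hlow : ∀ e ∈ G.edges, q (G.dst e) + δ ≤ z → e ∈ H.edges)
    (hhigh : ∀ e ∈ G.edges, z < q (G.src e) → e ∈ H.edges)
    (hcross : ∀ e ∈ G.edges, q (G.src e) + δ ≤ z → z < q (G.dst e) → (e ∈ H.edges ↔ e ∉ P)) :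
    H.IsDist r s X := by
  have hq := hG.topological
  have hqH : H.IsTopological q := fun e he => by
    rw [hH.src, hH.dst]; exact hq e (hH.edges e he)
  constructor
  · obtain rfl | ⟨e, ⟨he, heP, h1, h2⟩, rfl⟩ := hX.2
    · exact .inl rfl
    obtain hd | ⟨es₁, hw₁, hd⟩ := hG.d_walk (G.src e)
    · left; simp [hd]
    obtain ht | ⟨es₂, hw₂, ht⟩ := hG.t_walk (G.dst e)
    · left; simp [ht]
    right
    refine ⟨es₁ ++ e :: es₂, hqH.isPath (IsWalk.append (v := G.src e) ?_ ⟨?_, ?_, ?_⟩), ?_⟩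
    · exact hH.isWalk_of_dst_le hq hw₁ ((hverts _ (G.src_mem e he)).2 (.inl h1))
        fun f hf hle => hlow f hf (by omega)
    · exact (hcross e he h1 h2).2 heP
    · rw [hH.src]
    · rw [hH.dst]
      exact hH.isWalk_of_le_src hq hw₂ ((hverts _ hsG).2 (.inr hs))
        fun f hf hle => hhigh f hf (by omega)
    · rw [hd, ht, hH.pathWeight, pathWeight_append, pathWeight_cons]
      push_cast
      rw [add_assoc]
  · rintro y (rfl | ⟨es, ⟨hw, -⟩, rfl⟩)
    · exact le_top
    obtain ⟨es₁, e, es₂, rfl, hw₁, he, h1, h2, hw₂⟩ := exists_crossing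
      (low := fun v => q v + δ ≤ z) (high := fun v => z < q v)
      (fun v hv => (hverts v (hvG v hv)).1 hv) hw hr hs (fun v h1 h2 => by omega)
    have heG := hH.edges e he
    rw [hH.src] at h1 hw₁
    rw [hH.dst] at h2 hw₂
    refine (hX.1 e ⟨heG, (hcross e heG h1 h2).1 he, h1, h2⟩).trans ?_
    have h3 := hG.d_le (hH.isWalk hw₁ (G.src_mem e heG))
    have h4 := hG.t_le (hH.isWalk hw₂ hsG)
    rw [hH.pathWeight, pathWeight_append, pathWeight_cons, WithTop.coe_add, WithTop.coe_add,
      ← add_assoc]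
    refine add_le_add (add_le_add_left ?_ _) ?_
    · refine h3.trans ?_
      simpa using add_le_add_left hG.d_root (G.pathWeight es₁ : WithTop ℝ)
    · refine h4.trans ?_
      simpa using add_le_add_right hG.t_root (G.pathWeight es₂ : WithTop ℝ)

theorem IsDetour.isDist_deleteEdge {P : List E} {X : WithTop ℝ} (hG : G.IsDistances r s q d t)
    (hP : G.IsWalk r P s) (hs : s ∈ G.verts) {i : ℕ} (hi : i < P.length)
    (hX : G.IsDetour P q d t 0 (q (G.src P[i])) X) : (G.deleteEdge P[i]).IsDist r s X := by
  have hq := hG.topological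
  have hPi := hP.mem_edges (List.getElem_mem hi)
  have h1 := hq.le_of_mem_nodes hP (G.src P[i]) (by
    rw [← nodes_getElem_of_lt hP hi]; exact List.getElem_mem _)
  have h2 := hq.le_of_mem_nodes hP (G.dst P[i])
    (List.mem_cons_of_mem _ (List.mem_map_of_mem (List.getElem_mem hi)))
  have h3 := hq _ hPi
  refine hX.isDist hG ⟨rfl, rfl, rfl, fun e he => he.1⟩ h1.1 (h3.trans_le h2.2) hs
    (fun v hv => iff_of_true hv (by omega)) (fun v hv => hv) ?_ ?_ ?_
  · rintro e he hle
    refine ⟨he, ?_⟩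
    rintro rfl
    omega
  · rintro e he hlt
    refine ⟨he, ?_⟩
    rintro rfl
    omega
  · refine fun e he hle hlt =>
      ⟨fun h heP => h.2 (hq.eq_of_mem hP hi heP hle hlt), fun h => ⟨he, ?_⟩⟩
    rintro rfl
    exact h (List.getElem_mem hi)

theorem IsDetour.isDist_deleteNode {P : List E} {X : WithTop ℝ} (hG : G.IsDistances r s q d t)
    (hinj : Function.Injective q) (hP : G.IsWalk r P s) (hs : s ∈ G.verts) {i : ℕ}
    (hi : i < P.length) (hr : G.src P[i] ≠ r)
    (hX : G.IsDetour P q d t 1 (q (G.src P[i])) X) :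
    (G.deleteNode (G.src P[i])).IsDist r s X := by
  have hq := hG.topological
  have hPi := hP.mem_edges (List.getElem_mem hi)
  have h1 := (hq.le_of_mem_nodes hP (G.src P[i]) (by
    rw [← nodes_getElem_of_lt hP hi]; exact List.getElem_mem _)).1
  have h2 := hq.le_of_mem_nodes hP (G.dst P[i])
    (List.mem_cons_of_mem _ (List.mem_map_of_mem (List.getElem_mem hi)))
  have h3 := hq _ hPi
  have h4 : q r ≠ q (G.src P[i]) := fun h => hr (hinj h.symm)
  refine hX.isDist hG ⟨rfl, rfl, rfl, fun e he => he.1⟩ (by omega) (h3.trans_le h2.2) hs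
    (fun v hv => ?_) (fun v hv => hv.1) ?_ ?_ ?_
  · constructor
    · rintro ⟨-, hne⟩
      have := hinj.ne hne
      omega
    · rintro h
      refine ⟨hv, ?_⟩
      rintro rfl
      omega
  · intro e he hle
    have h5 := hq e he
    exact ⟨he, fun h => by rw [h] at h5; omega, fun h => by rw [h] at hle; omega⟩
  · intro e he hlt
    have h5 := hq e he
    exact ⟨he, fun h => by rw [h] at hlt; omega, fun h => by rw [h] at h5; omega⟩
  · refine fun e he hle hlt => ⟨fun h heP => ?_, fun h => ⟨he, fun h => ?_, fun h => ?_⟩⟩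
    · exact h.2.1 (by rw [hq.eq_of_mem hP hi heP (by omega) hlt])
    · rw [h] at hle; omega
    · rw [h] at hlt; omega

end WDigraph

/-! ### The running time and the output -/

open RAM WDigraph

/-- The algorithm runs in linear time with words of logarithmic length, and its output consists of
the detours over the positions of the tails of the edges of the path. -/
theorem replacementPaths_run (δ : ℕ) (hδ : δ ≤ 1) {n m : ℕ} (src dst : Fin m → Fin n)
    (w : Fin m → ℝ) (hac : (ofArrays src dst w).Acyclic) (r s : Fin n) (P : List (Fin m))
    (hP : (ofArrays src dst w).IsPath r P s) :
    ∃ (t : ℕ) (τ : Mem),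
      Run ((n + m + 2) ^ (6 * (replacementPaths δ).cost + 8)) (replacementPaths δ)
        (input src dst w r s P) t τ ∧
      t ≤ (6 * (replacementPaths δ).cost + 8) * (n + m) ∧
      ∃ (q : Fin n → ℕ) (d e : Fin n → WithTop ℝ), Function.Injective q ∧
        (ofArrays src dst w).IsDistances r s q d e ∧
        ∀ (i : ℕ) (hi : i < P.length),
          (ofArrays src dst w).IsDetour P q d e δ (q (src P[i])) (τ.warr 1 i) := by
  obtain ⟨G, hG⟩ : ∃ G, G = ofArrays src dst w := ⟨_, rfl⟩
  rw [← hG] at hac hP ⊢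
  have hGs : G.src = src := by rw [hG]; rfl
  have hGd : G.dst = dst := by rw [hG]; rfl
  have hGw : G.weight = w := by rw [hG]; rfl
  have hGe : ∀ e, e ∈ G.edges := fun e => by rw [hG]; trivial
  have hGv : ∀ v, v ∈ G.verts := fun v => by rw [hG]; trivial
  have hn0 : 0 < n := r.pos
  have hpn : P.length + 1 ≤ n := by
    have := hP.2.length_le_card
    simpa [nodes] using this
  -- As there is at least one node, words hold numbers below a power of a number that is at least 3.
  have hB : 100 * (n + m + 2) ≤ (n + m + 2) ^ (6 * (replacementPaths δ).cost + 8) := by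
    calc 100 * (n + m + 2) ≤ 3 ^ 7 * (n + m + 2) := Nat.mul_le_mul_right _ (by norm_num)
      _ ≤ (n + m + 2) ^ 7 * (n + m + 2) :=
        Nat.mul_le_mul_right _ (Nat.pow_le_pow_left (by omega) 7)
      _ = (n + m + 2) ^ 8 := (pow_succ _ _).symm
      _ ≤ _ := Nat.pow_le_pow_right (by omega) (by omega)
  have hw' : ∀ e (h : e < m), (input src dst w r s P).warr 0 e = (w ⟨e, h⟩ : ℝ) := fun e h => by
    simp [input, h]
  have hs' : ∀ e (h : e < m), (input src dst w r s P).arr 0 e = src ⟨e, h⟩ := fun e h => by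
    simp [input, h]
  have hd' : ∀ e (h : e < m), (input src dst w r s P).arr 1 e = dst ⟨e, h⟩ := fun e h => by
    simp [input, h]
  have hP' : ∀ i (h : i < P.length), (input src dst w r s P).arr 2 i = P[i] := fun i h => by
    simp [input, h]
  have hac' : ∀ S : Set ℕ, (∃ v < n, v ∈ S) → ∃ v < n, v ∈ S ∧
      ∀ e < m, (input src dst w r s P).arr 1 e = v → (input src dst w r s P).arr 0 e ∉ S := by
    rintro S ⟨v, hv, hvS⟩
    obtain ⟨u, hu, hmin⟩ := hac.exists_source (S := {v : Fin n | (v : ℕ) ∈ S}) ⟨⟨v, hv⟩, hvS⟩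
    refine ⟨u, u.2, hu, fun e he hev => ?_⟩
    rw [hs' e he]
    rw [hd' e he] at hev
    have := hmin ⟨e, he⟩ (hGe _) (by rw [hGd]; exact Fin.ext hev)
    rwa [hGs] at this
  have hA : ∀ e < m, ∀ x : WithTop ℝ,
      (∃ h : (input src dst w r s P).arr 0 e < n, ∃ es,
        G.IsWalk r es ⟨_, h⟩ ∧ x = (G.pathWeight es : ℝ)) →
      ∃ h : (input src dst w r s P).arr 1 e < n, ∃ es,
        G.IsWalk r es ⟨_, h⟩ ∧ x + (input src dst w r s P).warr 0 e = (G.pathWeight es : ℝ) := by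
    rintro e he x ⟨h, es, hw, rfl⟩
    refine ⟨by rw [hd' e he]; exact Fin.isLt _, es ++ [⟨e, he⟩],
      hw.append ⟨hGe _, ?_, hGv _, ?_⟩, ?_⟩
    · rw [hGs]; exact Fin.ext (hs' e he).symm
    · rw [hGd]; exact Fin.ext (hd' e he).symm
    · rw [hw' e he, pathWeight_append, pathWeight_cons, hGw]
      simp [pathWeight]
  have hA' : ∀ e < m, ∀ x : WithTop ℝ,
      (∃ h : (input src dst w r s P).arr 1 e < n, ∃ es,
        G.IsWalk ⟨_, h⟩ es s ∧ x = (G.pathWeight es : ℝ)) →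
      ∃ h : (input src dst w r s P).arr 0 e < n, ∃ es,
        G.IsWalk ⟨_, h⟩ es s ∧ x + (input src dst w r s P).warr 0 e = (G.pathWeight es : ℝ) := by
    rintro e he x ⟨h, es, hw, rfl⟩
    refine ⟨by rw [hs' e he]; exact Fin.isLt _, ⟨e, he⟩ :: es, ⟨hGe _, ?_, ?_⟩, ?_⟩
    · rw [hGs]; exact Fin.ext (hs' e he).symm
    · rw [hGd]
      convert hw using 1
      exact Fin.ext (hd' e he).symm
    · rw [hw' e he, pathWeight_cons, hGw, WithTop.coe_add, add_comm]
  obtain ⟨t, τ, hrun, ht, pos, eord, D, T, hT, hD, hDT, hout⟩ :=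
    replacementPaths_reaches (B := (n + m + 2) ^ (6 * (replacementPaths δ).cost + 8))
      (S := 3 * (n + m) + 3) (n := n) (m := m) (r := r) (s := s) (p := P.length)
      (σ := input src dst w r s P) le_rfl hB hδ
      (fun x hx => by
        simp only [input]
        rw [if_neg (by omega), if_neg (by omega), if_neg (by omega), if_neg (by omega),
          if_neg (by omega)])
      (fun a ha i => by
        simp only [input]
        rw [if_neg (by omega), if_neg (by omega), if_neg (by omega)])
      rfl rfl rfl rfl rfl rfl rfl rfl rfl
      (fun e he => by rw [hs' e he]; exact Fin.isLt _)
      (fun e he => by rw [hd' e he]; exact Fin.isLt _) r.2 s.2 (by omega)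
      (fun i hi => by rw [hP' i hi]; exact Fin.isLt _) hac'
      (fun v x => ∃ h : v < n, ∃ es, G.IsWalk r es ⟨v, h⟩ ∧ x = (G.pathWeight es : ℝ))
      (fun v x => ∃ h : v < n, ∃ es, G.IsWalk ⟨v, h⟩ es s ∧ x = (G.pathWeight es : ℝ))
      ⟨r.2, [], ⟨hGv _, rfl⟩, by simp [pathWeight]⟩ ⟨s.2, [], ⟨hGv _, rfl⟩, by simp [pathWeight]⟩
      hA hA'
  refine ⟨t, τ, hrun, ht.trans ?_, fun v => pos v, fun v => D v, fun v => T v, ?_, ?_, ?_⟩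
  · rw [mul_comm, add_mul, mul_comm 6, mul_assoc]
    have : (replacementPaths δ).cost * (3 * (n + m) + 3) ≤
        (replacementPaths δ).cost * (6 * (n + m)) := Nat.mul_le_mul_left _ (by omega)
    omega
  · exact fun u v h => Fin.ext (hT.pos_inj _ u.2 _ v.2 h)
  · refine ⟨fun e _ => ?_, hD.1, fun e _ => ?_, fun v => ?_, hDT.1, fun e _ => ?_, fun v => ?_⟩
    · have := hT.pos_src_lt e e.2
      rwa [hs' e e.2, hd' e e.2, ← hGs, ← hGd] at this
    · have := hD.2.1 e e.2
      rwa [hs' e e.2, hd' e e.2, hw' e e.2, ← hGs, ← hGd, ← hGw] at this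
    · exact (hD.2.2 v v.2).imp_right fun ⟨_, h⟩ => h
    · have := hDT.2.1 e e.2
      rwa [hs' e e.2, hd' e e.2, hw' e e.2, ← hGs, ← hGd, ← hGw] at this
    · exact (hDT.2.2 v v.2).imp_right fun ⟨_, h⟩ => h
  · intro i hi
    have hmem : ∀ e : Fin m,
        (∀ j < P.length, (input src dst w r s P).arr 2 j ≠ e) ↔ e ∉ P := by
      intro e
      constructor
      · intro h he
        obtain ⟨j, hj, rfl⟩ := List.mem_iff_getElem.1 he
        exact h j hj (hP' j hj)
      · intro h j hj hje
        rw [hP' j hj] at hje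
        exact h (Fin.ext hje ▸ List.getElem_mem hj)
    have hsi : (input src dst w r s P).arr 0 ((input src dst w r s P).arr 2 i) = src P[i] := by
      rw [hP' i hi, hs' _ (Fin.isLt _)]
    have hI := hout i hi
    rw [hsi] at hI
    constructor
    · rintro e ⟨-, he, h1, h2⟩
      rw [hGs] at h1
      rw [hGd] at h2
      have := (hI (τ.warr 1 i)).1 le_rfl e ⟨e.2, by rw [hs' e e.2]; exact h1,
        by rw [hd' e e.2]; exact h2⟩
      beta_reduce at this
      rwa [if_pos ((hmem e).2 he), hs' e e.2, hd' e e.2, hw' e e.2, ← hGs, ← hGd, ← hGw] at this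
    · obtain h | ⟨e, ⟨he, h1, h2⟩, h⟩ := hI.eq_top_or (fun k hk => hk.1)
      · exact .inl h
      · lift e to Fin m using he
        by_cases heP : e ∈ P
        · left
          rw [h, if_neg]
          exact fun h => (hmem e).1 h heP
        · right
          rw [if_pos ((hmem e).2 heP), hs' e e.2, hd' e e.2, hw' e e.2] at h
          rw [hs' e e.2] at h1
          rw [hd' e e.2] at h2
          exact ⟨e, ⟨hGe e, heP, by rw [hGs]; exact h1, by rw [hGd]; exact h2⟩,
            by rw [hGs, hGd, hGw]; exact h⟩

theorem theorem2 :
    (∃ (p : RAM.Prog) (c : ℕ), 1 ≤ c ∧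
      ∀ (n m : ℕ) (src dst : Fin m → Fin n) (w : Fin m → ℝ),
        (WDigraph.ofArrays src dst w).Acyclic →
        ∀ (r s : Fin n) (P : List (Fin m)),
          (WDigraph.ofArrays src dst w).IsShortestPath r P s →
          ∃ (t : ℕ) (τ : RAM.Mem),
            RAM.Run ((n + m + 2) ^ c) p (RAM.input src dst w r s P) t τ ∧
            t ≤ c * (n + m) ∧
            SolvesEdgeAvoiding (WDigraph.ofArrays src dst w) r s P τ) ∧
    (∃ (p : RAM.Prog) (c : ℕ), 1 ≤ c ∧
      ∀ (n m : ℕ) (src dst : Fin m → Fin n) (w : Fin m → ℝ),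
        (WDigraph.ofArrays src dst w).Acyclic →
        ∀ (r s : Fin n) (P : List (Fin m)),
          (WDigraph.ofArrays src dst w).IsShortestPath r P s →
          ∃ (t : ℕ) (τ : RAM.Mem),
            RAM.Run ((n + m + 2) ^ c) p (RAM.input src dst w r s P) t τ ∧
            t ≤ c * (n + m) ∧
            SolvesNodeAvoiding (WDigraph.ofArrays src dst w) r s P τ) := by
  refine ⟨⟨replacementPaths 0, 6 * (replacementPaths 0).cost + 8, by omega,
      fun n m src dst w hac r s P hP => ?_⟩,
    ⟨replacementPaths 1, 6 * (replacementPaths 1).cost + 8, by omega,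
      fun n m src dst w hac r s P hP => ?_⟩⟩
  · obtain ⟨t, τ, hrun, ht, q, d, e, -, hG, hout⟩ :=
      replacementPaths_run 0 (by omega) src dst w hac r s P hP.1
    exact ⟨t, τ, hrun, ht, fun i hi => (hout i hi).isDist_deleteEdge hG hP.1.1 trivial hi⟩
  · obtain ⟨t, τ, hrun, ht, q, d, e, hinj, hG, hout⟩ :=
      replacementPaths_run 1 le_rfl src dst w hac r s P hP.1
    refine ⟨t, τ, hrun, ht, fun i hi hir his => ?_⟩
    have hi' : i < P.length := by
      refine lt_of_le_of_ne (by simpa [nodes, Nat.lt_succ_iff] using hi) ?_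
      rintro rfl
      exact his (nodes_getElem_length hP.1.1)
    rw [nodes_getElem_of_lt hP.1.1 hi'] at hir ⊢
    exact (hout i hi').isDist_deleteNode hG hinj hP.1.1 trivial hi' hir
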